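/- Let $R$ be a commutative ring. A *tensor category* (over $R$) is a locally finitely presentable (in particular cocomplete), closed symmetric monoidal $R$-linear category whose tensor product is $R$-bilinear, whose unit object is finitely presentable, and whose finitely presentable objects are closed under the tensor product. A *tensor functor* is an $R$-linear symmetric strong monoidal functor which has a right adjoint. Let $\mathcal{T}$ be the 2-category of tensor categories, tensor functors and symmetric monoidal natural transformations. For a commutative algebra $A$ in a tensor category $\mathcal{C}$, let $\mathcal{C}_A$ be the category of $A$-modules in $\mathcal{C}$, with tensor product $M \otimes_A N$ the coequalizer of the two actions of $A$ on $M \otimes N$. Let $F \colon \mathcal{C} \to \mathcal{D}$ be a tensor functor, and let $A \in \mathcal{C}$ be a commutative algebra. Then $\mathcal{C}_A$ and $\mathcal{D}_{FA}$ are tensor categories, the functor $\overline{F} \colon \mathcal{C}_A \to \mathcal{D}_{FA}$ which sends an $A$-module $M$ to the $FA$-module $FM$ is a tensor functor, and the square $$\begin{array}{ccc} \mathcal{C}_A & \xrightarrow{\ \overline{F}\ } & \mathcal{D}_{FA} \\ {\scriptstyle A \otimes -}\big\uparrow & & \big\uparrow{\scriptstyle FA \otimes -} \\ \mathcal{C}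 & \xrightarrow{\ F\ } & \mathcal{D} \end{array}$$ which commutes up to the canonical isomorphism $F(A \otimes X) \cong FA \otimes FX$, is a bicategorical pushout in $\mathcal{T}$. That is, for every tensor category $\mathcal{E}$, the functor which sends $H$ to $(H\overline{F},\ H \circ (FA \otimes -))$ with the induced isomorphism is an equivalence from $\mathcal{T}(\mathcal{D}_{FA}, \mathcal{E})$ to the category of triples $(K, L, \sigma)$ of tensor functors $K \colon \mathcal{C}_A \to \mathcal{E}$ and $L \colon \mathcal{D} \to \mathcal{E}$ and an isomorphism $\sigma \colon K \circ (A \otimes -) \cong L \circ F$ of tensor functors, whose morphisms are the pairs of symmetric monoidal natural transformations compatible with the isomorphisms. -/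

import Mathlib

open CategoryTheory Category MonoidalCategory Limits
open scoped CategoryTheory.Obj

universe v u v' u'

noncomputable section

namespace TensorCategories

/-! ### The category of modules of an algebra -/

section Modules

variable {C : Type u} [Category.{v} C] [MonoidalCategory C]

section Basic

open scoped MonObj

variable {A : C} [MonObj A]

/-- The action `A ⊗ M ⟶ M` of an `A`-module `M`. -/
def act (M : Mod C A) : A ⊗ M.X ⟶ M.X := ModObj.smul (M := A) (X := M.X)

lemma one_act (M : Mod C A) : η[A] ▷ M.X ≫ act M = (λ_ M.X).hom :=
  ModObj.one_smul (M := A) M.X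

lemma mul_act (M : Mod C A) :
    μ[A] ▷ M.X ≫ act M = (α_ A A M.X).hom ≫ A ◁ act M ≫ act M :=
  ModObj.mul_smul (M := A) M.X

lemma act_hom {M N : Mod C A} (f : M ⟶ N) : act M ≫ f.hom = A ◁ f.hom ≫ act N :=
  IsModHom.smul_hom (A := A) (f := f.hom)

lemma act_hom_assoc {M N : Mod C A} (f : M ⟶ N) {Z : C} (g : N.X ⟶ Z) :
    act M ≫ f.hom ≫ g = A ◁ f.hom ≫ act N ≫ g := by
  rw [← Category.assoc, act_hom, Category.assoc]

/-- Constructor for modules. -/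
def mkMod (X : C) (a : A ⊗ X ⟶ X) (h₁ : η[A] ▷ X ≫ a = (λ_ X).hom)
    (h₂ : μ[A] ▷ X ≫ a = (α_ A A X).hom ≫ A ◁ a ≫ a) : Mod C A :=
  letI : ModObj A X := { smul := a, one_smul := h₁, mul_smul := h₂ }
  ⟨X⟩

/-- Constructor for morphisms of modules. -/
def mkHom {M N : Mod C A} (f : M.X ⟶ N.X) (h : act M ≫ f = A ◁ f ≫ act N) : M ⟶ N :=
  Mod.Hom.mk' f h

@[simp] lemma mkHom_hom {M N : Mod C A} (f : M.X ⟶ N.X) (h : act M ≫ f = A ◁ f ≫ act N) :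
    (mkHom f h).hom = f := rfl

/-- Constructor for isomorphisms of modules. -/
def mkIso {M N : Mod C A} (f : M.X ≅ N.X) (h : act M ≫ f.hom = A ◁ f.hom ≫ act N) : M ≅ N where
  hom := mkHom f.hom h
  inv := mkHom f.inv (by
    rw [← cancel_mono f.hom, Category.assoc, Category.assoc, f.inv_hom_id, h,
      ← MonoidalCategory.whiskerLeft_comp_assoc, f.inv_hom_id]
    simp)
  hom_inv_id := Mod.hom_ext _ _ (by simp)
  inv_hom_id := Mod.hom_ext _ _ (by simp)

variable (A) in
@[simp] lemma act_regular : act (Mod.regular A) = μ[A] := rfl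

end Basic

section Linear

variable {A : C} [MonObj A] [Preadditive C] [MonoidalPreadditive C]

instance (M N : Mod C A) : Zero (M ⟶ N) := ⟨mkHom 0 (by simp)⟩
instance (M N : Mod C A) : Add (M ⟶ N) := ⟨fun f g => mkHom (f.hom + g.hom) (by simp [act_hom])⟩
instance (M N : Mod C A) : Neg (M ⟶ N) :=
  ⟨fun f => mkHom (-f.hom) (by
    rw [Preadditive.comp_neg, act_hom, ← Preadditive.neg_comp]
    congr 1
    exact (((tensorLeft A).map_neg (f := f.hom))).symm)⟩
instance (M N : Mod C A) : Sub (M ⟶ N) :=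
  ⟨fun f g => mkHom (f.hom - g.hom) (by
    rw [Preadditive.comp_sub, act_hom, act_hom, ← Preadditive.sub_comp]
    congr 1
    exact (((tensorLeft A).map_sub (f := f.hom) (g := g.hom))).symm)⟩
instance (M N : Mod C A) : SMul ℕ (M ⟶ N) :=
  ⟨fun n f => mkHom (n • f.hom) (by
    rw [Preadditive.comp_nsmul, act_hom, ← Preadditive.nsmul_comp]
    congr 1
    exact (((tensorLeft A).map_nsmul (f := f.hom) (n := n))).symm)⟩
instance (M N : Mod C A) : SMul ℤ (M ⟶ N) :=
  ⟨fun n f => mkHom (n • f.hom) (by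
    rw [Preadditive.comp_zsmul, act_hom, ← Preadditive.zsmul_comp]
    congr 1
    exact (((tensorLeft A).map_zsmul (f := f.hom) (r := n))).symm)⟩

@[simp] lemma zero_hom (M N : Mod C A) : (0 : M ⟶ N).hom = 0 := rfl
@[simp] lemma add_hom {M N : Mod C A} (f g : M ⟶ N) : (f + g).hom = f.hom + g.hom := rfl

instance (M N : Mod C A) : AddCommGroup (M ⟶ N) :=
  Function.Injective.addCommGroup (fun f : M ⟶ N => f.hom) (fun _ _ h => Mod.hom_ext _ _ h)
    rfl (fun _ _ => rfl) (fun _ => rfl) (fun _ _ => rfl) (fun _ _ => rfl) (fun _ _ => rfl)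

/-- Morphisms of modules are added as morphisms of the underlying category. -/
instance : Preadditive (Mod C A) where
  add_comp _ _ _ _ _ _ := by ext; simp
  comp_add _ _ _ _ _ _ := by ext; simp

variable {R : Type*} [CommRing R] [CategoryTheory.Linear R C] [MonoidalLinear R C]

instance (M N : Mod C A) : SMul R (M ⟶ N) :=
  ⟨fun r f => mkHom (r • f.hom) (by simp [act_hom])⟩

@[simp] lemma smul_hom {M N : Mod C A} (r : R) (f : M ⟶ N) : (r • f).hom = r • f.hom := rfl

/-- The forgetful map on morphisms is additive. -/
def homAddHom (M N : Mod C A) : (M ⟶ N) →+ (M.X ⟶ N.X) where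
  toFun f := f.hom
  map_zero' := rfl
  map_add' _ _ := rfl

instance (M N : Mod C A) : Module R (M ⟶ N) :=
  Function.Injective.module R (homAddHom M N) (fun _ _ h => Mod.hom_ext _ _ h)
    (fun _ _ => rfl)

instance : CategoryTheory.Linear R (Mod C A) where
  smul_comp _ _ _ _ _ _ := by ext; simp
  comp_smul _ _ _ _ _ _ := by ext; simp

end Linear

end Modules

/-! ### The relative tensor product of modules of a commutative algebra -/

section RelativeTensor

open scoped MonObj

variable {C : Type u} [Category.{v} C] [MonoidalCategory C] [SymmetricCategory C]
set_option linter.unusedSectionVars false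

section Actions

variable {A : C} [MonObj A]

/-- The canonical isomorphism `X ⊗ (Y ⊗ Z) ⟶ Y ⊗ (X ⊗ Z)`. -/
def swp (X Y Z : C) : X ⊗ (Y ⊗ Z) ⟶ Y ⊗ (X ⊗ Z) :=
  (α_ X Y Z).inv ≫ (β_ X Y).hom ▷ Z ≫ (α_ Y X Z).hom

lemma swp_swp (X Y Z : C) : swp X Y Z ≫ swp Y X Z = 𝟙 _ := by
  simp [swp, ← comp_whiskerRight_assoc]

lemma swp_swp_assoc (X Y Z : C) {W : C} (h : X ⊗ (Y ⊗ Z) ⟶ W) :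
    swp X Y Z ≫ swp Y X Z ≫ h = h := by
  rw [← Category.assoc, swp_swp, Category.id_comp]

lemma bb₁ (X Y Z : C) {W : C} (h : (X ⊗ Y) ⊗ Z ⟶ W) :
    (β_ X Y).hom ▷ Z ≫ (β_ Y X).hom ▷ Z ≫ h = h := by
  rw [← comp_whiskerRight_assoc]; simp

lemma bb₂ (X Y Z V : C) {W : C} (h : ((X ⊗ Y) ⊗ Z) ⊗ V ⟶ W) :
    (β_ X Y).hom ▷ Z ▷ V ≫ (β_ Y X).hom ▷ Z ▷ V ≫ h = h := by
  rw [← comp_whiskerRight_assoc, ← comp_whiskerRight]; simp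

lemma bb₃ (X Y Z V : C) {W : C} (h : V ⊗ ((X ⊗ Y) ⊗ Z) ⟶ W) :
    V ◁ (β_ X Y).hom ▷ Z ≫ V ◁ (β_ Y X).hom ▷ Z ≫ h = h := by
  rw [← MonoidalCategory.whiskerLeft_comp_assoc, ← comp_whiskerRight]; simp

lemma bb₄ (X Y V : C) {W : C} (h : V ⊗ (X ⊗ Y) ⟶ W) :
    V ◁ (β_ X Y).hom ≫ V ◁ (β_ Y X).hom ≫ h = h := by
  rw [← MonoidalCategory.whiskerLeft_comp_assoc]; simp

lemma swp_nat_left {X X' Y Z : C} (f : X ⟶ X') :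
    f ▷ (Y ⊗ Z) ≫ swp X' Y Z = swp X Y Z ≫ Y ◁ f ▷ Z := by
  simp only [swp, Category.assoc, associator_inv_naturality_left_assoc]
  rw [← comp_whiskerRight_assoc, BraidedCategory.braiding_naturality_left]
  simp

/-- The action of `A` on `M ⊗ N` through the first factor. -/
def actL (M N : Mod C A) : A ⊗ (M.X ⊗ N.X) ⟶ M.X ⊗ N.X :=
  (α_ A M.X N.X).inv ≫ act M ▷ N.X

/-- The action of `A` on `M ⊗ N` through the second factor. -/
def actR (M N : Mod C A) : A ⊗ (M.X ⊗ N.X) ⟶ M.X ⊗ N.X :=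
  swp A M.X N.X ≫ M.X ◁ act N

lemma one_actL (M N : Mod C A) : η[A] ▷ (M.X ⊗ N.X) ≫ actL M N = (λ_ _).hom := by
  simp only [actL, whiskerRight_tensor, Category.assoc, Iso.hom_inv_id_assoc,
    ← comp_whiskerRight, one_act]
  monoidal

lemma mul_actL (M N : Mod C A) : μ[A] ▷ (M.X ⊗ N.X) ≫ actL M N =
    (α_ _ _ _).hom ≫ A ◁ actL M N ≫ actL M N := by
  simp only [actL, whiskerRight_tensor, Category.assoc, Iso.hom_inv_id_assoc,
    ← comp_whiskerRight, mul_act]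
  monoidal

lemma swp_nat_mid {X Y Y' Z : C} (f : Y ⟶ Y') :
    X ◁ f ▷ Z ≫ swp X Y' Z = swp X Y Z ≫ f ▷ (X ⊗ Z) := by
  simp only [swp, Category.assoc, associator_inv_naturality_middle_assoc]
  rw [← comp_whiskerRight_assoc, BraidedCategory.braiding_naturality_right]
  simp

lemma swp_tensor (X W Y Z : C) :
    X ◁ swp W Y Z ≫ (α_ X Y (W ⊗ Z)).inv =
      swp X W (Y ⊗ Z) ≫ W ◁ (α_ X Y Z).inv ≫ swp W (X ⊗ Y) Z := by
  have h : (β_ X W).hom ▷ Y ▷ Z ≫ (β_ W X).hom ▷ Y ▷ Z = 𝟙 _ := by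
    simp [← comp_whiskerRight]
  simp [swp, reassoc_of% h]

lemma actL_actR (M N : Mod C A) :
    A ◁ actR M N ≫ actL M N = swp A A _ ≫ A ◁ actL M N ≫ actR M N := by
  simp only [actL, actR, MonoidalCategory.whiskerLeft_comp, Category.assoc]
  rw [← Category.assoc (A ◁ act M ▷ N.X), swp_nat_mid]
  simp only [Category.assoc]
  rw [← whisker_exchange, ← reassoc_of% swp_tensor A A M.X N.X]
  simp

lemma actL_actL [IsCommMonObj A] (M N : Mod C A) :
    A ◁ actL M N ≫ actL M N = swp A A _ ≫ A ◁ actL M N ≫ actL M N := by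
  have h := mul_actL M N
  have h' : (β_ A A).hom ▷ (M.X ⊗ N.X) ≫ μ[A] ▷ (M.X ⊗ N.X) = μ[A] ▷ (M.X ⊗ N.X) := by
    rw [← comp_whiskerRight, IsCommMonObj.mul_comm]
  rw [swp, Category.assoc, Category.assoc, ← h, reassoc_of% h', h]
  simp

end Actions

variable [HasCoequalizers C]
  [∀ X : C, PreservesColimitsOfShape WalkingParallelPair (tensorLeft X)]

instance (X : C) : PreservesColimitsOfShape WalkingParallelPair (tensorRight X) where
  preservesColimit := inferInstance

section

variable {X Y : C} (f g : X ⟶ Y) (Z : C)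

instance epi_whiskerLeft_π : Epi (Z ◁ coequalizer.π f g) :=
  inferInstanceAs (Epi ((tensorLeft Z).map (coequalizer.π f g)))

instance epi_whiskerRight_π : Epi (coequalizer.π f g ▷ Z) :=
  inferInstanceAs (Epi ((tensorRight Z).map (coequalizer.π f g)))

lemma exists_desc_whiskerLeft {W : C} (h : Z ⊗ Y ⟶ W) (w : Z ◁ f ≫ h = Z ◁ g ≫ h) :
    ∃ k : Z ⊗ coequalizer f g ⟶ W, Z ◁ coequalizer.π f g ≫ k = h :=
  ⟨_, (Cofork.IsColimit.desc' (isColimitOfHasCoequalizerOfPreservesColimit (tensorLeft Z) f g)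
    h w).2⟩

lemma exists_desc_whiskerRight {W : C} (h : Y ⊗ Z ⟶ W) (w : f ▷ Z ≫ h = g ▷ Z ≫ h) :
    ∃ k : coequalizer f g ⊗ Z ⟶ W, coequalizer.π f g ▷ Z ≫ k = h :=
  ⟨_, (Cofork.IsColimit.desc' (isColimitOfHasCoequalizerOfPreservesColimit (tensorRight Z) f g)
    h w).2⟩

end

variable {A : C} [MonObj A] [IsCommMonObj A]

/-- The action of `A` on the coequalizer of the two actions of `A` on `M ⊗ N`. -/
def tensorAct (M N : Mod C A) :
    A ⊗ coequalizer (actL M N) (actR M N) ⟶ coequalizer (actL M N) (actR M N) :=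
  (exists_desc_whiskerLeft (actL M N) (actR M N) A
    (actL M N ≫ coequalizer.π (actL M N) (actR M N)) (by
      rw [← Category.assoc, ← Category.assoc, actL_actL, actL_actR]
      simp only [Category.assoc]
      rw [coequalizer.condition])).choose

lemma π_tensorAct (M N : Mod C A) :
    A ◁ coequalizer.π (actL M N) (actR M N) ≫ tensorAct M N =
      actL M N ≫ coequalizer.π (actL M N) (actR M N) :=
  (exists_desc_whiskerLeft (actL M N) (actR M N) A
    (actL M N ≫ coequalizer.π (actL M N) (actR M N)) (by
      rw [← Category.assoc, ← Category.assoc, actL_actL, actL_actR]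
      simp only [Category.assoc]
      rw [coequalizer.condition])).choose_spec

/-- The relative tensor product `M ⊗_A N`: the coequalizer of the two actions of `A` on
`M ⊗ N`, with the action of `A` induced by either of them. -/
def relTensor (M N : Mod C A) : Mod C A :=
  mkMod (coequalizer (actL M N) (actR M N)) (tensorAct M N)
    (by
      rw [← cancel_epi (𝟙_ C ◁ coequalizer.π (actL M N) (actR M N)), whisker_exchange_assoc,
        π_tensorAct, ← Category.assoc, one_actL]
      simp)
    (by
      rw [← cancel_epi ((A ⊗ A) ◁ coequalizer.π (actL M N) (actR M N)), whisker_exchange_assoc,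
        π_tensorAct, ← Category.assoc, mul_actL]
      simp only [Category.assoc, tensor_whiskerLeft, Iso.inv_hom_id_assoc]
      rw [← MonoidalCategory.whiskerLeft_comp_assoc, π_tensorAct]
      simp [π_tensorAct])

/-- The canonical morphism `M ⊗ N ⟶ M ⊗_A N`. -/
def q (M N : Mod C A) : M.X ⊗ N.X ⟶ (relTensor M N).X :=
  coequalizer.π (actL M N) (actR M N)

instance (M N : Mod C A) : Epi (q M N) :=
  inferInstanceAs (Epi (coequalizer.π (actL M N) (actR M N)))
instance (M N : Mod C A) (Z : C) : Epi (Z ◁ q M N) := epi_whiskerLeft_π _ _ _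
instance (M N : Mod C A) (Z : C) : Epi (q M N ▷ Z) := epi_whiskerRight_π _ _ _
instance (M N : Mod C A) (Z W : C) : Epi (Z ◁ q M N ▷ W) :=
  inferInstanceAs (Epi ((tensorRight W ⋙ tensorLeft Z).map (coequalizer.π _ _)))
instance (M N : Mod C A) (Z W : C) : Epi (Z ◁ W ◁ q M N) :=
  inferInstanceAs (Epi ((tensorLeft W ⋙ tensorLeft Z).map (coequalizer.π _ _)))
instance (M N : Mod C A) (Z W : C) : Epi (q M N ▷ Z ▷ W) :=
  inferInstanceAs (Epi ((tensorRight Z ⋙ tensorRight W).map (coequalizer.π _ _)))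

lemma actL_q (M N : Mod C A) : actL M N ≫ q M N = A ◁ q M N ≫ act (relTensor M N) :=
  (π_tensorAct M N).symm

lemma actR_q (M N : Mod C A) : actR M N ≫ q M N = A ◁ q M N ≫ act (relTensor M N) :=
  (coequalizer.condition _ _).symm.trans (actL_q M N)

lemma whiskerRight_act_q (M N : Mod C A) :
    act M ▷ N.X ≫ q M N = (α_ _ _ _).hom ≫ A ◁ q M N ≫ act (relTensor M N) := by
  rw [← actL_q]; simp [actL]

lemma whiskerLeft_act_q (M N : Mod C A) :
    M.X ◁ act N ≫ q M N = swp M.X A N.X ≫ A ◁ q M N ≫ act (relTensor M N) := by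
  rw [← actR_q, actR]
  simp only [← Category.assoc, swp_swp, Category.id_comp]

lemma relTensor_hom_ext {M N P : Mod C A} {f g : relTensor M N ⟶ P}
    (h : q M N ≫ f.hom = q M N ≫ g.hom) : f = g :=
  Mod.hom_ext _ _ ((cancel_epi _).1 h)

/-- Balanced morphisms `M ⊗ N ⟶ Z` descend to `M ⊗_A N`. -/
def relDescAux {M N : Mod C A} {Z : C} (f : M.X ⊗ N.X ⟶ Z)
    (h : actL M N ≫ f = actR M N ≫ f) : (relTensor M N).X ⟶ Z :=
  coequalizer.desc f h

lemma q_relDescAux {M N : Mod C A} {Z : C} (f : M.X ⊗ N.X ⟶ Z)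
    (h : actL M N ≫ f = actR M N ≫ f) : q M N ≫ relDescAux f h = f :=
  coequalizer.π_desc _ _

/-- `A`-bilinear morphisms `M ⊗ N ⟶ P` descend to `M ⊗_A N`. -/
def relDesc {M N P : Mod C A} (f : M.X ⊗ N.X ⟶ P.X)
    (hl : actL M N ≫ f = A ◁ f ≫ act P) (hr : actR M N ≫ f = A ◁ f ≫ act P) :
    relTensor M N ⟶ P :=
  mkHom (relDescAux f (hl.trans hr.symm)) (by
    rw [← cancel_epi (A ◁ q M N), ← Category.assoc, ← actL_q, Category.assoc, q_relDescAux,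
      ← MonoidalCategory.whiskerLeft_comp_assoc, q_relDescAux]
    exact hl)

@[simp] lemma q_relDesc {M N P : Mod C A} (f : M.X ⊗ N.X ⟶ P.X)
    (hl : actL M N ≫ f = A ◁ f ≫ act P) (hr : actR M N ≫ f = A ◁ f ≫ act P) :
    q M N ≫ (relDesc f hl hr).hom = f :=
  q_relDescAux f _

@[simp] lemma q_relDesc_assoc {M N P : Mod C A} (f : M.X ⊗ N.X ⟶ P.X)
    (hl : actL M N ≫ f = A ◁ f ≫ act P) (hr : actR M N ≫ f = A ◁ f ≫ act P) {Z : C}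
    (g : P.X ⟶ Z) : q M N ≫ (relDesc f hl hr).hom ≫ g = f ≫ g := by
  rw [← Category.assoc, q_relDesc]

lemma actL_map {M M' N N' : Mod C A} (f : M ⟶ M') (g : N ⟶ N') :
    actL M N ≫ (f.hom ⊗ₘ g.hom) = A ◁ (f.hom ⊗ₘ g.hom) ≫ actL M' N' := by
  simp only [actL, MonoidalCategory.tensorHom_def, Category.assoc, MonoidalCategory.whiskerLeft_comp]
  rw [← comp_whiskerRight_assoc, act_hom, comp_whiskerRight_assoc, ← whisker_exchange]
  simp

lemma swp_nat_right {X Y Z Z' : C} (f : Z ⟶ Z') :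
    X ◁ Y ◁ f ≫ swp X Y Z' = swp X Y Z ≫ Y ◁ X ◁ f := by
  simp only [swp, Category.assoc, associator_inv_naturality_right_assoc]
  rw [whisker_exchange_assoc]
  simp

lemma actR_map {M M' N N' : Mod C A} (f : M ⟶ M') (g : N ⟶ N') :
    actR M N ≫ (f.hom ⊗ₘ g.hom) = A ◁ (f.hom ⊗ₘ g.hom) ≫ actR M' N' := by
  simp only [actR, tensorHom_def', Category.assoc, MonoidalCategory.whiskerLeft_comp]
  rw [← MonoidalCategory.whiskerLeft_comp_assoc, act_hom,
    MonoidalCategory.whiskerLeft_comp_assoc, reassoc_of% swp_nat_mid f.hom,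
    reassoc_of% swp_nat_right g.hom, whisker_exchange]

/-- The relative tensor product of morphisms of modules. -/
def relMap {M M' N N' : Mod C A} (f : M ⟶ M') (g : N ⟶ N') :
    relTensor M N ⟶ relTensor M' N' :=
  relDesc ((f.hom ⊗ₘ g.hom) ≫ q M' N')
    (by rw [← Category.assoc, actL_map, Category.assoc, actL_q]; simp)
    (by rw [← Category.assoc, actR_map, Category.assoc, actR_q]; simp)

lemma q_relMap {M M' N N' : Mod C A} (f : M ⟶ M') (g : N ⟶ N') :
    q M N ≫ (relMap f g).hom = (f.hom ⊗ₘ g.hom) ≫ q M' N' :=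
  q_relDesc _ _ _

section Trilinear

variable {M N P Q : Mod C A}

lemma exists_relDesc₃ (f : (M.X ⊗ N.X) ⊗ P.X ⟶ Q.X)
    (h₁ : (α_ _ _ _).inv ≫ actL M N ▷ P.X ≫ f = A ◁ f ≫ act Q)
    (h₂ : (α_ _ _ _).inv ≫ actR M N ▷ P.X ≫ f = A ◁ f ≫ act Q)
    (h₃ : swp _ _ _ ≫ (M.X ⊗ N.X) ◁ act P ≫ f = A ◁ f ≫ act Q) :
    ∃ g : relTensor (relTensor M N) P ⟶ Q, q M N ▷ P.X ≫ q _ P ≫ g.hom = f := by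
  obtain ⟨k, hk⟩ := exists_desc_whiskerRight (actL M N) (actR M N) P.X f (by
    rw [← cancel_epi (α_ A (M.X ⊗ N.X) P.X).inv, h₁, h₂])
  change (relTensor M N).X ⊗ P.X ⟶ Q.X at k
  change q M N ▷ P.X ≫ k = f at hk
  refine ⟨relDesc k ?_ ?_, by rw [q_relDesc, hk]⟩
  · rw [← cancel_epi (A ◁ q M N ▷ P.X), ← MonoidalCategory.whiskerLeft_comp_assoc, hk, ← h₁, actL,
      Category.assoc, associator_inv_naturality_middle_assoc, ← comp_whiskerRight_assoc, ← actL_q,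
      comp_whiskerRight_assoc, hk]
  · rw [← cancel_epi (A ◁ q M N ▷ P.X), ← MonoidalCategory.whiskerLeft_comp_assoc, hk, ← h₃, actR,
      Category.assoc, reassoc_of% swp_nat_mid (q M N), ← whisker_exchange_assoc, hk]

lemma exists_relDesc₃' (f : M.X ⊗ (N.X ⊗ P.X) ⟶ Q.X)
    (h₁ : (α_ _ _ _).inv ≫ act M ▷ (N.X ⊗ P.X) ≫ f = A ◁ f ≫ act Q)
    (h₂ : swp _ _ _ ≫ M.X ◁ actL N P ≫ f = A ◁ f ≫ act Q)
    (h₃ : swp _ _ _ ≫ M.X ◁ actR N P ≫ f = A ◁ f ≫ act Q) :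
    ∃ g : relTensor M (relTensor N P) ⟶ Q, M.X ◁ q N P ≫ q M _ ≫ g.hom = f := by
  obtain ⟨k, hk⟩ := exists_desc_whiskerLeft (actL N P) (actR N P) M.X f (by
    have : IsIso (swp A M.X (N.X ⊗ P.X)) := ⟨swp _ _ _, swp_swp _ _ _, swp_swp _ _ _⟩
    rw [← cancel_epi (swp A M.X (N.X ⊗ P.X)), h₂, h₃])
  change M.X ⊗ (relTensor N P).X ⟶ Q.X at k
  change M.X ◁ q N P ≫ k = f at hk
  refine ⟨relDesc k ?_ ?_, by rw [q_relDesc, hk]⟩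
  · rw [← cancel_epi (A ◁ M.X ◁ q N P), ← MonoidalCategory.whiskerLeft_comp_assoc, hk, ← h₁, actL,
      Category.assoc, associator_inv_naturality_right_assoc, whisker_exchange_assoc, hk]
  · rw [← cancel_epi (A ◁ M.X ◁ q N P), ← MonoidalCategory.whiskerLeft_comp_assoc, hk, ← h₂, actR,
      Category.assoc, reassoc_of% swp_nat_right (q N P), ← MonoidalCategory.whiskerLeft_comp_assoc,
      ← actL_q, MonoidalCategory.whiskerLeft_comp_assoc, hk]

lemma hom_ext₃ {f g : relTensor (relTensor M N) P ⟶ Q}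
    (h : q M N ▷ P.X ≫ q _ P ≫ f.hom = q M N ▷ P.X ≫ q _ P ≫ g.hom) : f = g :=
  relTensor_hom_ext ((cancel_epi (q M N ▷ P.X)).1 h)

lemma hom_ext₃' {f g : relTensor M (relTensor N P) ⟶ Q}
    (h : M.X ◁ q N P ≫ q M _ ≫ f.hom = M.X ◁ q N P ≫ q M _ ≫ g.hom) : f = g :=
  relTensor_hom_ext ((cancel_epi (M.X ◁ q N P)).1 h)

variable (M N P)

lemma exists_assoc_hom : ∃ g : relTensor (relTensor M N) P ⟶ relTensor M (relTensor N P),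
    q M N ▷ P.X ≫ q _ P ≫ g.hom = (α_ _ _ _).hom ≫ M.X ◁ q N P ≫ q M _ := by
  apply exists_relDesc₃
  · simp only [actL, comp_whiskerRight, Category.assoc, associator_naturality_left_assoc]
    rw [← whisker_exchange_assoc, whiskerRight_act_q]
    simp
  · simp only [actR, comp_whiskerRight, Category.assoc, associator_naturality_middle_assoc]
    rw [← MonoidalCategory.whiskerLeft_comp_assoc, whiskerRight_act_q]
    simp only [MonoidalCategory.whiskerLeft_comp, Category.assoc]
    rw [whiskerLeft_act_q, reassoc_of% swp_nat_right (q N P)]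
    simp [swp, bb₂]
  · simp only [associator_naturality_right_assoc]
    rw [← MonoidalCategory.whiskerLeft_comp_assoc, whiskerLeft_act_q]
    simp only [MonoidalCategory.whiskerLeft_comp, Category.assoc]
    rw [whiskerLeft_act_q, reassoc_of% swp_nat_right (q N P)]
    simp [swp, bb₂, bb₃]

lemma exists_assoc_inv : ∃ g : relTensor M (relTensor N P) ⟶ relTensor (relTensor M N) P,
    M.X ◁ q N P ≫ q M _ ≫ g.hom = (α_ _ _ _).inv ≫ q M N ▷ P.X ≫ q _ P := by
  apply exists_relDesc₃'
  · simp only [associator_inv_naturality_left_assoc]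
    rw [← comp_whiskerRight_assoc, whiskerRight_act_q]
    simp only [comp_whiskerRight, Category.assoc]
    rw [whiskerRight_act_q]
    simp
  · simp only [actL, MonoidalCategory.whiskerLeft_comp, Category.assoc,
      associator_inv_naturality_middle_assoc]
    rw [← comp_whiskerRight_assoc, whiskerLeft_act_q]
    simp only [comp_whiskerRight, Category.assoc]
    rw [whiskerRight_act_q]
    simp [swp, bb₂]
  · simp only [actR, MonoidalCategory.whiskerLeft_comp, Category.assoc,
      associator_inv_naturality_right_assoc]
    rw [whisker_exchange_assoc, whiskerLeft_act_q]
    rw [reassoc_of% swp_nat_left (q M N)]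
    simp [swp, bb₂, bb₃]

end Trilinear

lemma actL_regular (M : Mod C A) :
    actL (Mod.regular A) M = (α_ A A M.X).inv ≫ μ[A] ▷ M.X := rfl

lemma actR_regular (M : Mod C A) :
    actR (Mod.regular A) M = swp A A M.X ≫ A ◁ act M := rfl

/-- The canonical morphism `A ⊗ M ⟶ A ⊗_A M`. -/
def qr (M : Mod C A) : A ⊗ M.X ⟶ (relTensor (Mod.regular A) M).X := q (Mod.regular A) M

instance (M : Mod C A) : Epi (qr M) := inferInstanceAs (Epi (q (Mod.regular A) M))

lemma whiskerLeft_act_qr (M : Mod C A) :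
    A ◁ act M ≫ qr M = (α_ A A M.X).inv ≫ μ[A] ▷ M.X ≫ qr M := by
  have h₁ : A ◁ act M ≫ qr M = swp A A M.X ≫ A ◁ qr M ≫ act _ :=
    whiskerLeft_act_q (Mod.regular A) M
  have h₂ : μ[A] ▷ M.X ≫ qr M = (α_ A A M.X).hom ≫ A ◁ qr M ≫ act _ :=
    whiskerRight_act_q (Mod.regular A) M
  have h₃ : (β_ A A).hom ▷ M.X ≫ μ[A] ▷ M.X = μ[A] ▷ M.X := by
    rw [← comp_whiskerRight, IsCommMonObj.mul_comm]
  rw [h₁, ← reassoc_of% h₃, h₂, swp]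
  simp

/-- The morphism `A ⊗_A M ⟶ M` induced by the action. -/
def unitorHom (M : Mod C A) : relTensor (Mod.regular A) M ⟶ M :=
  relDesc (M := Mod.regular A) (act M)
    (by
      have h : ((α_ A A M.X).inv ≫ μ[A] ▷ M.X) ≫ act M = A ◁ act M ≫ act M := by
        rw [Category.assoc, mul_act]; simp
      exact h)
    (by
      have h : (β_ A A).hom ▷ M.X ≫ μ[A] ▷ M.X = μ[A] ▷ M.X := by
        rw [← comp_whiskerRight, IsCommMonObj.mul_comm]
      have h' : (swp A A M.X ≫ A ◁ act M) ≫ act M = A ◁ act M ≫ act M := by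
        rw [swp, Category.assoc, Category.assoc, Category.assoc, ← mul_act, reassoc_of% h, mul_act]
        simp
      exact h')

lemma qr_unitorHom (M : Mod C A) : qr M ≫ (unitorHom M).hom = act M :=
  q_relDesc _ _ _

/-- The unit isomorphism `A ⊗_A M ≅ M`. -/
def unitorIso (M : Mod C A) : relTensor (Mod.regular A) M ≅ M :=
  mkIso
    { hom := (unitorHom M).hom
      inv := (λ_ M.X).inv ≫ η[A] ▷ M.X ≫ qr M
      hom_inv_id := by
        rw [← cancel_epi (qr M), ← Category.assoc, qr_unitorHom, leftUnitor_inv_naturality_assoc,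
          whisker_exchange_assoc, whiskerLeft_act_qr, whiskerRight_tensor]
        have h : η[A] ▷ A ▷ M.X ≫ μ[A] ▷ M.X = (λ_ A).hom ▷ M.X := by
          rw [← comp_whiskerRight, MonObj.one_mul]
        simp [reassoc_of% h]
      inv_hom_id := by
        rw [Category.assoc, Category.assoc, qr_unitorHom, one_act, Iso.inv_hom_id] }
    (act_hom (unitorHom M))

/-- The symmetry `M ⊗_A N ≅ N ⊗_A M`. -/
def symHom (M N : Mod C A) : relTensor M N ⟶ relTensor N M :=
  relDesc ((β_ M.X N.X).hom ≫ q N M)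
    (by
      rw [actL, Category.assoc, BraidedCategory.braiding_naturality_left_assoc, whiskerLeft_act_q]
      simp [swp, bb₁])
    (by
      rw [actR, Category.assoc, BraidedCategory.braiding_naturality_right_assoc,
        whiskerRight_act_q]
      simp [swp, bb₁])

lemma q_symHom (M N : Mod C A) :
    q M N ≫ (symHom M N).hom = (β_ M.X N.X).hom ≫ q N M :=
  q_relDesc _ _ _

lemma q_symHom_assoc (M N : Mod C A) {Z : C} (h : (relTensor N M).X ⟶ Z) :
    q M N ≫ (symHom M N).hom ≫ h = (β_ M.X N.X).hom ≫ q N M ≫ h := by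
  rw [← Category.assoc, q_symHom, Category.assoc]

/-- The symmetry `M ⊗_A N ≅ N ⊗_A M`. -/
def symIso (M N : Mod C A) : relTensor M N ≅ relTensor N M where
  hom := symHom M N
  inv := symHom N M
  hom_inv_id := relTensor_hom_ext (by simp [q_symHom_assoc, q_symHom])
  inv_hom_id := relTensor_hom_ext (by simp [q_symHom_assoc, q_symHom])

/-- The associativity isomorphism of the relative tensor product, induced by the one of `C`. -/
def assocIso (M N P : Mod C A) :
    relTensor (relTensor M N) P ≅ relTensor M (relTensor N P) where
  hom := (exists_assoc_hom M N P).choose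
  inv := (exists_assoc_inv M N P).choose
  hom_inv_id := hom_ext₃ (by
    rw [Mod.comp_hom', reassoc_of% (exists_assoc_hom M N P).choose_spec,
      (exists_assoc_inv M N P).choose_spec]
    simp)
  inv_hom_id := hom_ext₃' (by
    rw [Mod.comp_hom', reassoc_of% (exists_assoc_inv M N P).choose_spec,
      (exists_assoc_hom M N P).choose_spec]
    simp)

lemma q_assocIso (M N P : Mod C A) :
    q M N ▷ P.X ≫ q _ P ≫ (assocIso M N P).hom.hom = (α_ _ _ _).hom ≫ M.X ◁ q N P ≫ q M _ :=
  (exists_assoc_hom M N P).choose_spec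

instance : MonoidalCategoryStruct (Mod C A) where
  tensorObj M N := relTensor M N
  whiskerLeft M _ _ g := relMap (𝟙 M) g
  whiskerRight f N := relMap f (𝟙 N)
  tensorHom f g := relMap f g
  tensorUnit := Mod.regular A
  associator M N P := assocIso M N P
  leftUnitor M := unitorIso M
  rightUnitor M := symIso M (Mod.regular A) ≪≫ unitorIso M

/-- The canonical morphism `M ⊗ N ⟶ M ⊗_A N`. -/
def π (M N : Mod C A) : M.X ⊗ N.X ⟶ (M ⊗ N : Mod C A).X := q M N

instance (M N : Mod C A) : Epi (π M N) := inferInstanceAs (Epi (q M N))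
instance (M N : Mod C A) (Z : C) : Epi (Z ◁ π M N) := inferInstanceAs (Epi (Z ◁ q M N))
instance (M N : Mod C A) (Z : C) : Epi (π M N ▷ Z) := inferInstanceAs (Epi (q M N ▷ Z))
instance (M N : Mod C A) (Z W : C) : Epi (π M N ▷ Z ▷ W) :=
  inferInstanceAs (Epi (q M N ▷ Z ▷ W))

lemma tensor_hom_ext {M N P : Mod C A} {f g : M ⊗ N ⟶ P}
    (h : π M N ≫ f.hom = π M N ≫ g.hom) : f = g :=
  relTensor_hom_ext h

section

variable {M M' N N' : Mod C A}

lemma π_tensorHom (f : M ⟶ M') (g : N ⟶ N') :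
    π M N ≫ (f ⊗ₘ g).hom = (f.hom ⊗ₘ g.hom) ≫ π M' N' :=
  q_relMap f g

lemma π_whiskerLeft (M : Mod C A) (g : N ⟶ N') :
    π M N ≫ (M ◁ g).hom = M.X ◁ g.hom ≫ π M N' := by
  rw [← id_tensorHom]; exact q_relMap (𝟙 M) g

lemma π_whiskerRight (f : M ⟶ M') (N : Mod C A) :
    π M N ≫ (f ▷ N).hom = f.hom ▷ N.X ≫ π M' N := by
  rw [← tensorHom_id]; exact q_relMap f (𝟙 N)

lemma π_α (M N P : Mod C A) :
    π M N ▷ P.X ≫ π (M ⊗ N) P ≫ (α_ M N P).hom.hom =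
      (α_ M.X N.X P.X).hom ≫ M.X ◁ π N P ≫ π M (N ⊗ P) :=
  q_assocIso M N P

lemma π_leftUnitor (M : Mod C A) : π (𝟙_ (Mod C A)) M ≫ (λ_ M).hom.hom = act M :=
  qr_unitorHom M

lemma π_rightUnitor (M : Mod C A) :
    π M (𝟙_ (Mod C A)) ≫ (ρ_ M).hom.hom = (β_ M.X A).hom ≫ act M := by
  change q M _ ≫ (symHom M (Mod.regular A)).hom ≫ (unitorHom M).hom = _
  rw [q_symHom_assoc]
  exact (β_ M.X A).hom ≫= qr_unitorHom M

variable {Z : C}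

lemma π_leftUnitor_assoc (M : Mod C A) (h : M.X ⟶ Z) :
    π (𝟙_ (Mod C A)) M ≫ (λ_ M).hom.hom ≫ h = act M ≫ h :=
  (Category.assoc _ _ _).symm.trans (π_leftUnitor M =≫ h)

lemma π_rightUnitor_assoc (M : Mod C A) (h : M.X ⟶ Z) :
    π M (𝟙_ (Mod C A)) ≫ (ρ_ M).hom.hom ≫ h = (β_ M.X A).hom ≫ act M ≫ h :=
  (Category.assoc _ _ _).symm.trans ((π_rightUnitor M =≫ h).trans (Category.assoc _ _ _))

lemma π_tensorHom_assoc (f : M ⟶ M') (g : N ⟶ N') (h : (M' ⊗ N' : Mod C A).X ⟶ Z) :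
    π M N ≫ (f ⊗ₘ g).hom ≫ h = (f.hom ⊗ₘ g.hom) ≫ π M' N' ≫ h := by
  rw [← Category.assoc, π_tensorHom, Category.assoc]

lemma π_whiskerLeft_assoc (M : Mod C A) (g : N ⟶ N') (h : (M ⊗ N' : Mod C A).X ⟶ Z) :
    π M N ≫ (M ◁ g).hom ≫ h = M.X ◁ g.hom ≫ π M N' ≫ h := by
  rw [← Category.assoc, π_whiskerLeft, Category.assoc]

lemma π_whiskerRight_assoc (f : M ⟶ M') (N : Mod C A) (h : (M' ⊗ N : Mod C A).X ⟶ Z) :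
    π M N ≫ (f ▷ N).hom ≫ h = f.hom ▷ N.X ≫ π M' N ≫ h := by
  rw [← Category.assoc, π_whiskerRight, Category.assoc]

lemma π_α_assoc (M N P : Mod C A) (h : (M ⊗ (N ⊗ P) : Mod C A).X ⟶ Z) :
    π M N ▷ P.X ≫ π (M ⊗ N) P ≫ (α_ M N P).hom.hom ≫ h =
      (α_ M.X N.X P.X).hom ≫ M.X ◁ π N P ≫ π M (N ⊗ P) ≫ h := by
  rw [← Category.assoc (π _ _), ← Category.assoc, π_α]; simp

end

/-- The category of modules of a commutative algebra is monoidal under the relative tensor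
product. -/
instance : MonoidalCategory (Mod C A) :=
  MonoidalCategory.ofTensorHom
    (id_tensorHom_id := fun M N => tensor_hom_ext (by simp [π_tensorHom]))
    (tensorHom_comp_tensorHom := fun f g h k => tensor_hom_ext (by
      simp [π_tensorHom, π_tensorHom_assoc]))
    (associator_naturality := fun {M₁ M₂ M₃ N₁ N₂ N₃} f g h => tensor_hom_ext (by
      rw [← cancel_epi (π M₁ M₂ ▷ M₃.X)]
      simp only [Mod.comp_hom', π_tensorHom_assoc, π_α_assoc, π_tensorHom]
      rw [MonoidalCategory.tensorHom_def (f ⊗ₘ g).hom, Category.assoc, ← comp_whiskerRight_assoc,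
        π_tensorHom, comp_whiskerRight_assoc, ← whisker_exchange_assoc, π_α,
        MonoidalCategory.tensorHom_def f.hom (g ⊗ₘ h).hom, Category.assoc, whisker_exchange_assoc,
        ← MonoidalCategory.whiskerLeft_comp_assoc, π_tensorHom]
      simp [MonoidalCategory.tensorHom_def]))
    (leftUnitor_naturality := fun {M N} f => tensor_hom_ext (by
      have e : (𝟙 A ⊗ₘ f.hom) ≫ act N = act M ≫ f.hom := by rw [id_tensorHom, act_hom]
      exact (π_tensorHom_assoc _ _ _).trans
        (((_ ≫= π_leftUnitor N).trans e).trans (π_leftUnitor_assoc M f.hom).symm)))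
    (rightUnitor_naturality := fun {M N} f => tensor_hom_ext (by
      have e : (f.hom ⊗ₘ 𝟙 A) ≫ (β_ N.X A).hom ≫ act N = (β_ M.X A).hom ≫ act M ≫ f.hom := by
        rw [tensorHom_id, act_hom, BraidedCategory.braiding_naturality_left_assoc]
      exact (π_tensorHom_assoc _ _ _).trans
        (((_ ≫= π_rightUnitor N).trans e).trans (π_rightUnitor_assoc M f.hom).symm)))
    (pentagon := fun M N P Q => tensor_hom_ext (by
      rw [← cancel_epi (π (M ⊗ N) P ▷ Q.X), ← cancel_epi (π M N ▷ P.X ▷ Q.X)]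
      have h₁ : π M N ▷ P.X ▷ Q.X ≫ π (M ⊗ N) P ▷ Q.X ≫ (α_ M N P).hom.hom ▷ Q.X =
          (α_ M.X N.X P.X).hom ▷ Q.X ≫ (M.X ◁ π N P) ▷ Q.X ≫ π M (N ⊗ P) ▷ Q.X := by
        rw [← comp_whiskerRight, ← comp_whiskerRight, π_α]; simp
      have h₂ : M.X ◁ π N P ▷ Q.X ≫ M.X ◁ π (N ⊗ P) Q ≫ M.X ◁ (α_ N P Q).hom.hom =
          M.X ◁ (α_ N.X P.X Q.X).hom ≫ M.X ◁ N.X ◁ π P Q ≫ M.X ◁ π N (P ⊗ Q) := by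
        rw [← MonoidalCategory.whiskerLeft_comp, ← MonoidalCategory.whiskerLeft_comp, π_α]; simp
      simp only [Mod.comp_hom', Mod.id_hom', π_tensorHom_assoc, π_α_assoc, tensorHom_id]
      rw [reassoc_of% h₁, π_α_assoc, π_tensorHom, Mod.id_hom', id_tensorHom,
        associator_naturality_middle_assoc, reassoc_of% h₂, associator_naturality_left_assoc,
        ← whisker_exchange_assoc, π_α]
      simp))
    (triangle := fun M N => tensor_hom_ext (by
      rw [← cancel_epi (π M (𝟙_ (Mod C A)) ▷ N.X)]
      simp only [Mod.comp_hom', Mod.id_hom', π_α_assoc, π_tensorHom, id_tensorHom, tensorHom_id]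
      rw [← MonoidalCategory.whiskerLeft_comp_assoc, π_leftUnitor, ← comp_whiskerRight_assoc,
        π_rightUnitor]
      have e : (α_ M.X A N.X).hom ≫ M.X ◁ act N ≫ q M N =
          ((β_ M.X A).hom ≫ act M) ▷ N.X ≫ q M N := by
        rw [comp_whiskerRight_assoc, whiskerRight_act_q, whiskerLeft_act_q]
        simp [swp]
      exact e))

/-- The symmetry of the relative tensor product, induced by the one of `C`. -/
lemma π_symIso (M N : Mod C A) :
    π M N ≫ (symIso M N).hom.hom = (β_ M.X N.X).hom ≫ π N M := q_symHom M N

lemma π_symIso_assoc (M N : Mod C A) {Z : C} (h : (N ⊗ M : Mod C A).X ⟶ Z) :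
    π M N ≫ (symIso M N).hom.hom ≫ h = (β_ M.X N.X).hom ≫ π N M ≫ h := q_symHom_assoc M N h

lemma π_α_inv (M N P : Mod C A) :
    M.X ◁ π N P ≫ π M (N ⊗ P) ≫ (α_ M N P).inv.hom =
      (α_ M.X N.X P.X).inv ≫ π M N ▷ P.X ≫ π (M ⊗ N) P :=
  (exists_assoc_inv M N P).choose_spec

lemma π_α_inv_assoc (M N P : Mod C A) {Z : C} (h : ((M ⊗ N) ⊗ P : Mod C A).X ⟶ Z) :
    M.X ◁ π N P ≫ π M (N ⊗ P) ≫ (α_ M N P).inv.hom ≫ h =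
      (α_ M.X N.X P.X).inv ≫ π M N ▷ P.X ≫ π (M ⊗ N) P ≫ h := by
  rw [← Category.assoc (π _ _), ← Category.assoc, π_α_inv]; simp

instance : BraidedCategory (Mod C A) where
  braiding M N := symIso M N
  braiding_naturality_right M N P f := tensor_hom_ext (by
    simp only [Mod.comp_hom', π_whiskerLeft_assoc, π_symIso, π_symIso_assoc, π_whiskerRight]
    simp)
  braiding_naturality_left f P := tensor_hom_ext (by
    simp only [Mod.comp_hom', π_whiskerRight_assoc, π_symIso, π_symIso_assoc, π_whiskerLeft]
    simp)
  hexagon_forward M N P := tensor_hom_ext (by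
    rw [← cancel_epi (π M N ▷ P.X)]
    have h₁ : π M N ▷ P.X ≫ (symIso M N).hom.hom ▷ P.X =
        (β_ M.X N.X).hom ▷ P.X ≫ π N M ▷ P.X := by
      rw [← comp_whiskerRight, π_symIso]; simp
    have h₂ : N.X ◁ π M P ≫ N.X ◁ (symIso M P).hom.hom =
        N.X ◁ (β_ M.X P.X).hom ≫ N.X ◁ π P M := by
      rw [← MonoidalCategory.whiskerLeft_comp, π_symIso]; simp
    simp only [Mod.comp_hom', π_α_assoc, π_symIso_assoc, π_whiskerRight_assoc]
    rw [reassoc_of% h₁, π_α_assoc, π_whiskerLeft, reassoc_of% h₂,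
      BraidedCategory.braiding_naturality_right_assoc, π_α]
    simp)
  hexagon_reverse M N P := tensor_hom_ext (by
    rw [← cancel_epi (M.X ◁ π N P)]
    have h₁ : M.X ◁ π N P ≫ M.X ◁ (symIso N P).hom.hom =
        M.X ◁ (β_ N.X P.X).hom ≫ M.X ◁ π P N := by
      rw [← MonoidalCategory.whiskerLeft_comp, π_symIso]; simp
    have h₂ : π M P ▷ N.X ≫ (symIso M P).hom.hom ▷ N.X =
        (β_ M.X P.X).hom ▷ N.X ≫ π P M ▷ N.X := by
      rw [← comp_whiskerRight, π_symIso]; simp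
    simp only [Mod.comp_hom', π_α_inv_assoc, π_symIso_assoc, π_whiskerLeft_assoc]
    rw [reassoc_of% h₁, π_α_inv_assoc, π_whiskerRight, reassoc_of% h₂,
      BraidedCategory.braiding_naturality_left_assoc, π_α_inv]
    simp)

lemma π_braiding (M N : Mod C A) :
    π M N ≫ (β_ M N).hom.hom = (β_ M.X N.X).hom ≫ π N M := q_symHom M N

instance : SymmetricCategory (Mod C A) where
  symmetry M N := (symIso M N).hom_inv_id

section Linear

variable [Preadditive C] [MonoidalPreadditive C]

instance : MonoidalPreadditive (Mod C A) where
  whiskerLeft_zero := tensor_hom_ext (by simp [π_whiskerLeft])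
  zero_whiskerRight := tensor_hom_ext (by simp [π_whiskerRight])
  whiskerLeft_add _ _ := tensor_hom_ext (by simp [π_whiskerLeft])
  add_whiskerRight _ _ := tensor_hom_ext (by simp [π_whiskerRight])

instance {R : Type*} [CommRing R] [CategoryTheory.Linear R C] [MonoidalLinear R C] :
    MonoidalLinear R (Mod C A) where
  whiskerLeft_smul _ _ _ _ _ := tensor_hom_ext (by simp [π_whiskerLeft])
  smul_whiskerRight _ _ _ _ _ := tensor_hom_ext (by simp [π_whiskerRight])

end Linear

end RelativeTensor

/-! ### The free module functor -/

section Free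

variable {C : Type u} [Category.{v} C] [MonoidalCategory C]

section

open scoped MonObj

variable (A : C) [MonObj A]

/-- The free module functor `X ↦ A ⊗ X`. -/
def free : C ⥤ Mod C A where
  obj X := mkMod (A ⊗ X) ((α_ A A X).inv ≫ μ[A] ▷ X)
    (by simp [← comp_whiskerRight])
    (by
      have h : μ[A] ▷ A ▷ X ≫ μ[A] ▷ X =
          (α_ A A A).hom ▷ X ≫ (A ◁ μ[A]) ▷ X ≫ μ[A] ▷ X := by
        simp only [← comp_whiskerRight, MonObj.mul_assoc]
      rw [whiskerRight_tensor, Category.assoc, Category.assoc, Iso.hom_inv_id_assoc, h]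
      simp)
  map f := mkHom (A ◁ f) (by
    change ((α_ A A _).inv ≫ μ[A] ▷ _) ≫ A ◁ f = A ◁ A ◁ f ≫ (α_ A A _).inv ≫ μ[A] ▷ _
    rw [Category.assoc, ← whisker_exchange]
    simp)
  map_id X := Mod.hom_ext _ _ (MonoidalCategory.whiskerLeft_id A X)
  map_comp f g := Mod.hom_ext _ _ (MonoidalCategory.whiskerLeft_comp A f g)

lemma act_free (X : C) : act ((free A).obj X) = (α_ A A X).inv ≫ μ[A] ▷ X := rfl

lemma free_map_hom {X Y : C} (f : X ⟶ Y) : ((free A).map f).hom = A ◁ f := rfl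

/-- The free module functor is left adjoint to the forgetful functor. -/
def freeAdj : free A ⊣ Mod.forget (D := C) A where
  unit :=
    { app := fun X => (λ_ X).inv ≫ η[A] ▷ X
      naturality := fun X Y f => by
        change f ≫ (λ_ Y).inv ≫ η[A] ▷ Y = ((λ_ X).inv ≫ η[A] ▷ X) ≫ A ◁ f
        rw [leftUnitor_inv_naturality_assoc, whisker_exchange, Category.assoc] }
  counit :=
    { app := fun M => mkHom (act M) (by
        change ((α_ A A M.X).inv ≫ μ[A] ▷ M.X) ≫ act M = A ◁ act M ≫ act M
        rw [Category.assoc, mul_act]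
        simp)
      naturality := fun M N f => Mod.hom_ext _ _ (act_hom f).symm }
  left_triangle_components X := Mod.hom_ext _ _ (by
    change A ◁ ((λ_ X).inv ≫ η[A] ▷ X) ≫ (α_ A A X).inv ≫ μ[A] ▷ X = 𝟙 (A ⊗ X)
    have h : A ◁ η[A] ▷ X ≫ (α_ A A X).inv ≫ μ[A] ▷ X = (α_ A (𝟙_ C) X).inv ≫ (ρ_ A).hom ▷ X := by
      rw [associator_inv_naturality_middle_assoc, ← comp_whiskerRight, MonObj.mul_one]
    rw [MonoidalCategory.whiskerLeft_comp, Category.assoc, h]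
    simp)
  right_triangle_components M := by
    change ((λ_ M.X).inv ≫ η[A] ▷ M.X) ≫ act M = 𝟙 M.X
    rw [Category.assoc, one_act]
    simp

instance : (free A).IsLeftAdjoint := (freeAdj A).isLeftAdjoint

instance [Preadditive C] [MonoidalPreadditive C] : (free A).Additive where
  map_add {_ _ f g} := Mod.hom_ext _ _ (MonoidalPreadditive.whiskerLeft_add (X := A) f g)

instance [Preadditive C] [MonoidalPreadditive C] {R : Type*} [CommRing R]
    [CategoryTheory.Linear R C] [MonoidalLinear R C] : (free A).Linear R where
  map_smul f r := Mod.hom_ext _ _ (MonoidalLinear.whiskerLeft_smul A r f)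

end

variable [SymmetricCategory C] [HasCoequalizers C]
  [∀ X : C, PreservesColimitsOfShape WalkingParallelPair (tensorLeft X)]
  (A : C) [MonObj A] [IsCommMonObj A]

/-- The forgetful functor is lax monoidal through the morphisms `M ⊗ N ⟶ M ⊗_A N`. -/
instance : (Mod.forget (D := C) A).LaxMonoidal where
  ε := MonObj.one (X := A)
  μ M N := π M N
  μ_natural_left f N := (π_whiskerRight f N).symm
  μ_natural_right M f := (π_whiskerLeft M f).symm
  associativity M N P := π_α M N P
  left_unitality M := by
    refine (one_act M).symm.trans ?_
    exact (_ ≫= π_leftUnitor M).symm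
  right_unitality M := by
    have h : M.X ◁ MonObj.one (X := A) ≫ (β_ M.X A).hom ≫ act M = (ρ_ M.X).hom := by
      rw [BraidedCategory.braiding_naturality_right_assoc, one_act]; simp
    exact h.symm.trans (_ ≫= π_rightUnitor M).symm

set_option linter.unusedSectionVars false

/-- The unit of the free module adjunction. -/
def unitFree (X : C) : X ⟶ ((free A).obj X).X := (freeAdj A).unit.app X

lemma unitFree_eq (X : C) :
    unitFree A X = (λ_ X).inv ≫ MonObj.one (X := A) ▷ X := rfl

variable {A} in
lemma free_hom_ext {X : C} {M : Mod C A} {f g : (free A).obj X ⟶ M}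
    (h : unitFree A X ≫ f.hom = unitFree A X ≫ g.hom) : f = g :=
  ((freeAdj A).homEquiv X M).injective h

lemma unitFree_map {X Y : C} (f : X ⟶ Y) :
    unitFree A X ≫ ((free A).map f).hom = f ≫ unitFree A Y :=
  ((freeAdj A).unit.naturality f).symm

/-- The free module functor is oplax monoidal, being left adjoint to a lax monoidal functor. -/
instance freeOplax : (free A).OplaxMonoidal := (freeAdj A).leftAdjointOplaxMonoidal

instance : (freeAdj A).IsMonoidal := inferInstance

lemma unitFree_η : unitFree A (𝟙_ C) ≫ (Functor.OplaxMonoidal.η (free A)).hom =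
    MonObj.one (X := A) :=
  (freeAdj A).unit_app_unit_comp_map_η

lemma unitFree_δ (X Y : C) :
    unitFree A (X ⊗ Y) ≫ (Functor.OplaxMonoidal.δ (free A) X Y).hom =
      (unitFree A X ⊗ₘ unitFree A Y) ≫ π ((free A).obj X) ((free A).obj Y) :=
  (freeAdj A).unit_app_tensor_comp_map_δ X Y

lemma map_unitFree_act (X : C) : A ◁ unitFree A X ≫ act ((free A).obj X) = 𝟙 (A ⊗ X) :=
  congrArg Mod.Hom.hom ((freeAdj A).left_triangle_components X)

variable {A} in
lemma act_act_comm (P : Mod C A) :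
    A ◁ act P ≫ act P = swp A A P.X ≫ A ◁ act P ≫ act P := by
  have h : (β_ A A).hom ▷ P.X ≫ MonObj.mul (X := A) ▷ P.X = MonObj.mul (X := A) ▷ P.X := by
    rw [← comp_whiskerRight, IsCommMonObj.mul_comm]
  rw [swp, Category.assoc, Category.assoc, ← mul_act, reassoc_of% h, mul_act]
  simp

section Bilinear

variable {A} {X Y : C} {M N P : Mod C A}

/-- The morphism `(A ⊗ X) ⊗ (A ⊗ Y) ⟶ P` induced by `f : X ⊗ Y ⟶ P`. -/
def bil (f : X ⊗ Y ⟶ P.X) : (A ⊗ X) ⊗ (A ⊗ Y) ⟶ P.X :=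
  (α_ _ _ _).hom ≫ A ◁ swp X A Y ≫ A ◁ A ◁ f ≫ A ◁ act P ≫ act P

lemma bil_left (f : X ⊗ Y ⟶ P.X) :
    ((α_ A A X).inv ≫ MonObj.mul (X := A) ▷ X) ▷ (A ⊗ Y) ≫ bil f =
      (α_ _ _ _).hom ≫ A ◁ bil f ≫ act P := by
  simp only [bil, comp_whiskerRight, Category.assoc, associator_naturality_left_assoc]
  rw [← whisker_exchange_assoc, ← whisker_exchange_assoc, ← whisker_exchange_assoc, mul_act]
  monoidal

lemma swp_tensor_mid (X W W' Y : C) : swp X (W ⊗ W') Y ≫ (α_ W W' (X ⊗ Y)).hom =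
    X ◁ (α_ W W' Y).hom ≫ swp X W (W' ⊗ Y) ≫ W ◁ swp X W' Y := by
  simp [swp]

lemma swp_tensor_left (W X V Z : C) : swp (W ⊗ X) V Z ≫ V ◁ (α_ W X Z).hom =
    (α_ _ _ _).hom ≫ W ◁ swp X V Z ≫ swp W V (X ⊗ Z) := by
  simp [swp]

lemma bil_right (f : X ⊗ Y ⟶ P.X) :
    (A ⊗ X) ◁ ((α_ A A Y).inv ≫ MonObj.mul (X := A) ▷ Y) ≫ bil f =
      swp _ _ _ ≫ A ◁ bil f ≫ act P := by
  have h : X ◁ ((α_ A A Y).inv ≫ MonObj.mul (X := A) ▷ Y) ≫ swp X A Y ≫ A ◁ f ≫ act P =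
      X ◁ (α_ A A Y).inv ≫ swp X (A ⊗ A) Y ≫ (α_ _ _ _).hom ≫ A ◁ A ◁ f ≫ A ◁ act P ≫ act P := by
    rw [MonoidalCategory.whiskerLeft_comp, Category.assoc, reassoc_of% swp_nat_mid,
      ← whisker_exchange_assoc, mul_act]
    simp
  simp only [bil, associator_naturality_right_assoc]
  simp only [← MonoidalCategory.whiskerLeft_comp_assoc, Category.assoc]
  rw [h]
  simp only [MonoidalCategory.whiskerLeft_comp, Category.assoc]
  conv_lhs => rw [act_act_comm, reassoc_of% swp_nat_right (act P), reassoc_of% swp_nat_right (A ◁ f)]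
  have h₁ : A ◁ swp X (A ⊗ A) Y ≫ A ◁ (α_ A A (X ⊗ Y)).hom = A ◁ X ◁ (α_ A A Y).hom ≫
      A ◁ swp X A (A ⊗ Y) ≫ A ◁ A ◁ swp X A Y := by
    rw [← MonoidalCategory.whiskerLeft_comp, swp_tensor_mid]; simp
  rw [reassoc_of% h₁, reassoc_of% swp_tensor_left, reassoc_of% swp_nat_right (swp X A Y)]
  simp

lemma one_bil (f : X ⊗ Y ⟶ P.X) :
    (((λ_ X).inv ≫ MonObj.one (X := A) ▷ X) ⊗ₘ ((λ_ Y).inv ≫ MonObj.one (X := A) ▷ Y)) ≫ bil f =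
      f := by
  have h₀ : ∀ {W : C} (k : W ⟶ P.X), MonObj.one (X := A) ▷ W ≫ A ◁ k ≫ act P = (λ_ W).hom ≫ k :=
    fun k => by rw [← whisker_exchange_assoc, one_act, leftUnitor_naturality]
  have h₁ : X ◁ ((λ_ Y).inv ≫ MonObj.one (X := A) ▷ Y) ≫ swp X A Y ≫ A ◁ f ≫ act P = f := by
    rw [MonoidalCategory.whiskerLeft_comp, Category.assoc, reassoc_of% swp_nat_mid, h₀]
    simp [swp]
  rw [MonoidalCategory.tensorHom_def]
  simp only [bil, Category.assoc, associator_naturality_right_assoc]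
  simp only [← MonoidalCategory.whiskerLeft_comp_assoc]
  rw [h₁, comp_whiskerRight, Category.assoc, associator_naturality_left_assoc, h₀]
  simp

/-- Bilinear extension of a morphism along two free modules. -/
lemma exists_desc_free {r : M.X ⟶ A ⊗ X} {s : N.X ⟶ A ⊗ Y} {i : X ⟶ M.X} {j : Y ⟶ N.X}
    (hr : act M ≫ r = A ◁ r ≫ (α_ A A X).inv ≫ MonObj.mul (X := A) ▷ X)
    (hs : act N ≫ s = A ◁ s ≫ (α_ A A Y).inv ≫ MonObj.mul (X := A) ▷ Y)
    (hi : i ≫ r = (λ_ X).inv ≫ MonObj.one (X := A) ▷ X)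
    (hj : j ≫ s = (λ_ Y).inv ≫ MonObj.one (X := A) ▷ Y) (f : X ⊗ Y ⟶ P.X) :
    ∃ g : M ⊗ N ⟶ P, (i ⊗ₘ j) ≫ π M N ≫ g.hom = f := by
  refine ⟨relDesc ((r ⊗ₘ s) ≫ bil f) ?_ ?_, ?_⟩
  · rw [actL, Category.assoc, MonoidalCategory.tensorHom_def, Category.assoc,
      ← comp_whiskerRight_assoc, hr, comp_whiskerRight_assoc, ← whisker_exchange_assoc, bil_left]
    simp
  · rw [actR, Category.assoc, MonoidalCategory.tensorHom_def', Category.assoc,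
      ← MonoidalCategory.whiskerLeft_comp_assoc, hs, MonoidalCategory.whiskerLeft_comp_assoc,
      whisker_exchange_assoc, bil_right]
    rw [reassoc_of% swp_nat_left, ← reassoc_of% swp_nat_right, swp_swp_assoc]
    simp
  · refine ((i ⊗ₘ j) ≫= q_relDesc _ _ _).trans ?_
    rw [tensorHom_comp_tensorHom_assoc, hi, hj, one_bil]

lemma free_tensor_hom_ext {r : M.X ⟶ A ⊗ X} {s : N.X ⟶ A ⊗ Y} {i : X ⟶ M.X} {j : Y ⟶ N.X}
    (hr : r ≫ A ◁ i ≫ act M = 𝟙 _) (hs : s ≫ A ◁ j ≫ act N = 𝟙 _) {g g' : M ⊗ N ⟶ P}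
    (h : (i ⊗ₘ j) ≫ π M N ≫ g.hom = (i ⊗ₘ j) ≫ π M N ≫ g'.hom) : g = g' := by
  have key : ∀ g : M ⊗ N ⟶ P, π M N ≫ g.hom =
      (r ⊗ₘ s) ≫ bil ((i ⊗ₘ j) ≫ π M N ≫ g.hom) := by
    intro g
    have h₁ : r ▷ N.X ≫ (A ◁ i) ▷ N.X ≫ act M ▷ N.X = 𝟙 _ := by
      rw [← comp_whiskerRight, ← comp_whiskerRight, hr, id_whiskerRight]
    have h₂ : M.X ◁ s ≫ M.X ◁ A ◁ j ≫ M.X ◁ act N = 𝟙 _ := by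
      rw [← MonoidalCategory.whiskerLeft_comp, ← MonoidalCategory.whiskerLeft_comp, hs,
        MonoidalCategory.whiskerLeft_id]
    have e₁ : act M ▷ N.X ≫ π M N ≫ g.hom = (α_ _ _ _).hom ≫ A ◁ (π M N ≫ g.hom) ≫ act P := by
      have : (_ ≫ π M N) ≫ g.hom = ((α_ _ _ _).hom ≫ A ◁ π M N ≫ act (M ⊗ N)) ≫ g.hom :=
        whiskerRight_act_q M N =≫ g.hom
      simp only [Category.assoc, act_hom] at this
      simpa using this
    have e₂ : M.X ◁ act N ≫ π M N ≫ g.hom = swp _ _ _ ≫ A ◁ (π M N ≫ g.hom) ≫ act P := by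
      have : (_ ≫ π M N) ≫ g.hom = (swp _ _ _ ≫ A ◁ π M N ≫ act (M ⊗ N)) ≫ g.hom :=
        whiskerLeft_act_q M N =≫ g.hom
      simp only [Category.assoc, act_hom] at this
      simpa using this
    generalize π M N ≫ g.hom = k at e₁ e₂ ⊢
    have e₃ : k = M.X ◁ s ≫ swp _ _ _ ≫ A ◁ (M.X ◁ j ≫ k) ≫ act P := by
      rw [MonoidalCategory.whiskerLeft_comp, Category.assoc, ← reassoc_of% swp_nat_right j, ← e₂,
        reassoc_of% h₂]
    have e₄ : i ▷ N.X ≫ k = X ◁ s ≫ swp _ _ _ ≫ A ◁ ((i ⊗ₘ j) ≫ k) ≫ act P := by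
      conv_lhs => rw [e₃]
      rw [← whisker_exchange_assoc, reassoc_of% swp_nat_left i, MonoidalCategory.tensorHom_def]
      simp
    have e₅ : k = r ▷ N.X ≫ (α_ _ _ _).hom ≫ A ◁ (i ▷ N.X ≫ k) ≫ act P := by
      have : r ▷ N.X ≫ (A ◁ i) ▷ N.X ≫ act M ▷ N.X ≫ k = k := by rw [reassoc_of% h₁]
      refine this.symm.trans ?_
      rw [e₁]
      simp
    conv_lhs => rw [e₅, e₄]
    rw [MonoidalCategory.tensorHom_def r s, bil]
    simp
  exact tensor_hom_ext (by rw [key g, key g', h])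

end Bilinear

variable {A} in
/-- The underlying morphism of the identity of `A ⊗ X`. -/
def freeId (X : C) : ((free A).obj X).X ⟶ A ⊗ X := 𝟙 (A ⊗ X)

lemma freeId_act (X : C) : act ((free A).obj X) ≫ freeId X =
    A ◁ freeId X ≫ (α_ A A X).inv ≫ MonObj.mul (X := A) ▷ X := by
  change ((α_ A A X).inv ≫ MonObj.mul (X := A) ▷ X) ≫ 𝟙 (A ⊗ X) =
    A ◁ 𝟙 (A ⊗ X) ≫ (α_ A A X).inv ≫ MonObj.mul (X := A) ▷ X
  simp

lemma unitFree_freeId (X : C) : unitFree A X ≫ freeId X =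
    (λ_ X).inv ≫ MonObj.one (X := A) ▷ X := Category.comp_id _

lemma freeId_unitFree (X : C) :
    freeId X ≫ A ◁ unitFree A X ≫ act ((free A).obj X) = 𝟙 ((free A).obj X).X :=
  (Category.id_comp _).trans (map_unitFree_act A X)

lemma freeη_eq : (Functor.OplaxMonoidal.η (free A)) =
    (mkIso (M := (free A).obj (𝟙_ C)) (N := Mod.regular A) (ρ_ A) (by
      change ((α_ A A (𝟙_ C)).inv ≫ MonObj.mul (X := A) ▷ (𝟙_ C)) ≫ (ρ_ A).hom =
        A ◁ (ρ_ A).hom ≫ MonObj.mul (X := A)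
      simp)).hom := by
  apply free_hom_ext
  refine (unitFree_η A).trans ?_
  change _ = ((λ_ (𝟙_ C)).inv ≫ MonObj.one (X := A) ▷ (𝟙_ C)) ≫ (ρ_ A).hom
  rw [Category.assoc, rightUnitor_naturality, ← unitors_equal, Iso.inv_hom_id_assoc]

instance : IsIso (Functor.OplaxMonoidal.η (free A)) := by
  rw [freeη_eq]
  exact Iso.isIso_hom _

instance (X Y : C) : IsIso (Functor.OplaxMonoidal.δ (free A) X Y) := by
  obtain ⟨g, hg⟩ := exists_desc_free (P := (free A).obj (X ⊗ Y)) (freeId_act A X) (freeId_act A Y)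
    (unitFree_freeId A X) (unitFree_freeId A Y) (unitFree A (X ⊗ Y))
  refine ⟨g, free_hom_ext ?_, free_tensor_hom_ext (freeId_unitFree A X) (freeId_unitFree A Y) ?_⟩
  · rw [Mod.comp_hom', ← Category.assoc, unitFree_δ, Category.assoc, hg]
    simp
  · rw [Mod.comp_hom', reassoc_of% hg, unitFree_δ]
    simp

/-- The free module functor is strong monoidal. -/
instance freeMonoidal : (free A).Monoidal where
  toLaxMonoidal := (Functor.Monoidal.ofOplaxMonoidal (free A)).toLaxMonoidal
  toOplaxMonoidal := freeOplax A
  ε_η := (Functor.Monoidal.ofOplaxMonoidal (free A)).ε_η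
  η_ε := (Functor.Monoidal.ofOplaxMonoidal (free A)).η_ε
  μ_δ := (Functor.Monoidal.ofOplaxMonoidal (free A)).μ_δ
  δ_μ := (Functor.Monoidal.ofOplaxMonoidal (free A)).δ_μ

lemma free_map_braiding (X Y : C) :
    (free A).map (β_ X Y).hom ≫ Functor.OplaxMonoidal.δ (free A) Y X =
      Functor.OplaxMonoidal.δ (free A) X Y ≫ (β_ ((free A).obj X) ((free A).obj Y)).hom := by
  apply free_hom_ext
  rw [Mod.comp_hom', Mod.comp_hom', ← Category.assoc, unitFree_map, Category.assoc]
  refine ((β_ X Y).hom ≫= unitFree_δ A Y X).trans ?_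
  have h := unitFree_δ A X Y =≫ (β_ ((free A).obj X) ((free A).obj Y)).hom.hom
  refine Eq.trans ?_ ((Category.assoc _ _ _).symm.trans h).symm
  rw [Category.assoc, π_braiding, BraidedCategory.braiding_naturality_assoc]

/-- The free module functor is symmetric strong monoidal. -/
instance : (free A).Braided where
  braided X Y := by
    have h := free_map_braiding A X Y =≫ Functor.LaxMonoidal.μ (free A) Y X
    rw [Category.assoc, Category.assoc, Functor.Monoidal.δ_μ, Category.comp_id] at h
    rw [h, Functor.Monoidal.μ_δ_assoc]

end Free

/-! ### The functor between categories of modules induced by a monoidal functor -/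

section Induced

set_option linter.unusedSectionVars false

variable {C : Type u} [Category.{v} C] [MonoidalCategory C]
  {D : Type u'} [Category.{v'} D] [MonoidalCategory D]

open Functor.LaxMonoidal Functor.OplaxMonoidal

section

open scoped MonObj

variable (F : C ⥤ D) [F.LaxMonoidal] (A : C) [MonObj A]

/-- The functor `M ↦ F M` from `A`-modules to `F A`-modules induced by a lax monoidal
functor `F`. -/
def induced : Mod C A ⥤ Mod D (F.obj A) where
  obj M := mkMod (F.obj M.X) (Functor.LaxMonoidal.μ F A M.X ≫ F.map (act M))
    (by
      change (Functor.LaxMonoidal.ε F ≫ F.map η[A]) ▷ F.obj M.X ≫ _ = _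
      rw [comp_whiskerRight, Category.assoc, μ_natural_left_assoc, ← F.map_comp, one_act,
        ← Functor.LaxMonoidal.left_unitality])
    (by
      change (Functor.LaxMonoidal.μ F A A ≫ F.map μ[A]) ▷ F.obj M.X ≫ _ = _
      rw [comp_whiskerRight, Category.assoc, μ_natural_left_assoc, ← F.map_comp, mul_act]
      simp)
  map f := mkHom (F.map f.hom) (by
    change (Functor.LaxMonoidal.μ F A _ ≫ F.map (act _)) ≫ F.map f.hom =
      F.obj A ◁ F.map f.hom ≫ Functor.LaxMonoidal.μ F A _ ≫ F.map (act _)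
    rw [Category.assoc, ← F.map_comp, act_hom]
    simp)
  map_id M := Mod.hom_ext _ _ (F.map_id M.X)
  map_comp f g := Mod.hom_ext _ _ (F.map_comp f.hom g.hom)

lemma act_induced (M : Mod C A) :
    act ((induced F A).obj M) = Functor.LaxMonoidal.μ F A M.X ≫ F.map (act M) := rfl

lemma induced_map_hom {M N : Mod C A} (f : M ⟶ N) :
    ((induced F A).map f).hom = F.map f.hom := rfl

section

variable [Preadditive C] [MonoidalPreadditive C] [Preadditive D] [MonoidalPreadditive D]

instance [F.Additive] : (induced F A).Additive where
  map_add {_ _ f g} := Mod.hom_ext _ _ (F.map_add (f := f.hom) (g := g.hom))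

instance {R : Type*} [CommRing R] [CategoryTheory.Linear R C] [MonoidalLinear R C]
    [CategoryTheory.Linear R D] [MonoidalLinear R D] [F.Linear R] :
    (induced F A).Linear R where
  map_smul f r := Mod.hom_ext _ _ (Functor.map_smul (R := R) F r f.hom)

end

end

variable [SymmetricCategory C] [HasCoequalizers C]
  [∀ X : C, PreservesColimitsOfShape WalkingParallelPair (tensorLeft X)]
  [SymmetricCategory D] [HasCoequalizers D]
  [∀ X : D, PreservesColimitsOfShape WalkingParallelPair (tensorLeft X)]
  (F : C ⥤ D) [F.Braided]

lemma μ_swp (X Y Z : C) :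
    F.obj X ◁ Functor.LaxMonoidal.μ F Y Z ≫ Functor.LaxMonoidal.μ F X (Y ⊗ Z) ≫
        F.map (swp X Y Z) =
      swp _ _ _ ≫ F.obj Y ◁ Functor.LaxMonoidal.μ F X Z ≫ Functor.LaxMonoidal.μ F Y (X ⊗ Z) := by
  have h : Functor.LaxMonoidal.μ F X Y ▷ F.obj Z ≫ F.map (β_ X Y).hom ▷ F.obj Z =
      (β_ (F.obj X) (F.obj Y)).hom ▷ F.obj Z ≫ Functor.LaxMonoidal.μ F Y X ▷ F.obj Z := by
    rw [← comp_whiskerRight, ← comp_whiskerRight, Functor.LaxBraided.braided]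
  simp only [swp, F.map_comp]
  rw [Functor.LaxMonoidal.associativity_inv_assoc, ← μ_natural_left_assoc, reassoc_of% h,
    Functor.LaxMonoidal.associativity]
  simp

variable (A : C) [MonObj A]

lemma map_actL (M N : Mod C A) :
    F.obj A ◁ Functor.LaxMonoidal.μ F M.X N.X ≫ Functor.LaxMonoidal.μ F A _ ≫ F.map (actL M N) =
      ((α_ (F.obj A) (F.obj M.X) (F.obj N.X)).inv ≫
        (Functor.LaxMonoidal.μ F A M.X ≫ F.map (act M)) ▷ F.obj N.X) ≫
        Functor.LaxMonoidal.μ F M.X N.X := by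
  simp only [actL, F.map_comp]
  rw [Functor.LaxMonoidal.associativity_inv_assoc]
  simp

lemma map_actR (M N : Mod C A) :
    F.obj A ◁ Functor.LaxMonoidal.μ F M.X N.X ≫ Functor.LaxMonoidal.μ F A _ ≫ F.map (actR M N) =
      (swp (F.obj A) (F.obj M.X) (F.obj N.X) ≫
        F.obj M.X ◁ (Functor.LaxMonoidal.μ F A N.X ≫ F.map (act N))) ≫
        Functor.LaxMonoidal.μ F M.X N.X := by
  simp only [actR, F.map_comp]
  rw [reassoc_of% μ_swp]
  simp

variable [IsCommMonObj A]

lemma actL_π (M N : Mod C A) : actL M N ≫ π M N = A ◁ π M N ≫ act (M ⊗ N) := actL_q M N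

lemma actR_π (M N : Mod C A) : actR M N ≫ π M N = A ◁ π M N ≫ act (M ⊗ N) := actR_q M N

/-- The comparison morphism `F M ⊗_{F A} F N ⟶ F (M ⊗_A N)`. -/
def inducedμ (M N : Mod C A) :
    (induced F A).obj M ⊗ (induced F A).obj N ⟶ (induced F A).obj (M ⊗ N) :=
  relDesc (P := (induced F A).obj (M ⊗ N))
    (Functor.LaxMonoidal.μ F M.X N.X ≫ F.map (π M N))
    (by
      change ((α_ (F.obj A) (F.obj M.X) (F.obj N.X)).inv ≫
        (Functor.LaxMonoidal.μ F A M.X ≫ F.map (act M)) ▷ F.obj N.X) ≫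
          Functor.LaxMonoidal.μ F M.X N.X ≫ F.map (π M N) =
        F.obj A ◁ (Functor.LaxMonoidal.μ F M.X N.X ≫ F.map (π M N)) ≫
          Functor.LaxMonoidal.μ F A _ ≫ F.map (act (M ⊗ N))
      rw [← Category.assoc, ← map_actL, Category.assoc, Category.assoc, ← F.map_comp, actL_π]
      simp)
    (by
      change (swp (F.obj A) (F.obj M.X) (F.obj N.X) ≫
        F.obj M.X ◁ (Functor.LaxMonoidal.μ F A N.X ≫ F.map (act N))) ≫
          Functor.LaxMonoidal.μ F M.X N.X ≫ F.map (π M N) =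
        F.obj A ◁ (Functor.LaxMonoidal.μ F M.X N.X ≫ F.map (π M N)) ≫
          Functor.LaxMonoidal.μ F A _ ≫ F.map (act (M ⊗ N))
      rw [← Category.assoc, ← map_actR, Category.assoc, Category.assoc, ← F.map_comp, actR_π]
      simp)

/-- The canonical morphism `F M ⊗ F N ⟶ F M ⊗_{F A} F N`. -/
def πF (M N : Mod C A) : F.obj M.X ⊗ F.obj N.X ⟶
    ((induced F A).obj M ⊗ (induced F A).obj N : Mod D (F.obj A)).X :=
  π ((induced F A).obj M) ((induced F A).obj N)

instance (M N : Mod C A) : Epi (πF F A M N) :=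
  inferInstanceAs (Epi (π ((induced F A).obj M) ((induced F A).obj N)))

instance (M N : Mod C A) (Z : D) : Epi (πF F A M N ▷ Z) :=
  inferInstanceAs (Epi (π ((induced F A).obj M) ((induced F A).obj N) ▷ Z))

/-- The underlying morphism of `inducedμ`. -/
def inducedμX (M N : Mod C A) : ((induced F A).obj M ⊗ (induced F A).obj N : Mod D (F.obj A)).X ⟶
    F.obj (M ⊗ N : Mod C A).X :=
  (inducedμ F A M N).hom

lemma πF_inducedμX (M N : Mod C A) : πF F A M N ≫ inducedμX F A M N =
    Functor.LaxMonoidal.μ F M.X N.X ≫ F.map (π M N) :=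
  q_relDesc (P := (induced F A).obj (M ⊗ N)) _ _ _

lemma πF_inducedμX_assoc (M N : Mod C A) {Z : D} (h : F.obj (M ⊗ N : Mod C A).X ⟶ Z) :
    πF F A M N ≫ inducedμX F A M N ≫ h =
      Functor.LaxMonoidal.μ F M.X N.X ≫ F.map (π M N) ≫ h := by
  rw [← Category.assoc, πF_inducedμX, Category.assoc]

lemma πF_left {M M' N : Mod C A} (f : M ⟶ M') :
    πF F A M N ≫ (((induced F A).map f) ▷ ((induced F A).obj N)).hom =
      F.map f.hom ▷ F.obj N.X ≫ πF F A M' N :=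
  π_whiskerRight _ _

lemma πF_right {M N N' : Mod C A} (f : N ⟶ N') :
    πF F A M N ≫ (((induced F A).obj M) ◁ ((induced F A).map f)).hom =
      F.obj M.X ◁ F.map f.hom ≫ πF F A M N' :=
  π_whiskerLeft _ _

lemma induced_μ_natural_left {M M' : Mod C A} (f : M ⟶ M') (N : Mod C A) :
    (induced F A).map f ▷ (induced F A).obj N ≫ inducedμ F A M' N =
      inducedμ F A M N ≫ (induced F A).map (f ▷ N) := by
  have h : (((induced F A).map f) ▷ ((induced F A).obj N)).hom ≫ inducedμX F A M' N =
      inducedμX F A M N ≫ F.map (f ▷ N).hom := by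
    rw [← cancel_epi (πF F A M N), ← Category.assoc, πF_left, Category.assoc, πF_inducedμX,
      πF_inducedμX_assoc, ← F.map_comp, π_whiskerRight, F.map_comp, μ_natural_left_assoc]
  exact Mod.hom_ext _ _ h

lemma induced_μ_natural_right (N : Mod C A) {M M' : Mod C A} (f : M ⟶ M') :
    (induced F A).obj N ◁ (induced F A).map f ≫ inducedμ F A N M' =
      inducedμ F A N M ≫ (induced F A).map (N ◁ f) := by
  have h : (((induced F A).obj N) ◁ ((induced F A).map f)).hom ≫ inducedμX F A N M' =
      inducedμX F A N M ≫ F.map (N ◁ f).hom := by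
    rw [← cancel_epi (πF F A N M), ← Category.assoc, πF_right, Category.assoc, πF_inducedμX,
      πF_inducedμX_assoc, ← F.map_comp, π_whiskerLeft, F.map_comp, μ_natural_right_assoc]
  exact Mod.hom_ext _ _ h

lemma induced_associativity (M N P : Mod C A) :
    inducedμ F A M N ▷ (induced F A).obj P ≫ inducedμ F A (M ⊗ N) P ≫
        (induced F A).map (α_ M N P).hom =
      (α_ _ _ _).hom ≫ (induced F A).obj M ◁ inducedμ F A N P ≫ inducedμ F A M (N ⊗ P) := by
  obtain ⟨p, hp⟩ : ∃ p : ((induced F A).obj M ⊗ (induced F A).obj N : Mod D (F.obj A)).X ⊗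
      F.obj P.X ⟶ (((induced F A).obj M ⊗ (induced F A).obj N) ⊗ (induced F A).obj P :
        Mod D (F.obj A)).X,
      p = π ((induced F A).obj M ⊗ (induced F A).obj N) ((induced F A).obj P) := ⟨_, rfl⟩
  obtain ⟨p', hp'⟩ : ∃ p : F.obj M.X ⊗ ((induced F A).obj N ⊗ (induced F A).obj P :
      Mod D (F.obj A)).X ⟶ ((induced F A).obj M ⊗ ((induced F A).obj N ⊗ (induced F A).obj P) :
        Mod D (F.obj A)).X,
      p = π ((induced F A).obj M) ((induced F A).obj N ⊗ (induced F A).obj P) := ⟨_, rfl⟩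
  have h₁ : p ≫ (inducedμ F A M N ▷ (induced F A).obj P).hom =
      inducedμX F A M N ▷ F.obj P.X ≫ πF F A (M ⊗ N) P := by
    rw [hp]; exact π_whiskerRight _ _
  have h₂ : p' ≫ ((induced F A).obj M ◁ inducedμ F A N P).hom =
      F.obj M.X ◁ inducedμX F A N P ≫ πF F A M (N ⊗ P) := by
    rw [hp']; exact π_whiskerLeft _ _
  have h₃ : πF F A M N ▷ F.obj P.X ≫ p ≫
        (α_ ((induced F A).obj M) ((induced F A).obj N) ((induced F A).obj P)).hom.hom =
      (α_ (F.obj M.X) (F.obj N.X) (F.obj P.X)).hom ≫ F.obj M.X ◁ πF F A N P ≫ p' := by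
    rw [hp, hp']
    exact π_α ((induced F A).obj M) ((induced F A).obj N) ((induced F A).obj P)
  have key : πF F A M N ▷ F.obj P.X ≫ p ≫ (inducedμ F A M N ▷ (induced F A).obj P).hom ≫
      inducedμX F A (M ⊗ N) P ≫ F.map (α_ M N P).hom.hom =
    πF F A M N ▷ F.obj P.X ≫ p ≫
      (α_ ((induced F A).obj M) ((induced F A).obj N) ((induced F A).obj P)).hom.hom ≫
      ((induced F A).obj M ◁ inducedμ F A N P).hom ≫ inducedμX F A M (N ⊗ P) := by
    rw [reassoc_of% h₃, reassoc_of% h₂, πF_inducedμX, reassoc_of% h₁, πF_inducedμX_assoc,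
      ← comp_whiskerRight_assoc, πF_inducedμX, ← MonoidalCategory.whiskerLeft_comp_assoc,
      πF_inducedμX, comp_whiskerRight, MonoidalCategory.whiskerLeft_comp, Category.assoc,
      Category.assoc, μ_natural_left_assoc, μ_natural_right_assoc, ← F.map_comp, ← F.map_comp,
      π_α]
    simp
  rw [hp] at key
  exact tensor_hom_ext ((cancel_epi (πF F A M N ▷ F.obj P.X)).1 key)

/-- The induced functor is lax monoidal. -/
instance inducedLax : (induced F A).LaxMonoidal where
  ε := mkHom (M := Mod.regular (F.obj A)) (N := (induced F A).obj (Mod.regular A))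
    (𝟙 (F.obj A)) (by
      change (Functor.LaxMonoidal.μ F A A ≫ F.map (MonObj.mul (X := A))) ≫ 𝟙 _ =
        F.obj A ◁ 𝟙 (F.obj A) ≫ Functor.LaxMonoidal.μ F A A ≫ F.map (MonObj.mul (X := A))
      simp)
  μ M N := inducedμ F A M N
  μ_natural_left f N := induced_μ_natural_left F A f N
  μ_natural_right N f := induced_μ_natural_right F A N f
  associativity M N P := induced_associativity F A M N P
  left_unitality M := by
    refine tensor_hom_ext ?_
    refine (π_leftUnitor ((induced F A).obj M)).trans ?_
    refine Eq.trans ?_ (π_whiskerRight_assoc _ _ _).symm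
    change Functor.LaxMonoidal.μ F A M.X ≫ F.map (act M) =
      𝟙 (F.obj (𝟙_ (Mod C A)).X) ▷ F.obj M.X ≫ πF F A (𝟙_ (Mod C A)) M ≫ inducedμX F A (𝟙_ (Mod C A)) M ≫
        F.map (λ_ M).hom.hom
    rw [πF_inducedμX_assoc, ← F.map_comp, π_leftUnitor, id_whiskerRight, Category.id_comp]
    rfl
  right_unitality M := by
    refine tensor_hom_ext ?_
    refine (π_rightUnitor ((induced F A).obj M)).trans ?_
    refine Eq.trans ?_ (π_whiskerLeft_assoc _ _ _).symm
    change (β_ (F.obj M.X) (F.obj A)).hom ≫ Functor.LaxMonoidal.μ F A M.X ≫ F.map (act M) =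
      F.obj M.X ◁ 𝟙 (F.obj (𝟙_ (Mod C A)).X) ≫ πF F A M (𝟙_ (Mod C A)) ≫ inducedμX F A M (𝟙_ (Mod C A)) ≫
        F.map (ρ_ M).hom.hom
    rw [πF_inducedμX_assoc, ← F.map_comp, π_rightUnitor, MonoidalCategory.whiskerLeft_id,
      Category.id_comp]
    change _ = Functor.LaxMonoidal.μ F M.X A ≫ F.map ((β_ M.X A).hom ≫ act M)
    rw [F.map_comp, Functor.LaxBraided.braided_assoc]

instance : IsIso (Functor.LaxMonoidal.ε (induced F A)) :=
  Iso.isIso_hom (mkIso (M := Mod.regular (F.obj A)) (N := (induced F A).obj (Mod.regular A))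
    (Iso.refl (F.obj A)) (by
      change (Functor.LaxMonoidal.μ F A A ≫ F.map (MonObj.mul (X := A))) ≫ 𝟙 _ =
        F.obj A ◁ 𝟙 (F.obj A) ≫ Functor.LaxMonoidal.μ F A A ≫ F.map (MonObj.mul (X := A))
      simp))

variable [PreservesColimitsOfShape WalkingParallelPair F]

instance epi_map_π (M N : Mod C A) : Epi (F.map (π M N)) :=
  inferInstanceAs (Epi (F.map (coequalizer.π (actL M N) (actR M N))))

lemma exists_δ (M N : Mod C A) : ∃ k : F.obj (M ⊗ N : Mod C A).X ⟶
      ((induced F A).obj M ⊗ (induced F A).obj N : Mod D (F.obj A)).X,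
    F.map (π M N) ≫ k = Functor.OplaxMonoidal.δ F M.X N.X ≫ πF F A M N := by
  refine ⟨_, (Cofork.IsColimit.desc' (isColimitOfHasCoequalizerOfPreservesColimit F
    (actL M N) (actR M N)) (Functor.OplaxMonoidal.δ F M.X N.X ≫ πF F A M N) ?_).2⟩
  have h : ((α_ (F.obj A) (F.obj M.X) (F.obj N.X)).inv ≫
        (Functor.LaxMonoidal.μ F A M.X ≫ F.map (act M)) ▷ F.obj N.X) ≫ πF F A M N =
      (swp (F.obj A) (F.obj M.X) (F.obj N.X) ≫
        F.obj M.X ◁ (Functor.LaxMonoidal.μ F A N.X ≫ F.map (act N))) ≫ πF F A M N :=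
    coequalizer.condition (actL ((induced F A).obj M) ((induced F A).obj N)) (actR _ _)
  rw [← cancel_epi (Functor.LaxMonoidal.μ F A (M.X ⊗ N.X)),
    ← cancel_epi (F.obj A ◁ Functor.LaxMonoidal.μ F M.X N.X)]
  have h₁ := map_actL F A M N =≫ (Functor.OplaxMonoidal.δ F M.X N.X ≫ πF F A M N)
  have h₂ := map_actR F A M N =≫ (Functor.OplaxMonoidal.δ F M.X N.X ≫ πF F A M N)
  simp only [Category.assoc, Functor.Monoidal.μ_δ_assoc] at h h₁ h₂
  rw [h₁, h₂, h]

instance (M N : Mod C A) : IsIso (Functor.LaxMonoidal.μ (induced F A) M N) := by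
  obtain ⟨k, hk⟩ := exists_δ F A M N
  refine Iso.isIso_hom (mkIso (M := (induced F A).obj M ⊗ (induced F A).obj N)
    (N := (induced F A).obj (M ⊗ N)) ⟨inducedμX F A M N, k, ?_, ?_⟩ (act_hom (inducedμ F A M N)))
  · have h : inducedμX F A M N ≫ k = 𝟙 _ := by
      rw [← cancel_epi (πF F A M N), πF_inducedμX_assoc, hk]
      simp
    exact h
  · change k ≫ inducedμX F A M N = 𝟙 (F.obj (M ⊗ N : Mod C A).X)
    rw [← cancel_epi (F.map (π M N)), reassoc_of% hk, πF_inducedμX]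
    simp

/-- The induced functor is strong monoidal if `F` preserves coequalizers. -/
instance inducedMonoidal : (induced F A).Monoidal where
  toLaxMonoidal := inducedLax F A
  toOplaxMonoidal := (Functor.Monoidal.ofLaxMonoidal (induced F A)).toOplaxMonoidal
  ε_η := (Functor.Monoidal.ofLaxMonoidal (induced F A)).ε_η
  η_ε := (Functor.Monoidal.ofLaxMonoidal (induced F A)).η_ε
  μ_δ := (Functor.Monoidal.ofLaxMonoidal (induced F A)).μ_δ
  δ_μ := (Functor.Monoidal.ofLaxMonoidal (induced F A)).δ_μ

/-- The induced functor is symmetric strong monoidal if `F` preserves coequalizers. -/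
instance : (induced F A).Braided where
  braided M N := by
    have h : inducedμX F A M N ≫ F.map (β_ M N).hom.hom =
        (β_ ((induced F A).obj M) ((induced F A).obj N)).hom.hom ≫ inducedμX F A N M := by
      have h₁ : πF F A M N ≫ (β_ ((induced F A).obj M) ((induced F A).obj N)).hom.hom =
        (β_ (F.obj M.X) (F.obj N.X)).hom ≫ πF F A N M := π_braiding _ _
      rw [← cancel_epi (πF F A M N), πF_inducedμX_assoc, reassoc_of% h₁, πF_inducedμX,
        ← F.map_comp, π_braiding, F.map_comp, Functor.LaxBraided.braided_assoc]
    exact Mod.hom_ext _ _ h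

/-- The inverse of `inducedμX`. -/
def inducedδX (M N : Mod C A) : F.obj (M ⊗ N : Mod C A).X ⟶
    ((induced F A).obj M ⊗ (induced F A).obj N : Mod D (F.obj A)).X :=
  (Functor.OplaxMonoidal.δ (induced F A) M N).hom

lemma map_π_δ (M N : Mod C A) :
    F.map (π M N) ≫ inducedδX F A M N = Functor.OplaxMonoidal.δ F M.X N.X ≫ πF F A M N := by
  have h : inducedμX F A M N ≫ inducedδX F A M N = 𝟙 _ :=
    congrArg Mod.Hom.hom (Functor.Monoidal.μ_δ (induced F A) M N)
  rw [← cancel_epi (Functor.LaxMonoidal.μ F M.X N.X), ← πF_inducedμX_assoc, h]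
  simp

/-- The isomorphism `F A ⊗ F X ≅ F (A ⊗ X)` of free modules. -/
def freeIso : F ⋙ free (F.obj A) ≅ free A ⋙ induced F A :=
  NatIso.ofComponents
    (fun X => mkIso (M := (free (F.obj A)).obj (F.obj X)) (N := (induced F A).obj ((free A).obj X))
      (Functor.Monoidal.μIso F A X) (by
        change ((α_ (F.obj A) (F.obj A) (F.obj X)).inv ≫ (Functor.LaxMonoidal.μ F A A ≫
            F.map (MonObj.mul (X := A))) ▷ F.obj X) ≫ Functor.LaxMonoidal.μ F A X =
          F.obj A ◁ Functor.LaxMonoidal.μ F A X ≫ Functor.LaxMonoidal.μ F A (A ⊗ X) ≫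
            F.map ((α_ A A X).inv ≫ MonObj.mul (X := A) ▷ X)
        rw [F.map_comp, Functor.LaxMonoidal.associativity_inv_assoc]
        simp))
    (fun f => Mod.hom_ext _ _ (Functor.LaxMonoidal.μ_natural_right F A f))

lemma unitFree_freeIso (X : C) :
    unitFree (F.obj A) (F.obj X) ≫ ((freeIso F A).hom.app X).hom = F.map (unitFree A X) := by
  change ((λ_ (F.obj X)).inv ≫ (Functor.LaxMonoidal.ε F ≫ F.map (MonObj.one (X := A))) ▷ F.obj X) ≫
    Functor.LaxMonoidal.μ F A X = F.map ((λ_ X).inv ≫ MonObj.one (X := A) ▷ X)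
  rw [comp_whiskerRight, F.map_comp, ← Functor.LaxMonoidal.left_unitality_inv]
  simp

/-- The underlying morphism of the component at `X` of `freeIso`. -/
def freeIsoX (X : C) : ((free (F.obj A)).obj (F.obj X)).X ⟶ F.obj ((free A).obj X).X :=
  ((freeIso F A).hom.app X).hom

lemma unitFree_freeIsoX (X : C) :
    unitFree (F.obj A) (F.obj X) ≫ freeIsoX F A X = F.map (unitFree A X) :=
  unitFree_freeIso F A X

/-- The isomorphism `F A ⊗ F X ≅ F (A ⊗ X)` is compatible with the tensor products. -/
lemma freeIso_δ (X Y : C) :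
    (freeIso F A).hom.app (X ⊗ Y) ≫ Functor.OplaxMonoidal.δ (free A ⋙ induced F A) X Y =
      Functor.OplaxMonoidal.δ (F ⋙ free (F.obj A)) X Y ≫
        ((freeIso F A).hom.app X ⊗ₘ (freeIso F A).hom.app Y) := by
  obtain ⟨t, ht⟩ : ∃ t : ((free (F.obj A)).obj (F.obj X) ⊗ (free (F.obj A)).obj (F.obj Y) :
      Mod D (F.obj A)).X ⟶ ((induced F A).obj ((free A).obj X) ⊗ (induced F A).obj ((free A).obj Y) :
      Mod D (F.obj A)).X, t = ((freeIso F A).hom.app X ⊗ₘ (freeIso F A).hom.app Y).hom :=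
    ⟨_, rfl⟩
  have h₁ : F.map (unitFree A (X ⊗ Y)) ≫
      F.map (Functor.OplaxMonoidal.δ (free A) X Y).hom ≫
        inducedδX F A ((free A).obj X) ((free A).obj Y) =
      Functor.OplaxMonoidal.δ F X Y ≫ (F.map (unitFree A X) ⊗ₘ F.map (unitFree A Y)) ≫
        πF F A ((free A).obj X) ((free A).obj Y) := by
    rw [← F.map_comp_assoc, unitFree_δ, F.map_comp, Category.assoc, map_π_δ,
      ← Functor.OplaxMonoidal.δ_natural_assoc]
  have h₂ : unitFree (F.obj A) (F.obj (X ⊗ Y)) ≫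
      ((free (F.obj A)).map (Functor.OplaxMonoidal.δ F X Y)).hom ≫
      (Functor.OplaxMonoidal.δ (free (F.obj A)) (F.obj X) (F.obj Y)).hom =
      Functor.OplaxMonoidal.δ F X Y ≫
        (unitFree (F.obj A) (F.obj X) ⊗ₘ unitFree (F.obj A) (F.obj Y)) ≫
        π ((free (F.obj A)).obj (F.obj X)) ((free (F.obj A)).obj (F.obj Y)) := by
    rw [← Category.assoc, unitFree_map, Category.assoc, unitFree_δ]
  have h₃ : π ((free (F.obj A)).obj (F.obj X)) ((free (F.obj A)).obj (F.obj Y)) ≫ t =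
      (freeIsoX F A X ⊗ₘ freeIsoX F A Y) ≫ πF F A ((free A).obj X) ((free A).obj Y) := by
    rw [ht]; exact π_tensorHom _ _
  have key : unitFree (F.obj A) (F.obj (X ⊗ Y)) ≫ freeIsoX F A (X ⊗ Y) ≫
      F.map (Functor.OplaxMonoidal.δ (free A) X Y).hom ≫
        inducedδX F A ((free A).obj X) ((free A).obj Y) =
      unitFree (F.obj A) (F.obj (X ⊗ Y)) ≫
        (((free (F.obj A)).map (Functor.OplaxMonoidal.δ F X Y)).hom ≫
        (Functor.OplaxMonoidal.δ (free (F.obj A)) (F.obj X) (F.obj Y)).hom) ≫ t := by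
    rw [reassoc_of% unitFree_freeIsoX, h₁, Category.assoc, reassoc_of% h₂, h₃,
      tensorHom_comp_tensorHom_assoc, unitFree_freeIsoX, unitFree_freeIsoX]
  rw [ht] at key
  exact free_hom_ext key

lemma freeIso_η : (freeIso F A).hom.app (𝟙_ C) ≫ Functor.OplaxMonoidal.η (free A ⋙ induced F A) =
    Functor.OplaxMonoidal.η (F ⋙ free (F.obj A)) := by
  obtain ⟨e, he⟩ : ∃ e : F.obj (Mod.regular A).X ⟶ (Mod.regular (F.obj A)).X,
    e = (Functor.OplaxMonoidal.η (induced F A)).hom := ⟨_, rfl⟩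
  obtain ⟨n, hn⟩ : ∃ n : ((free A).obj (𝟙_ C)).X ⟶ (Mod.regular A).X,
    n = (Functor.OplaxMonoidal.η (free A)).hom := ⟨_, rfl⟩
  have he' : e = 𝟙 (F.obj A) := by
    rw [he]
    have h : 𝟙 (F.obj A) ≫ (Functor.OplaxMonoidal.η (induced F A)).hom = 𝟙 (F.obj A) :=
      congrArg Mod.Hom.hom (Functor.Monoidal.ε_η (induced F A))
    exact (Category.id_comp _).symm.trans h
  have hu : unitFree A (𝟙_ C) ≫ n = MonObj.one (X := A) := by rw [hn]; exact unitFree_η A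
  have hu' : unitFree (F.obj A) (𝟙_ D) ≫ (Functor.OplaxMonoidal.η (free (F.obj A))).hom =
    Functor.LaxMonoidal.ε F ≫ F.map (MonObj.one (X := A)) := unitFree_η (F.obj A)
  have key : unitFree (F.obj A) (F.obj (𝟙_ C)) ≫ freeIsoX F A (𝟙_ C) ≫ F.map n ≫ e =
      unitFree (F.obj A) (F.obj (𝟙_ C)) ≫
        ((free (F.obj A)).map (Functor.OplaxMonoidal.η F)).hom ≫
        (Functor.OplaxMonoidal.η (free (F.obj A))).hom := by
    rw [reassoc_of% unitFree_freeIsoX, ← F.map_comp_assoc, hu, reassoc_of% unitFree_map, he']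
    refine Eq.trans ?_ (_ ≫= hu').symm
    change F.map (MonObj.one (X := A)) ≫ 𝟙 (F.obj A) =
      Functor.OplaxMonoidal.η F ≫ Functor.LaxMonoidal.ε F ≫ F.map (MonObj.one (X := A))
    rw [Functor.Monoidal.η_ε_assoc, Category.comp_id]
  rw [he, hn] at key
  exact free_hom_ext key

instance : NatTrans.IsMonoidal (freeIso F A).hom where
  unit := by
    rw [← cancel_mono (Functor.OplaxMonoidal.η (free A ⋙ induced F A)), Category.assoc, freeIso_η,
      Functor.Monoidal.ε_η, Functor.Monoidal.ε_η]
  tensor X Y := by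
    rw [← cancel_mono (Functor.OplaxMonoidal.δ (free A ⋙ induced F A) X Y), Category.assoc,
      freeIso_δ, Functor.Monoidal.μ_δ_assoc, Category.assoc, Functor.Monoidal.μ_δ, Category.comp_id]

end Induced

/-! ### Tensor categories -/

section TensorCategory

variable (C : Type u) [Category.{v} C] [MonoidalCategory C] [SymmetricCategory C]

/-- The conditions on a symmetric monoidal category to be a tensor category: it is locally
finitely presentable (in particular cocomplete), the unit object is finitely presentable, the
finitely presentable objects are closed under the tensor product, and the symmetric monoidal
structure is closed. -/
class IsTensorCategory : Prop where
  locallyFinitelyPresentable : IsLocallyFinitelyPresentable.{v} C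
  unit : IsFinitelyPresentable.{v} (𝟙_ C)
  tensor (X Y : C) : IsFinitelyPresentable.{v} X → IsFinitelyPresentable.{v} Y →
    IsFinitelyPresentable.{v} (X ⊗ Y)
  closed (X : C) : (tensorLeft X).IsLeftAdjoint

variable [IsTensorCategory C]

instance hasColimits_of_isTensorCategory : HasColimitsOfSize.{v, v} C :=
  (IsTensorCategory.locallyFinitelyPresentable (C := C)).toHasColimitsOfSize

instance hasCoequalizers_of_isTensorCategory : HasCoequalizers C :=
  inferInstance

variable {C} in
instance preserves_tensorLeft (X : C) :
    PreservesColimitsOfShape WalkingParallelPair (tensorLeft X) :=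
  have := IsTensorCategory.closed X
  inferInstance

end TensorCategory

/-- A tensor category over `R`: a locally finitely presentable closed symmetric monoidal `R`-linear
category whose tensor product is `R`-bilinear. -/
structure TensorCat (R : Type u) [CommRing R] where
  /-- The underlying category. -/
  carrier : Type (v + 1)
  [category : Category.{v} carrier]
  [preadditive : Preadditive carrier]
  [linear : CategoryTheory.Linear R carrier]
  [monoidal : MonoidalCategory carrier]
  [symmetric : SymmetricCategory carrier]
  [monoidalPreadditive : MonoidalPreadditive carrier]
  [monoidalLinear : MonoidalLinear R carrier]
  [isTensorCategory : IsTensorCategory carrier]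

namespace TensorCat

variable {R : Type u} [CommRing R]

instance : CoeSort (TensorCat.{v, u} R) (Type (v + 1)) := ⟨TensorCat.carrier⟩

attribute [instance] category preadditive linear monoidal symmetric monoidalPreadditive
  monoidalLinear isTensorCategory

end TensorCat

section TwoCategory

variable {R : Type u} [CommRing R]

/-- A tensor functor: an `R`-linear symmetric strong monoidal functor which has a right adjoint. -/
structure TensorFunctor (C D : TensorCat.{v, u} R) where
  /-- The underlying functor. -/
  functor : C ⥤ D
  [braided : functor.Braided]
  [additive : functor.Additive]
  [linear : functor.Linear R]
  [isLeftAdjoint : functor.IsLeftAdjoint]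

attribute [instance] TensorFunctor.braided TensorFunctor.additive TensorFunctor.linear
  TensorFunctor.isLeftAdjoint

/-- A symmetric monoidal natural transformation between tensor functors. -/
@[ext]
structure TensorTrans {C D : TensorCat.{v, u} R} (F G : TensorFunctor C D) where
  /-- The underlying natural transformation. -/
  natTrans : F.functor ⟶ G.functor
  isMonoidal : natTrans.IsMonoidal

attribute [instance] TensorTrans.isMonoidal

instance (C D : TensorCat.{v, u} R) : Category (TensorFunctor C D) where
  Hom F G := TensorTrans F G
  id F := ⟨𝟙 F.functor, inferInstance⟩
  comp f g := ⟨f.natTrans ≫ g.natTrans, inferInstance⟩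
  id_comp _ := TensorTrans.ext (Category.id_comp _)
  comp_id _ := TensorTrans.ext (Category.comp_id _)
  assoc _ _ _ := TensorTrans.ext (Category.assoc _ _ _)

variable {C D : TensorCat.{v, u} R}

@[ext]
lemma tensorTrans_ext {F G : TensorFunctor C D} {f g : F ⟶ G} (h : f.natTrans = g.natTrans) :
    f = g :=
  TensorTrans.ext h

@[simp] lemma natTrans_id (F : TensorFunctor C D) : (𝟙 F : F ⟶ F).natTrans = 𝟙 F.functor := rfl

@[simp] lemma natTrans_comp {F G H : TensorFunctor C D} (f : F ⟶ G) (g : G ⟶ H) :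
    (f ≫ g).natTrans = f.natTrans ≫ g.natTrans := rfl

/-- A monoidal natural isomorphism is an isomorphism of tensor functors. -/
def tensorIso {F G : TensorFunctor C D} (e : F.functor ≅ G.functor) (h : e.hom.IsMonoidal) :
    F ≅ G where
  hom := ⟨e.hom, h⟩
  inv := ⟨e.inv, inferInstance⟩
  hom_inv_id := TensorTrans.ext e.hom_inv_id
  inv_hom_id := TensorTrans.ext e.inv_hom_id

/-- The identity tensor functor. -/
def TensorFunctor.id (C : TensorCat.{v, u} R) : TensorFunctor C C where
  functor := 𝟭 C

/-- The composition of tensor functors. -/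
def TensorFunctor.comp {C D E : TensorCat.{v, u} R} (F : TensorFunctor C D)
    (G : TensorFunctor D E) : TensorFunctor C E where
  functor := F.functor ⋙ G.functor
  isLeftAdjoint := inferInstance

instance : CategoryStruct (TensorCat.{v, u} R) where
  Hom C D := TensorFunctor C D
  id C := TensorFunctor.id C
  comp F G := TensorFunctor.comp F G

instance (C D : TensorCat.{v, u} R) : Category (C ⟶ D) :=
  inferInstanceAs (Category (TensorFunctor C D))

/-- Horizontal composition of the identity of `F` with a transformation. -/
def whiskerL {C D E : TensorCat.{v, u} R} (F : C ⟶ D) {G H : D ⟶ E} (f : G ⟶ H) :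
    F ≫ G ⟶ F ≫ H :=
  TensorTrans.mk (F := TensorFunctor.comp F G) (G := TensorFunctor.comp F H)
    (Functor.whiskerLeft F.functor f.natTrans)
    (NatTrans.IsMonoidal.whiskerLeft (F₁ := F.functor) f.natTrans)

/-- Horizontal composition of a transformation with the identity of `H`. -/
def whiskerR {C D E : TensorCat.{v, u} R} {F G : C ⟶ D} (f : F ⟶ G) (H : D ⟶ E) :
    F ≫ H ⟶ G ≫ H :=
  TensorTrans.mk (F := TensorFunctor.comp F H) (G := TensorFunctor.comp G H)
    (Functor.whiskerRight f.natTrans H.functor)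
    (NatTrans.IsMonoidal.whiskerRight (G₁ := H.functor) f.natTrans)

lemma associator_isMonoidal {C D E E' : TensorCat.{v, u} R} (F : TensorFunctor C D)
    (G : TensorFunctor D E) (H : TensorFunctor E E') :
    (Functor.associator F.functor G.functor H.functor).hom.IsMonoidal := inferInstance

lemma leftUnitor_isMonoidal (F : TensorFunctor C D) :
    (Functor.leftUnitor F.functor).hom.IsMonoidal := inferInstance

lemma rightUnitor_isMonoidal (F : TensorFunctor C D) :
    (Functor.rightUnitor F.functor).hom.IsMonoidal := inferInstance

/-- The bicategory of tensor categories over `R`, tensor functors and symmetric monoidal natural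
transformations. -/
instance : Bicategory (TensorCat.{v, u} R) where
  whiskerLeft F _ _ f := whiskerL F f
  whiskerRight f H := whiskerR f H
  associator F G H := tensorIso (F := (F.comp G).comp H) (G := F.comp (G.comp H))
    (Functor.associator F.functor G.functor H.functor) (associator_isMonoidal F G H)
  leftUnitor F := tensorIso (F := (TensorFunctor.id _).comp F) (G := F)
    (Functor.leftUnitor F.functor) (leftUnitor_isMonoidal F)
  rightUnitor F := tensorIso (F := F.comp (TensorFunctor.id _)) (G := F)
    (Functor.rightUnitor F.functor) (rightUnitor_isMonoidal F)
  whiskerLeft_id _ _ := by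
    refine TensorTrans.ext (NatTrans.ext (funext fun _ => ?_))
    rfl
  whiskerLeft_comp _ _ _ _ _ _ := by
    refine TensorTrans.ext (NatTrans.ext (funext fun _ => ?_))
    rfl
  id_whiskerLeft _ := by
    refine TensorTrans.ext (NatTrans.ext (funext fun _ => ?_))
    exact ((Category.id_comp _).trans (Category.comp_id _)).symm
  comp_whiskerLeft _ _ _ _ _ := by
    refine TensorTrans.ext (NatTrans.ext (funext fun _ => ?_))
    exact ((Category.id_comp _).trans (Category.comp_id _)).symm
  id_whiskerRight _ H := by
    refine TensorTrans.ext (NatTrans.ext (funext fun _ => ?_))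
    exact H.functor.map_id _
  comp_whiskerRight _ _ H := by
    refine TensorTrans.ext (NatTrans.ext (funext fun _ => ?_))
    exact H.functor.map_comp _ _
  whiskerRight_id _ := by
    refine TensorTrans.ext (NatTrans.ext (funext fun _ => ?_))
    exact ((Category.id_comp _).trans (Category.comp_id _)).symm
  whiskerRight_comp _ _ _ := by
    refine TensorTrans.ext (NatTrans.ext (funext fun _ => ?_))
    exact ((Category.id_comp _).trans (Category.comp_id _)).symm
  whisker_assoc _ _ _ _ _ := by
    refine TensorTrans.ext (NatTrans.ext (funext fun _ => ?_))
    exact ((Category.id_comp _).trans (Category.comp_id _)).symm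
  whisker_exchange f g := by
    refine TensorTrans.ext (NatTrans.ext (funext fun _ => ?_))
    exact ((TensorTrans.natTrans g).naturality ((TensorTrans.natTrans f).app _)).symm
  pentagon F G H K := by
    refine TensorTrans.ext (NatTrans.ext (funext fun X => ?_))
    exact (K.functor.map_id (H.functor.obj (G.functor.obj (F.functor.obj X))) =≫ _).trans
      (Category.id_comp _)
  triangle F G := by
    refine TensorTrans.ext (NatTrans.ext (funext fun X => ?_))
    exact (Category.id_comp _).trans (G.functor.map_id (F.functor.obj X)).symm

end TwoCategory

/-! ### Bicategorical pushouts -/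

section Bipushout

open Bicategory

variable {B : Type u} [Bicategory.{v, v'} B]

/-- The functor which sends `h : d ⟶ e` to the pair `(p ≫ h, q ≫ h)`, together with the
isomorphism `f ≫ p ≫ h ≅ g ≫ q ≫ h` induced by `σ : f ≫ p ≅ g ≫ q`. -/
def pushoutComparison {a b c d : B} (f : c ⟶ a) (g : c ⟶ b) (p : a ⟶ d) (q : b ⟶ d)
    (σ : f ≫ p ≅ g ≫ q) (e : B) :
    (d ⟶ e) ⥤ CategoricalPullback (precomp e f) (precomp e g) where
  obj h :=
    { fst := p ≫ h
      snd := q ≫ h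
      iso := (α_ f p h).symm ≪≫ whiskerRightIso σ h ≪≫ α_ g q h }
  map t :=
    { fst := p ◁ t
      snd := q ◁ t
      w := by
        change f ◁ p ◁ t ≫ (α_ f p _).inv ≫ σ.hom ▷ _ ≫ (α_ g q _).hom =
          ((α_ f p _).inv ≫ σ.hom ▷ _ ≫ (α_ g q _).hom) ≫ g ◁ q ◁ t
        rw [Bicategory.associator_inv_naturality_right_assoc, Bicategory.whisker_exchange_assoc]
        simp }
  map_id h := by
    ext <;> simp
  map_comp s t := by
    ext <;> simp

/-- A square which commutes up to the isomorphism `σ : f ≫ p ≅ g ≫ q` is a bicategorical pushout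
if it is universal among the squares on `f` and `g` which commute up to a specified isomorphism,
that is, if for all `e` the comparison functor from the category of 1-cells `d ⟶ e` to the
category of triples `(h : a ⟶ e, k : b ⟶ e, f ≫ h ≅ g ≫ k)` is an equivalence. -/
def IsBipushout {a b c d : B} (f : c ⟶ a) (g : c ⟶ b) (p : a ⟶ d) (q : b ⟶ d)
    (σ : f ≫ p ≅ g ≫ q) : Prop :=
  ∀ e : B, (pushoutComparison f g p q σ e).IsEquivalence

end Bipushout

/-! ### The square of free module functors -/

section Square

variable {R : Type u} [CommRing R]

/-- The tensor category of modules of a commutative algebra in a tensor category. -/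
def modCat (C : TensorCat.{v, u} R) (A : C) [MonObj A] [IsCommMonObj A]
    [IsTensorCategory (Mod C.carrier A)] : TensorCat.{v, u} R where
  carrier := Mod C.carrier A

/-- The tensor functor `A ⊗ - : C ⟶ C_A`. -/
def freeFunctor (C : TensorCat.{v, u} R) (A : C) [MonObj A] [IsCommMonObj A]
    [IsTensorCategory (Mod C.carrier A)] : TensorFunctor C (modCat C A) where
  functor := free A
  braided := (inferInstance : (free (C := C.carrier) A).Braided)
  additive := (inferInstance : (free (C := C.carrier) A).Additive)
  linear := (inferInstance : (free (C := C.carrier) A).Linear R)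
  isLeftAdjoint := (inferInstance : (free (C := C.carrier) A).IsLeftAdjoint)

variable {C D : TensorCat.{v, u} R} (F : TensorFunctor C D) (A : C) [MonObj A] [IsCommMonObj A]
  [IsTensorCategory (Mod C.carrier A)] [IsTensorCategory (Mod D.carrier (F.functor.obj A))]

/-- The tensor functor `M ↦ F M` from `C_A` to `D_{FA}`. -/
def inducedFunctor (h : (induced F.functor A).IsLeftAdjoint) :
    TensorFunctor (modCat C A) (modCat D (F.functor.obj A)) where
  functor := induced F.functor A
  braided := (inferInstance : (induced F.functor A).Braided)
  additive := (inferInstance : (induced F.functor A).Additive)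
  linear := (inferInstance : (induced F.functor A).Linear R)
  isLeftAdjoint := h

/-- The isomorphism `F (A ⊗ X) ≅ F A ⊗ F X` of tensor functors. -/
def squareIso (h : (induced F.functor A).IsLeftAdjoint) :
    (freeFunctor C A).comp (inducedFunctor F A h) ≅ F.comp (freeFunctor D (F.functor.obj A)) :=
  tensorIso (freeIso F.functor A).symm
    (inferInstance : (freeIso F.functor A).inv.IsMonoidal)

end Square

end TensorCategories

end

open TensorCategories

noncomputable section

namespace TensorCategories

/-! ### Cocontinuous functors out of presentable categories -/

section AdjointFunctor

variable {C : Type u} [Category.{v} C] {D : Type u'} [Category.{v} D]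

/-! A tensor functor `H` on the modules of a commutative algebra `B` in `D` amounts to two data: its
restriction `L` along the free module functor, and a morphism of algebras `L B ⟶ 𝟙_`. The latter
comes from applying `H` to the multiplication of `B`, read as a `B`-linear map `freeCounitUnit B`
from the free module on `B` to the unit object `B`. Conversely, `L` and a morphism of algebras `L B
⟶ 𝟙_` give back the functor sending `M` to the tensor product of `L M` with the unit over `L B`: the
induced functor from `B`-modules to `L B`-modules, followed by `Augmentation.baseChange`.

The pushout property follows by taking `B = F A`. A functor `K` on `A`-modules whose restriction to
free modules is `F ⋙ L` carries a morphism of algebras `L (F A) ⟶ 𝟙_` (`augmentation`), which is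
exactly what is missing in order to extend `L` to `F A`-modules. The functors `K` and `induced F A ⋙
H` then have the same restriction to free modules and the same augmentation, so they are isomorphic
(`exists_iso_induced`); this is essential surjectivity.

The passage from free modules to all modules rests on the presentation of `M` as a coequalizer of
free modules on `B ⊗ M` and `M` (`isColimitFreeCounit`), which left adjoints preserve. Hence a
transformation is determined on free modules, which gives faithfulness. To extend one, naturality is
needed against the counit of a free module, which does not come from a morphism of `D`. By
`freeMul_eq` that counit is built from the monoidal structure and `freeCounitUnit B`, so monoidality
reduces the requirement to one equation at `B` (`IsMonoidalOnFree.mul`). For fullness the equation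
is supplied by the component on `A`-modules (`exists_natTrans_induced`).

That modules form a tensor category follows from the free modules on finitely presentable
generators: they are finitely presentable, form a strong generator, and are closed under the
relative tensor product up to isomorphism. Right adjoints come from the adjoint functor theorem for
locally finitely presentable categories. -/

open Functor in
/-- A cocontinuous functor on a cocomplete category with a small dense subcategory has a right
adjoint. -/
lemma isLeftAdjoint_of_isDense [HasColimitsOfSize.{v, v} C] (P : ObjectProperty C)
    [ObjectProperty.EssentiallySmall.{v} P] [P.ι.IsDense] (T : C ⥤ D)
    [PreservesColimitsOfSize.{v, v} T] : T.IsLeftAdjoint := by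
  have (Y : D) : HasTerminal (CostructuredArrow T Y) := by
    -- The value at `Y` of the right adjoint is the colimit `Z` of all `p` in `P` equipped with a
    -- morphism `T p ⟶ Y`. Restricting to `P` makes the index category essentially small.
    let J := CostructuredArrow (P.ι ⋙ T) Y
    let Φ : J ⥤ C := CostructuredArrow.proj (P.ι ⋙ T) Y ⋙ P.ι
    have : HasColimitsOfShape J C :=
      hasColimitsOfShape_of_equivalence (equivSmallModel.{v} J).symm
    have : PreservesColimitsOfShape J T :=
      preservesColimitsOfShape_of_equiv (equivSmallModel.{v} J).symm T
    let Z : C := colimit Φ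
    let ht := isColimitOfPreserves T (colimit.isColimit Φ)
    let z : T.obj Z ⟶ Y := ht.desc
      { pt := Y
        ι := { app := fun j => j.hom
               naturality := fun i j f => (CostructuredArrow.w f).trans (Category.comp_id _).symm } }
    let leg (p : P.FullSubcategory) (f : T.obj p.obj ⟶ Y) : p.obj ⟶ Z :=
      colimit.ι Φ (CostructuredArrow.mk (Y := p) f : J)
    have hz (p : P.FullSubcategory) (f : T.obj p.obj ⟶ Y) : T.map (leg p f) ≫ z = f :=
      ht.fac _ (CostructuredArrow.mk (Y := p) f : J)
    have leg_nat {p r : P.FullSubcategory} (a : p ⟶ r) (f : T.obj r.obj ⟶ Y) :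
        a.hom ≫ leg r f = leg p (T.map a.hom ≫ f) :=
      colimit.w Φ (CostructuredArrow.homMk a rfl :
        (CostructuredArrow.mk (Y := p) (T.map a.hom ≫ f) : J) ⟶ CostructuredArrow.mk (Y := r) f)
    let c (X : C) : Cocone (CostructuredArrow.proj P.ι X ⋙ P.ι) :=
      { pt := X
        ι := { app := fun k => k.hom
               naturality := fun i j f => (CostructuredArrow.w f).trans (Category.comp_id _).symm } }
    -- Density: `X` is the colimit of the objects of `P` over it, so a morphism `T X ⟶ Y` induces `X
    -- ⟶ Z` by restriction to these objects.
    let hc (X : C) : IsColimit (c X) := IsColimit.ofIsoColimit (P.ι.denseAt X)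
      (Cocone.ext (Iso.refl _) (fun k => (Category.comp_id _).trans (Category.id_comp _)))
    let d {X : C} (f : T.obj X ⟶ Y) : X ⟶ Z := (hc X).desc
      { pt := Z
        ι := { app := fun k => leg k.left (T.map k.hom ≫ f)
               naturality := fun k l a => by
                 refine (leg_nat a.left _).trans (Eq.trans ?_ (Category.comp_id _).symm)
                 rw [← T.map_comp_assoc]
                 exact congrArg (fun g => leg k.left (T.map g ≫ f)) (CostructuredArrow.w a) } }
    have hd {X : C} (f : T.obj X ⟶ Y) (p : P.FullSubcategory) (g : p.obj ⟶ X) :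
        g ≫ d f = leg p (T.map g ≫ f) :=
      (hc X).fac _ (CostructuredArrow.mk (S := P.ι) (Y := p) g)
    have hdz {X : C} (f : T.obj X ⟶ Y) : T.map (d f) ≫ z = f := by
      have : PreservesColimitsOfShape (CostructuredArrow P.ι X) T :=
        preservesColimitsOfShape_of_equiv
          (equivSmallModel.{v} (CostructuredArrow P.ι X)).symm T
      refine (isColimitOfPreserves T (hc X)).hom_ext (fun k => ?_)
      have h₁ : T.map k.hom ≫ T.map (d f) ≫ z = T.map k.hom ≫ f := by
        rw [← T.map_comp_assoc]
        refine (congrArg (fun g => T.map g ≫ z) (hd f k.left k.hom)).trans ?_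
        exact hz _ _
      exact h₁
    have hid : d z = 𝟙 Z := by
      refine colimit.hom_ext (fun j => ?_)
      refine (hd z j.left (leg j.left j.hom)).trans ?_
      rw [hz]
      exact (Category.comp_id _).symm
    -- Tested on `g : p ⟶ X` with `p` in `P`: as `d z` is the identity, `g ≫ m` equals `g ≫ m ≫ d
    -- z`, and `hd` computes the latter as the leg of `Z` at `T (g ≫ m) ≫ z`.
    have huniq {X : C} (m : X ⟶ Z) : m = d (T.map m ≫ z) := by
      refine (hc X).hom_ext (fun k => ?_)
      refine Eq.trans ?_ (hd (T.map m ≫ z) k.left k.hom).symm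
      have e := hd z k.left (k.hom ≫ m)
      rw [hid] at e
      refine (Category.comp_id _).symm.trans (e.trans ?_)
      rw [T.map_comp, Category.assoc]
    refine IsTerminal.hasTerminal (X := CostructuredArrow.mk z) (IsTerminal.ofUniqueHom
      (fun W => CostructuredArrow.homMk (d W.hom) (hdz W.hom)) (fun W m => ?_))
    ext
    have h := huniq m.left
    rw [show T.map m.left ≫ z = W.hom from CostructuredArrow.w m] at h
    exact h
  exact isLeftAdjoint_of_costructuredArrowTerminals T

attribute [local instance] Cardinal.fact_isRegular_aleph0

/-- The finitely presentable objects form an essentially small dense subcategory of `C`. Nothing is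
required of the target category. -/
lemma isLeftAdjoint_of_isLocallyFinitelyPresentable [IsLocallyFinitelyPresentable.{v} C]
    (T : C ⥤ D) [PreservesColimitsOfSize.{v, v} T] : T.IsLeftAdjoint :=
  isLeftAdjoint_of_isDense (isCardinalPresentable.{v} C Cardinal.aleph0) T

/-- A cocontinuous functor which sends a strong generator of finitely presentable objects to
finitely presentable objects preserves finitely presentable objects. -/
lemma isFinitelyPresentable_map [HasColimitsOfSize.{v, v} C] {P : ObjectProperty C}
    [ObjectProperty.Small.{v} P] (hP : P.IsStrongGenerator)
    (hP' : P ≤ isCardinalPresentable.{v} C Cardinal.aleph0) (T : C ⥤ D)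
    [PreservesColimitsOfSize.{v, v} T]
    (hT : ∀ X, P X → IsFinitelyPresentable.{v} (T.obj X)) (X : C)
    (hX : IsFinitelyPresentable.{v} X) : IsFinitelyPresentable.{v} (T.obj X) := by
  -- The finitely presentable objects are the closure of `P` under finite colimits. Those with
  -- finitely presentable image under `T` contain `P` and are closed under finite colimits, since
  -- `T` preserves them.
  have h : P.colimitsCardinalClosure Cardinal.aleph0.{v} ≤
      (isCardinalPresentable.{v} D Cardinal.aleph0.{v}).inverseImage T := by
    refine P.colimitsCardinalClosure_le Cardinal.aleph0.{v} (fun J _ hJ => ?_) hT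
    have := isClosedUnderColimitsOfShape_isCardinalPresentable.{v} D hJ
    refine ⟨?_⟩
    rintro Y ⟨p⟩
    exact ObjectProperty.prop_of_isColimit (P := isCardinalPresentable.{v} D Cardinal.aleph0.{v})
      (isColimitOfPreserves T p.isColimit) (fun j => p.prop_diag_obj j)
  rw [← IsStrongGenerator.colimitsCardinalClosure_eq_isCardinalPresentable hP hP'] at h
  exact h X hX

end AdjointFunctor

/-! ### Monadicity of the forgetful functor and colimits of modules. -/

section ModColimits

variable {C : Type u} [Category.{v} C] [MonoidalCategory C] (A : C) [MonObj A]

instance : (Mod.forget (D := C) A).Faithful where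
  map_injective h := Mod.hom_ext _ _ h

instance : (Mod.forget (D := C) A).ReflectsIsomorphisms where
  reflects {M N} f hf := by
    have : IsIso f.hom := hf
    exact Iso.isIso_hom (mkIso (asIso f.hom) (act_hom f))

instance : (Monad.comparison (freeAdj A)).Full where
  map_surjective {_ _} f := ⟨mkHom f.f f.h.symm, rfl⟩

/-- An algebra for the monad `A ⊗ -` is a module: its two laws are those of an action, up to moving
the unitor and the associator to the other side. -/
instance : (Monad.comparison (freeAdj A)).EssSurj where
  mem_essImage X := by
    obtain ⟨a, ha⟩ : ∃ a : A ⊗ X.A ⟶ X.A, a = X.a := ⟨_, rfl⟩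
    have h₁ : ((λ_ X.A).inv ≫ MonObj.one (X := A) ▷ X.A) ≫ a = 𝟙 X.A := ha ▸ X.unit
    have h₂ : ((α_ A A X.A).inv ≫ MonObj.mul (X := A) ▷ X.A) ≫ a = A ◁ a ≫ a := ha ▸ X.assoc
    let M : Mod C A := mkMod X.A a
      (by rw [← cancel_epi (λ_ X.A).inv, ← Category.assoc, h₁, Iso.inv_hom_id])
      (by rw [← h₂]; simp)
    exact ⟨M, ⟨Monad.Algebra.isoMk (Iso.refl _)
      ((congrArg (· ≫ X.a) (MonoidalCategory.whiskerLeft_id A X.A)).trans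
        ((Category.id_comp _).trans (ha.symm.trans (Category.comp_id _).symm)))⟩⟩

/-- The category of modules is monadic. -/
instance : MonadicRightAdjoint (Mod.forget (D := C) A) where
  L := free A
  adj := freeAdj A
  eqv := { }

variable [(tensorLeft A).IsLeftAdjoint]

/-- Colimits of modules are computed in the underlying category. -/
instance {J : Type*} [Category* J] : CreatesColimitsOfShape J (Mod.forget (D := C) A) :=
  -- The monad is tensoring with `A`, a left adjoint; a monadic functor creates the colimits which
  -- its monad preserves.
  have : PreservesColimitsOfShape J (monadicLeftAdjoint (Mod.forget (D := C) A) ⋙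
      Mod.forget (D := C) A) :=
    inferInstanceAs (PreservesColimitsOfShape J (tensorLeft A))
  ⟨fun {K} =>
    have : PreservesColimit ((K ⋙ Mod.forget (D := C) A) ⋙
        (monadicLeftAdjoint (Mod.forget (D := C) A) ⋙ Mod.forget (D := C) A))
        (monadicLeftAdjoint (Mod.forget (D := C) A) ⋙ Mod.forget (D := C) A) := inferInstance
    monadicCreatesColimitOfPreservesColimit _ K⟩

instance [HasColimitsOfSize.{v', u'} C] : HasColimitsOfSize.{v', u'} (Mod C A) where
  has_colimits_of_shape _ _ := ⟨fun K => hasColimit_of_created K (Mod.forget (D := C) A)⟩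

instance preservesColimits_forget [HasColimitsOfSize.{v', u'} C] :
    PreservesColimitsOfSize.{v', u'} (Mod.forget (D := C) A) where
  preservesColimitsOfShape {_} _ :=
    preservesColimitOfShape_of_createsColimitsOfShape_and_hasColimitsOfShape _

instance {J : Type*} [Category* J] : ReflectsColimitsOfShape J (Mod.forget (D := C) A) :=
  reflectsColimitsOfShapeOfCreatesColimitsOfShape _

instance : ReflectsColimitsOfSize.{v', u'} (Mod.forget (D := C) A) where

end ModColimits

/-! ### Free modules as generators. -/

section Free

variable {C : Type u} [Category.{v} C] [MonoidalCategory C] (A : C) [MonObj A]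

/-- Free modules on a strong generator form a strong generator. -/
lemma isStrongGenerator_free {P : ObjectProperty C} (hP : P.IsStrongGenerator) :
    (ObjectProperty.ofObj (fun X : Subtype P => (free A).obj X.1)).IsStrongGenerator := by
  -- Morphisms from the free module on `X` to `N` are morphisms from `X` to `N.X`. As the forgetful
  -- functor is faithful, conservative and preserves monomorphisms, separation and detection of
  -- isomorphisms among monomorphisms both carry over from `P`.
  rw [ObjectProperty.isStrongGenerator_iff]
  refine ⟨fun M N f g h => Mod.hom_ext _ _ (hP.isSeparating _ _ (fun X hX k => ?_)),
    fun M N i _ h => ?_⟩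
  · have e := h _ (ObjectProperty.ofObj_apply _ ⟨X, hX⟩) (((freeAdj A).homEquiv X M).symm k)
    exact ((freeAdj A).homEquiv X N).symm.injective
      (((freeAdj A).homEquiv_naturality_right_symm k f).trans
        (e.trans ((freeAdj A).homEquiv_naturality_right_symm k g).symm))
  · have : (Mod.forget (D := C) A).IsRightAdjoint := (freeAdj A).isRightAdjoint
    have : Mono ((Mod.forget (D := C) A).map i) := inferInstance
    have : IsIso ((Mod.forget (D := C) A).map i) := hP.isIso_of_mono _ (fun X hX k => by
      obtain ⟨l, hl⟩ := h _ (ObjectProperty.ofObj_apply _ ⟨X, hX⟩) (((freeAdj A).homEquiv X N).symm k)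
      refine ⟨(freeAdj A).homEquiv X M l, ?_⟩
      change (freeAdj A).homEquiv X M l ≫ _ = k
      rw [← (freeAdj A).homEquiv_naturality_right]
      exact (Equiv.eq_symm_apply _).1 hl)
    exact isIso_of_reflects_iso i (Mod.forget (D := C) A)

end Free

attribute [local instance] Cardinal.fact_isRegular_aleph0

/-! ### Cocontinuity of the relative tensor product. -/

section TensorLeft

variable {C : Type u} [Category.{v} C] [MonoidalCategory C] [SymmetricCategory C]
  [HasCoequalizers C] [∀ X : C, PreservesColimitsOfShape WalkingParallelPair (tensorLeft X)]
  (A : C) [MonObj A] [IsCommMonObj A]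

set_option linter.unusedSectionVars false in
variable {A} in
-- Together with its analogue for `actR`, this allows `A`-bilinearity of a morphism out of `M ⊗
-- colim N` to be tested on the legs of the colimit.
lemma whiskerLeft_actL (M : Mod C A) {N N' : Mod C A} (g : N ⟶ N') {Z : C}
    (h : M.X ⊗ N'.X ⟶ Z) :
    A ◁ M.X ◁ g.hom ≫ actL M N' ≫ h = actL M N ≫ M.X ◁ g.hom ≫ h := by
  have := actL_map (𝟙 M) g
  rw [Mod.id_hom', id_tensorHom] at this
  rw [← reassoc_of% this]

set_option linter.unusedSectionVars false in
variable {A} in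
lemma whiskerLeft_actR (M : Mod C A) {N N' : Mod C A} (g : N ⟶ N') {Z : C}
    (h : M.X ⊗ N'.X ⟶ Z) :
    A ◁ M.X ◁ g.hom ≫ actR M N' ≫ h = actR M N ≫ M.X ◁ g.hom ≫ h := by
  have := actR_map (𝟙 M) g
  rw [Mod.id_hom', id_tensorHom] at this
  rw [← reassoc_of% this]

/-- The relative tensor product preserves colimits in the second variable. -/
lemma preservesColimitsOfShape_tensorLeft_mod {J : Type*} [Category* J]
    [hA : (tensorLeft A).IsLeftAdjoint]
    [HasColimitsOfShape J C] (M : Mod C A) [(tensorLeft M.X).IsLeftAdjoint] :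
    PreservesColimitsOfShape J (tensorLeft M) where
  preservesColimit {K} := ⟨fun {c} hc => by
    let ι (j : J) : K.obj j ⟶ c.pt := c.ι.app j
    -- The colimit stays a colimit in `C` after tensoring with `M.X`, and again after tensoring with
    -- `A`: the first is used to glue bilinear morphisms, the second to check that the result is
    -- bilinear.
    have h₁ := isColimitOfPreserves (tensorLeft M.X)
      (isColimitOfPreserves (Mod.forget (D := C) A) hc)
    have h₂ := isColimitOfPreserves (tensorLeft A) h₁
    have hext {Z : C} {f g : M.X ⊗ c.pt.X ⟶ Z}
        (h : ∀ j, M.X ◁ (ι j).hom ≫ f = M.X ◁ (ι j).hom ≫ g) : f = g := h₁.hom_ext h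
    have hext' {Z : C} {f g : A ⊗ (M.X ⊗ c.pt.X) ⟶ Z}
        (h : ∀ j, A ◁ M.X ◁ (ι j).hom ≫ f = A ◁ M.X ◁ (ι j).hom ≫ g) : f = g :=
      h₂.hom_ext h
    have desc (P : Mod C A) (k : ∀ j, M ⊗ K.obj j ⟶ P)
        (hk : ∀ ⦃i j : J⦄ (a : i ⟶ j), M ◁ K.map a ≫ k j = k i) :
        ∃ d : M ⊗ c.pt ⟶ P, ∀ j, M ◁ ι j ≫ d = k j := by
      have hs (i j : J) (a : i ⟶ j) :
          M.X ◁ (K.map a).hom ≫ π M (K.obj j) ≫ (k j).hom = π M (K.obj i) ≫ (k i).hom := by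
        rw [← hk a, Mod.comp_hom', π_whiskerLeft_assoc]
      -- A cocone on the relative tensor products is a compatible family of bilinear morphisms,
      -- glued here before passing to the quotient.
      obtain ⟨b, hb⟩ : ∃ b : M.X ⊗ c.pt.X ⟶ P.X,
          ∀ j, M.X ◁ (ι j).hom ≫ b = π M (K.obj j) ≫ (k j).hom :=
        ⟨h₁.desc
          { pt := P.X
            ι := { app := fun j => π M (K.obj j) ≫ (k j).hom
                   naturality := fun i j a => (hs i j a).trans (Category.comp_id _).symm } },
          fun j => h₁.fac _ j⟩
      refine ⟨relDesc b (hext' fun j => ?_) (hext' fun j => ?_), fun j => tensor_hom_ext ?_⟩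
      · rw [whiskerLeft_actL, hb, ← MonoidalCategory.whiskerLeft_comp_assoc, hb,
          MonoidalCategory.whiskerLeft_comp_assoc, ← act_hom, ← Category.assoc, ← Category.assoc]
        exact actL_q M (K.obj j) =≫ _
      · rw [whiskerLeft_actR, hb, ← MonoidalCategory.whiskerLeft_comp_assoc, hb,
          MonoidalCategory.whiskerLeft_comp_assoc, ← act_hom, ← Category.assoc, ← Category.assoc]
        exact actR_q M (K.obj j) =≫ _
      · rw [Mod.comp_hom', π_whiskerLeft_assoc, ← hb]
        exact _ ≫= q_relDesc _ _ _
    choose d hd using fun s : Cocone (K ⋙ tensorLeft M) => desc s.pt s.ι.app (fun _ _ a => s.w a)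
    exact ⟨{
      desc := d
      fac := hd
      uniq := fun s m hm => tensor_hom_ext (hext fun j => by
        have h : M ◁ ι j ≫ m = M ◁ ι j ≫ d s := (hm j).trans (hd s j).symm
        rw [← π_whiskerLeft_assoc, ← π_whiskerLeft_assoc, ← Mod.comp_hom', ← Mod.comp_hom', h]) }⟩⟩

end TensorLeft

/-! ### The tensor category of modules, and the right adjoint of the induced functor. -/

section TensorCategory

variable {C : Type (v + 1)} [Category.{v} C] [MonoidalCategory C] [SymmetricCategory C]
  [IsTensorCategory C] (A : C) [MonObj A] [IsCommMonObj A]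

instance (X : C) : (tensorLeft X).IsLeftAdjoint := IsTensorCategory.closed X

set_option linter.unusedSectionVars false in
-- The right adjoint of the free module functor preserves filtered colimits, so the free module
-- functor preserves finitely presentable objects.
lemma isFinitelyPresentable_free (X : C) (hX : IsFinitelyPresentable.{v} X) :
    IsFinitelyPresentable.{v} ((free A).obj X) := by
  have : (Mod.forget (D := C) A).IsCardinalAccessible Cardinal.aleph0.{v} := 
    ⟨fun J _ _ => inferInstance⟩
  exact (freeAdj A).isCardinalPresentable_leftAdjoint_obj _ X

/-- The modules of a commutative algebra in a tensor category form a tensor category. -/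
instance isTensorCategory_mod : IsTensorCategory (Mod C A) := by
  have := IsTensorCategory.locallyFinitelyPresentable (C := C)
  obtain ⟨P, _, hP⟩ := HasCardinalFilteredGenerator.exists_small_generator C Cardinal.aleph0.{v}
  have hG := isStrongGenerator_free A hP.isStrongGenerator
  have hfp : ObjectProperty.ofObj (fun X : Subtype P => (free A).obj X.1) ≤
      isCardinalPresentable.{v} (Mod C A) Cardinal.aleph0.{v} := by
    rintro _ ⟨X⟩
    exact isFinitelyPresentable_free A X.1 (hP.le_isCardinalPresentable _ X.2)
  have hlfp : IsLocallyFinitelyPresentable.{v} (Mod C A) :=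
    (IsCardinalLocallyPresentable.iff_exists_isStrongGenerator _ _).2 ⟨_, inferInstance, hG, hfp⟩
  have hpres (M : Mod C A) : PreservesColimitsOfSize.{v, v} (tensorLeft M) :=
    ⟨preservesColimitsOfShape_tensorLeft_mod A M⟩
  have iso_fp {M N : Mod C A} (e : M ≅ N) (h : IsFinitelyPresentable.{v} M) :
      IsFinitelyPresentable.{v} N := isCardinalPresentable_of_iso e _
  -- Closure under the tensor product is reduced to generators one variable at a time. For two free
  -- modules it holds because their tensor product over `A` is the free module on the tensor product
  -- of the generators.
  have h₁ (X : C) (hX : P X) (N : Mod C A) (hN : IsFinitelyPresentable.{v} N) :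
      IsFinitelyPresentable.{v} ((free A).obj X ⊗ N) := by
    refine isFinitelyPresentable_map hG hfp (tensorLeft ((free A).obj X)) ?_ N hN
    rintro _ ⟨Y⟩
    exact iso_fp (Functor.Monoidal.μIso (free A) X Y.1).symm
      (isFinitelyPresentable_free A _ (IsTensorCategory.tensor X Y.1
        (hP.le_isCardinalPresentable _ hX) (hP.le_isCardinalPresentable _ Y.2)))
  exact
    { locallyFinitelyPresentable := hlfp
      unit := iso_fp (Functor.Monoidal.εIso (free A)).symm
        (isFinitelyPresentable_free A _ IsTensorCategory.unit)
      tensor := fun M N hM hN => by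
        refine isFinitelyPresentable_map hG hfp (tensorLeft M) ?_ N hN
        rintro _ ⟨Y⟩
        -- The symmetry exchanges the variables, so `h₁` applies with the arbitrary module `M` in
        -- the second place.
        exact iso_fp (β_ _ _) (h₁ Y.1 Y.2 M hM)
      closed := fun M => isLeftAdjoint_of_isLocallyFinitelyPresentable _ }

variable {D : Type (v + 1)} [Category.{v} D] [MonoidalCategory D] [SymmetricCategory D]
  [IsTensorCategory D]

set_option linter.unusedSectionVars false in
/-- The functor induced on modules by a cocontinuous monoidal functor has a right adjoint. -/
lemma isLeftAdjoint_induced (F : C ⥤ D) [F.Monoidal] [F.IsLeftAdjoint] :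
    (induced F A).IsLeftAdjoint := by
  have := IsTensorCategory.locallyFinitelyPresentable (C := Mod C A)
  -- On underlying objects the induced functor is `F`, and colimits of modules are preserved and
  -- reflected by the forgetful functors.
  have : PreservesColimitsOfSize.{v, v} (induced F A ⋙ Mod.forget (D := D) (F.obj A)) :=
    inferInstanceAs (PreservesColimitsOfSize.{v, v} (Mod.forget (D := C) A ⋙ F))
  have : PreservesColimitsOfSize.{v, v} (induced F A) :=
    preservesColimits_of_reflects_of_preserves _ (Mod.forget (D := D) (F.obj A))
  exact isLeftAdjoint_of_isLocallyFinitelyPresentable _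

end TensorCategory

/-! ### Extension of monoidal transformations from free modules to all modules. -/

section Extension

open Functor.LaxMonoidal Functor.OplaxMonoidal

variable {D : Type u} [Category.{v} D] [MonoidalCategory D]

section

variable {B : D} [MonObj B]

/-- The action `B ⊗ M ⟶ M` as a morphism of modules. -/
def freeCounit (M : Mod D B) : (free B).obj M.X ⟶ M := (freeAdj B).counit.app M

/-- The counit of the free module adjunction on a free module. -/
def freeMul (X : D) : (free B).obj (B ⊗ X) ⟶ (free B).obj X := freeCounit ((free B).obj X)

lemma free_map_act_comp_freeCounit (M : Mod D B) :
    (free B).map (act M) ≫ freeCounit M = freeMul M.X ≫ freeCounit M :=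
  (freeAdj B).counit.naturality (freeCounit M)

lemma free_map_freeCounit {M N : Mod D B} (f : M ⟶ N) :
    (free B).map f.hom ≫ freeCounit N = freeCounit M ≫ f :=
  (freeAdj B).counit.naturality f

/-- Every module is a coequalizer of free modules. -/
def isColimitFreeCounit (M : Mod D B) :
    IsColimit (Cofork.ofπ (freeCounit M) (free_map_act_comp_freeCounit M)) :=
  Cofork.IsColimit.mk' _ (fun s => by
    -- In elements, the factorization of `s` sends `m` to `s (1 ⊗ m)`. The fork relation identifies
    -- `s (1 ⊗ b m)` with `s (b ⊗ m)`.
    have h₀ : act M ≫ (λ_ M.X).inv ≫ MonObj.one (X := B) ▷ M.X ≫ (Cofork.π s).hom =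
        (Cofork.π s).hom := by
      have h : (free B).map (act M) ≫ Cofork.π s =
        freeMul M.X ≫ Cofork.π s := s.condition
      have h' : B ◁ act M ≫ (Cofork.π s).hom =
        ((α_ B B M.X).inv ≫ MonObj.mul (X := B) ▷ M.X) ≫ (Cofork.π s).hom := congrArg Mod.Hom.hom h
      obtain ⟨k, hk⟩ : ∃ k : B ⊗ M.X ⟶ s.pt.X, k = (Cofork.π s).hom := ⟨_, rfl⟩
      rw [← hk] at h' ⊢
      have h₁ : MonObj.one (X := B) ▷ B ▷ M.X ≫ MonObj.mul (X := B) ▷ M.X = (λ_ B).hom ▷ M.X := by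
        rw [← comp_whiskerRight, MonObj.one_mul]
      rw [leftUnitor_inv_naturality_assoc, whisker_exchange_assoc, h', whiskerRight_tensor]
      simp [reassoc_of% h₁]
    have h₁ : act ((free B).obj M.X) ≫ (Cofork.π s).hom = B ◁ (Cofork.π s).hom ≫ act s.pt :=
      act_hom _
    have h₂ : B ◁ ((λ_ M.X).inv ≫ MonObj.one (X := B) ▷ M.X) ≫ act ((free B).obj M.X) =
      𝟙 (B ⊗ M.X) := congrArg Mod.Hom.hom ((freeAdj B).left_triangle_components M.X)
    refine ⟨mkHom ((λ_ M.X).inv ≫ MonObj.one (X := B) ▷ M.X ≫ (Cofork.π s).hom) ?_,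
      Mod.hom_ext _ _ h₀, fun {m} hm => Mod.hom_ext _ _ ?_⟩
    -- Linearity of the factorization: by `h₂`, `b ⊗ m` is `b` acting on `1 ⊗ m`, and `s` is linear.
    · refine h₀.trans ?_
      refine (Category.id_comp _).symm.trans ((h₂ =≫ (Cofork.π s).hom).symm.trans ?_)
      refine (Category.assoc _ _ _).trans ((_ ≫= h₁).trans ?_)
      exact (MonoidalCategory.whiskerLeft_comp_assoc _ _ _ _).symm.trans
        (congrArg (fun k => B ◁ k ≫ act s.pt) (Category.assoc _ _ _))
    · have hm' : act M ≫ m.hom = (Cofork.π s).hom := congrArg Mod.Hom.hom hm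
      refine Eq.trans ?_ (congrArg (fun k => (λ_ M.X).inv ≫ MonObj.one (X := B) ▷ M.X ≫ k) hm')
      rw [← Category.assoc (_ ▷ _), one_act]
      simp)

variable {E : Type u'} [Category.{v'} E] (H : Mod D B ⥤ E)
  [PreservesColimitsOfShape WalkingParallelPair H]

lemma exists_desc_map_freeCounit {M : Mod D B} {Z : E} (k : H.obj ((free B).obj M.X) ⟶ Z)
    (hk : H.map ((free B).map (act M)) ≫ k = H.map (freeMul M.X) ≫ k) :
    ∃ t : H.obj M ⟶ Z, H.map (freeCounit M) ≫ t = k :=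
  ⟨_, (Cofork.IsColimit.desc' (isColimitCoforkMapOfIsColimit H _ (isColimitFreeCounit M)) k hk).2⟩

instance (M : Mod D B) : Epi (H.map (freeCounit M)) :=
  epi_of_isColimit_cofork (isColimitCoforkMapOfIsColimit H _ (isColimitFreeCounit M))

variable {H} in
/-- Transformations between functors on modules are determined by their restrictions to free
modules. -/
lemma natTrans_ext_of_free {H' : Mod D B ⥤ E} {s t : H ⟶ H'}
    (h : ∀ X, s.app ((free B).obj X) = t.app ((free B).obj X)) : s = t := by
  ext M
  rw [← cancel_epi (H.map (freeCounit M)), s.naturality, t.naturality, h]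

end

variable [SymmetricCategory D] [HasCoequalizers D]
  [∀ X : D, PreservesColimitsOfShape WalkingParallelPair (tensorLeft X)]
  (B : D) [MonObj B] [IsCommMonObj B]

/-- The multiplication of `B` as a morphism of modules to the unit object. -/
def freeCounitUnit : (free B).obj B ⟶ 𝟙_ (Mod D B) := freeCounit (Mod.regular B)

lemma unitFree_freeCounitUnit : unitFree B B ≫ (freeCounitUnit B).hom = 𝟙 B :=
  (freeAdj B).right_triangle_components (Mod.regular B)

set_option linter.unusedSectionVars false in
lemma unitFree_freeCounit (M : Mod D B) : unitFree B M.X ≫ (freeCounit M).hom = 𝟙 M.X :=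
  (freeAdj B).right_triangle_components M

set_option linter.unusedSectionVars false in
lemma unitFree_freeMul (X : D) :
    unitFree B (B ⊗ X) ≫ (freeMul X).hom = 𝟙 ((free B).obj X).X :=
  (freeAdj B).right_triangle_components ((free B).obj X)

/-- The counit on a free module is induced by the multiplication of `B`. -/
lemma freeMul_eq (X : D) : freeMul X =
    δ (free B) B X ≫ freeCounitUnit B ▷ (free B).obj X ≫ (λ_ ((free B).obj X)).hom := by
  -- Transposed along the adjunction, both sides become the identity of `B ⊗ X`.
  apply free_hom_ext
  refine (unitFree_freeMul B X).trans ?_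
  have h := unitFree_δ B B X =≫
    ((freeCounitUnit B ▷ (free B).obj X).hom ≫ (λ_ ((free B).obj X)).hom.hom)
  rw [Category.assoc, Category.assoc, π_whiskerRight_assoc] at h
  refine Eq.trans ?_ h.symm
  have h₂ (c : ((free B).obj B).X ⟶ B) (hc : unitFree B B ≫ c = 𝟙 B) :
      (unitFree B B ⊗ₘ unitFree B X) ≫ c ▷ ((free B).obj X).X = B ◁ unitFree B X := by
    rw [MonoidalCategory.tensorHom_def', Category.assoc, ← comp_whiskerRight, hc, id_whiskerRight,
      Category.comp_id]
  refine Eq.trans ?_ (Category.assoc _ _ _)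
  refine Eq.trans ?_ (h₂ _ (unitFree_freeCounitUnit B) =≫ (π (𝟙_ (Mod D B)) ((free B).obj X) ≫
    (λ_ ((free B).obj X)).hom.hom)).symm
  refine Eq.trans ?_ (_ ≫= π_leftUnitor ((free B).obj X)).symm
  exact (map_unitFree_act B X).symm

/-- Once `μ` is moved across as `δ`, both sides are morphisms out of the free module on `M.X ⊗ N.X`,
and both have transpose `π M N`. This is what makes an extension from free modules monoidal. -/
lemma freeCounit_tensor (M N : Mod D B) :
    μ (free B) M.X N.X ≫ (free B).map (π M N) ≫ freeCounit (M ⊗ N) =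
      (freeCounit M ⊗ₘ freeCounit N) := by
  have h : (free B).map (π M N) ≫ freeCounit (M ⊗ N) =
      δ (free B) M.X N.X ≫ (freeCounit M ⊗ₘ freeCounit N) := by
    apply free_hom_ext
    rw [Mod.comp_hom', Mod.comp_hom', reassoc_of% unitFree_map B (π M N)]
    refine (_ ≫= unitFree_freeCounit B (M ⊗ N)).trans ?_
    refine Eq.trans ?_ ((Category.assoc _ _ _).symm.trans (unitFree_δ B M.X N.X =≫ _)).symm
    rw [Category.assoc, π_tensorHom, tensorHom_comp_tensorHom_assoc]
    have h₁ := unitFree_freeCounit B M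
    have h₂ := unitFree_freeCounit B N
    refine Eq.trans ?_ (congrArg₂ (fun f g => (f ⊗ₘ g) ≫ π M N) h₁ h₂).symm
    simp
  rw [h, Functor.Monoidal.μ_δ_assoc]

/-- The unit of `B` is a section of its multiplication. Thus the unit object of the modules is a
retract of the free module on `B`, through the free module on the unit. -/
lemma ε_free_map_one :
    ε (free B) ≫ (free B).map (MonObj.one (X := B)) ≫ freeCounitUnit B = 𝟙 (𝟙_ (Mod D B)) := by
  have h : (free B).map (MonObj.one (X := B)) ≫ freeCounitUnit B = η (free B) := by
    apply free_hom_ext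
    refine Eq.trans ?_ (unitFree_η B).symm
    rw [Mod.comp_hom', reassoc_of% unitFree_map B (MonObj.one (X := B)), unitFree_freeCounitUnit]
    exact Category.comp_id _
  rw [h, Functor.Monoidal.ε_η]

variable {B} {E : Type u'} [Category.{v'} E] [MonoidalCategory E] {H H' : Mod D B ⥤ E}
  [H.Monoidal] [H'.Monoidal]

/-- A monoidal transformation between the restrictions of two functors to free modules. -/
structure IsMonoidalOnFree (l : ∀ X, H.obj ((free B).obj X) ⟶ H'.obj ((free B).obj X)) : Prop where
  naturality {X Y : D} (f : X ⟶ Y) :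
    H.map ((free B).map f) ≫ l Y = l X ≫ H'.map ((free B).map f)
  unit : ε H ≫ H.map (ε (free B)) ≫ l (𝟙_ D) = ε H' ≫ H'.map (ε (free B))
  tensor (X Y : D) : μ H ((free B).obj X) ((free B).obj Y) ≫ H.map (μ (free B) X Y) ≫ l (X ⊗ Y) =
    (l X ⊗ₘ l Y) ≫ μ H' ((free B).obj X) ((free B).obj Y) ≫ H'.map (μ (free B) X Y)
  -- This condition goes beyond naturality in `D`: the multiplication of `B` is a morphism of
  -- modules which is not given as the free module functor applied to a morphism of `D`. It says
  -- that `l` respects the augmentations defined by `H` and `H'`.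
  mul : l B ≫ H'.map (freeCounitUnit B) ≫ η H' = H.map (freeCounitUnit B) ≫ η H

namespace IsMonoidalOnFree

variable {l : ∀ X, H.obj ((free B).obj X) ⟶ H'.obj ((free B).obj X)}

/-- By `freeMul_eq`, the counit on a free module is `freeCounitUnit B` tensored with that module.
Compatibility at every `X` therefore follows from the single condition `mul` and the compatibility
of `l` with tensor products. -/
lemma map_freeMul (hl : IsMonoidalOnFree l) (X : D) :
    l (B ⊗ X) ≫ H'.map (freeMul X) = H.map (freeMul X) ≫ l X := by
  have e (H : Mod D B ⥤ E) [H.Monoidal] : μ H ((free B).obj B) ((free B).obj X) ≫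
      H.map (μ (free B) B X) ≫ H.map (freeMul X) =
        (H.map (freeCounitUnit B) ≫ η H) ▷ H.obj ((free B).obj X) ≫
          (λ_ (H.obj ((free B).obj X))).hom := by
    rw [freeMul_eq, ← H.map_comp, Functor.Monoidal.μ_δ_assoc, H.map_comp,
      ← μ_natural_left_assoc, Functor.Monoidal.map_leftUnitor, Functor.Monoidal.μ_δ_assoc,
      comp_whiskerRight_assoc]
  rw [← cancel_epi (H.map (μ (free B) B X)),
    ← cancel_epi (μ H ((free B).obj B) ((free B).obj X)), reassoc_of% hl.tensor, e H',
    reassoc_of% e H, ← hl.mul, ← leftUnitor_naturality, MonoidalCategory.tensorHom_def']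
  simp only [comp_whiskerRight, Category.assoc, ← whisker_exchange_assoc]

variable [PreservesColimitsOfShape WalkingParallelPair H]

/-- A monoidal transformation on free modules which is compatible with the multiplication of `B`
extends to all modules. -/
lemma exists_extension [∀ X : E, (tensorLeft X).PreservesEpimorphisms]
    [∀ X : E, (tensorRight X).PreservesEpimorphisms] (hl : IsMonoidalOnFree l) :
    ∃ t : H ⟶ H', t.IsMonoidal ∧ ∀ X, t.app ((free B).obj X) = l X := by
  -- `H` preserves the presentation of `M` by free modules. The two parallel arrows are equalized
  -- because `l` is natural at the action of `M` and compatible with `freeMul`.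
  have h (M : Mod D B) : ∃ t : H.obj M ⟶ H'.obj M,
      H.map (freeCounit M) ≫ t = l M.X ≫ H'.map (freeCounit M) :=
    exists_desc_map_freeCounit H _ (by
      rw [reassoc_of% hl.naturality (act M), ← reassoc_of% hl.map_freeMul M.X, ← H'.map_comp,
        ← H'.map_comp, free_map_act_comp_freeCounit])
  choose t ht using h
  have hnat {M N : Mod D B} (f : M ⟶ N) : H.map f ≫ t N = t M ≫ H'.map f := by
    rw [← cancel_epi (H.map (freeCounit M)), ← H.map_comp_assoc, ← free_map_freeCounit,
      H.map_comp, Category.assoc, ht, reassoc_of% hl.naturality f.hom, reassoc_of% ht M,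
      ← H'.map_comp, ← H'.map_comp, free_map_freeCounit]
  refine ⟨{ app := t, naturality := fun _ _ f => hnat f }, ⟨?_, fun M N => ?_⟩, fun X => ?_⟩
  · have h₁ := hl.naturality (MonObj.one (X := B))
    have h₂ : H.map (freeCounitUnit B) ≫ t (𝟙_ _) = l B ≫ H'.map (freeCounitUnit B) :=
      ht (Mod.regular B)
    -- Through this retraction the value of `t` at the unit object is computed from `l B`, and by
    -- naturality from `l` at the unit of `D`.
    have e (H : Mod D B ⥤ E) : H.map (ε (free B)) ≫
        H.map ((free B).map (MonObj.one (X := B))) ≫ H.map (freeCounitUnit B) = 𝟙 _ := by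
      rw [← H.map_comp, ← H.map_comp, ε_free_map_one, H.map_id]
    have h₃ := ε H ≫= e H =≫ t (𝟙_ _)
    simp only [Category.assoc, Category.id_comp] at h₃
    dsimp
    rw [← h₃, h₂, reassoc_of% h₁, reassoc_of% hl.unit, e H', Category.comp_id]
  -- The tensor product of the two presentations is still an epimorphism after applying `H`.
  -- Precomposing with it turns the tensor condition for `t` into the one for `l`.
  · have e (H : Mod D B ⥤ E) [H.Monoidal] :
        (H.map (freeCounit M) ⊗ₘ H.map (freeCounit N)) ≫ μ H M N =
        μ H ((free B).obj M.X) ((free B).obj N.X) ≫ H.map (μ (free B) M.X N.X) ≫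
          H.map ((free B).map (π M N)) ≫ H.map (freeCounit (M ⊗ N)) := by
      rw [← H.map_comp, ← H.map_comp, freeCounit_tensor, μ_natural]
    have : Epi (H.map (freeCounit M) ▷ H.obj ((free B).obj N.X)) :=
      inferInstanceAs (Epi ((tensorRight _).map (H.map (freeCounit M))))
    have : Epi (H.obj M ◁ H.map (freeCounit N)) :=
      inferInstanceAs (Epi ((tensorLeft _).map (H.map (freeCounit N))))
    have : Epi (H.map (freeCounit M) ⊗ₘ H.map (freeCounit N)) := by
      rw [MonoidalCategory.tensorHom_def]
      infer_instance
    dsimp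
    rw [← cancel_epi (H.map (freeCounit M) ⊗ₘ H.map (freeCounit N)), reassoc_of% e H, ht (M ⊗ N),
      reassoc_of% hl.naturality (π M N), reassoc_of% hl.tensor, tensorHom_comp_tensorHom_assoc,
      ht, ht, ← tensorHom_comp_tensorHom_assoc, e H']
  · dsimp
    -- On a free module `t` is defined through the presentation of its underlying object, not as `l
    -- X`; the two agree by `map_freeMul` because `freeMul` becomes an epimorphism.
    have h₁ : H.map (freeMul X) ≫ t ((free B).obj X) =
      l (B ⊗ X) ≫ H'.map (freeMul X) := ht ((free B).obj X)
    have : Epi (H.map (freeMul (B := B) X)) :=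
      inferInstanceAs (Epi (H.map (freeCounit ((free B).obj X))))
    rw [← cancel_epi (H.map (freeMul X)), h₁, hl.map_freeMul]

omit [PreservesColimitsOfShape WalkingParallelPair H] in
lemma inv {l : ∀ X, H.obj ((free B).obj X) ≅ H'.obj ((free B).obj X)}
    (hl : IsMonoidalOnFree (fun X => (l X).hom)) : IsMonoidalOnFree (fun X => (l X).inv) where
  naturality {X Y} f := by
    rw [← cancel_epi (l X).hom, ← reassoc_of% hl.naturality f]
    simp
  unit := by
    rw [← reassoc_of% hl.unit]
    simp
  tensor X Y := by
    rw [← cancel_epi ((l X).hom ⊗ₘ (l Y).hom), ← reassoc_of% hl.tensor X Y]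
    simp
  mul := by
    rw [← hl.mul]
    simp

/-- The inverses satisfy the same conditions and extend as well. The two extensions are mutually
inverse since this can be tested on free modules, which needs both `H` and `H'` to preserve
coequalizers. -/
lemma exists_iso_extension [∀ X : E, (tensorLeft X).PreservesEpimorphisms]
    [∀ X : E, (tensorRight X).PreservesEpimorphisms]
    [PreservesColimitsOfShape WalkingParallelPair H']
    {l : ∀ X, H.obj ((free B).obj X) ≅ H'.obj ((free B).obj X)}
    (hl : IsMonoidalOnFree (fun X => (l X).hom)) :
    ∃ t : H ≅ H', t.hom.IsMonoidal ∧ ∀ X, t.hom.app ((free B).obj X) = (l X).hom := by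
  obtain ⟨s, hs, hs'⟩ := hl.exists_extension
  obtain ⟨t, _, ht'⟩ := hl.inv.exists_extension
  exact ⟨⟨s, t, natTrans_ext_of_free (fun X => by simp [hs', ht']),
    natTrans_ext_of_free (fun X => by simp [hs', ht'])⟩, hs, hs'⟩

end IsMonoidalOnFree

lemma isMonoidalOnFree_of_natTrans (l : free B ⋙ H ⟶ free B ⋙ H') [l.IsMonoidal]
    (hl : l.app B ≫ H'.map (freeCounitUnit B) ≫ η H' = H.map (freeCounitUnit B) ≫ η H) :
    IsMonoidalOnFree (H := H) (H' := H') (fun X => l.app X) where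
  naturality f := l.naturality f
  unit := by
    have := NatTrans.IsMonoidal.unit (τ := l)
    rw [Functor.LaxMonoidal.comp_ε, Functor.LaxMonoidal.comp_ε, Category.assoc] at this
    exact this
  tensor X Y := by
    have := NatTrans.IsMonoidal.tensor (τ := l) X Y
    rw [Functor.LaxMonoidal.comp_μ, Functor.LaxMonoidal.comp_μ, Category.assoc] at this
    exact this
  mul := hl

end Extension

/-! ### Base change along an augmentation as a symmetric monoidal functor. -/

section BaseChange

open Functor.LaxMonoidal Functor.OplaxMonoidal

variable {E : Type u} [Category.{v} E] [MonoidalCategory E]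

/-- A morphism of algebras from `B` to the unit object. -/
structure Augmentation (B : E) [MonObj B] where
  /-- The underlying morphism. -/
  hom : B ⟶ 𝟙_ E
  one : MonObj.one (X := B) ≫ hom = 𝟙 _
  mul : MonObj.mul (X := B) ≫ hom = (hom ⊗ₘ hom) ≫ (λ_ (𝟙_ E)).hom

namespace Augmentation

variable {B : E} [MonObj B] (a : Augmentation B)

/-- The action of `B` on `X` through the augmentation. -/
def act (X : E) : B ⊗ X ⟶ X := a.hom ▷ X ≫ (λ_ X).hom

lemma act_naturality {X Y : E} (f : X ⟶ Y) : a.act X ≫ f = B ◁ f ≫ a.act Y := by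
  rw [act, act, Category.assoc, ← leftUnitor_naturality, whisker_exchange_assoc]

lemma act_naturality_assoc {X Y Z : E} (f : X ⟶ Y) (g : Y ⟶ Z) :
    a.act X ≫ f ≫ g = B ◁ f ≫ a.act Y ≫ g := by
  rw [← Category.assoc, act_naturality, Category.assoc]

lemma one_act (X : E) : MonObj.one (X := B) ▷ X ≫ a.act X = (λ_ X).hom := by
  rw [act, ← comp_whiskerRight_assoc, a.one, id_whiskerRight, Category.id_comp]

lemma mul_act (X : E) :
    MonObj.mul (X := B) ▷ X ≫ a.act X = (α_ B B X).hom ≫ B ◁ a.act X ≫ a.act X := by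
  rw [← act_naturality, act, ← comp_whiskerRight_assoc, a.mul, act,
    MonoidalCategory.tensorHom_def]
  simp

lemma act_tensor (X Y : E) : a.act (X ⊗ Y) = (α_ B X Y).inv ≫ a.act X ▷ Y := by
  simp [act]

/-- The functor which sends `X` to `X` with the action of `B` through the augmentation. -/
def trivial : E ⥤ Mod E B where
  obj X := mkMod X (a.act X) (a.one_act X) (a.mul_act X)
  map f := mkHom f (a.act_naturality f)
  map_id _ := rfl
  map_comp _ _ := rfl

variable [HasCoequalizers E]

/-- The base change of a module along the augmentation. -/
def baseChangeObj (M : Mod E B) : E := coequalizer (TensorCategories.act M) (a.act M.X)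

/-- The projection of a module to its base change. -/
def proj (M : Mod E B) : M.X ⟶ a.baseChangeObj M := coequalizer.π _ _

instance (M : Mod E B) : Epi (a.proj M) := inferInstanceAs (Epi (coequalizer.π _ _))

lemma act_proj (M : Mod E B) : TensorCategories.act M ≫ a.proj M = a.act M.X ≫ a.proj M :=
  coequalizer.condition _ _

/-- Descent of morphisms to the base change. -/
def desc {M : Mod E B} {Z : E} (f : M.X ⟶ Z) (hf : TensorCategories.act M ≫ f = a.act M.X ≫ f) :
    a.baseChangeObj M ⟶ Z := coequalizer.desc f hf

@[simp] lemma proj_desc {M : Mod E B} {Z : E} (f : M.X ⟶ Z)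
    (hf : TensorCategories.act M ≫ f = a.act M.X ≫ f) : a.proj M ≫ a.desc f hf = f :=
  coequalizer.π_desc _ _

/-- The base change functor along an augmentation. -/
def baseChange : Mod E B ⥤ E where
  obj M := a.baseChangeObj M
  map {M N} f := a.desc (f.hom ≫ a.proj N) (by
    rw [act_hom_assoc, act_proj, ← Category.assoc, ← Category.assoc, act_naturality])
  map_id M := by
    rw [← cancel_epi (a.proj M)]
    simp
  map_comp {M N P} f g := by
    have h {M N : Mod E B} (f : M ⟶ N) (hf) {Z : E} (k : a.baseChangeObj N ⟶ Z) :
        a.proj M ≫ a.desc (f.hom ≫ a.proj N) hf ≫ k = f.hom ≫ a.proj N ≫ k := by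
      rw [← Category.assoc, proj_desc, Category.assoc]
    rw [← cancel_epi (a.proj M), proj_desc, h, proj_desc, Mod.comp_hom', Category.assoc]

/-- The projection of a module to its base change. -/
def p (M : Mod E B) : M.X ⟶ a.baseChange.obj M := a.proj M

instance (M : Mod E B) : Epi (a.p M) := inferInstanceAs (Epi (a.proj M))

lemma act_p (M : Mod E B) : TensorCategories.act M ≫ a.p M = a.act M.X ≫ a.p M := a.act_proj M

lemma exists_desc {M : Mod E B} {Z : E} (f : M.X ⟶ Z)
    (hf : TensorCategories.act M ≫ f = a.act M.X ≫ f) :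
    ∃ g : a.baseChange.obj M ⟶ Z, a.p M ≫ g = f := ⟨a.desc f hf, a.proj_desc f hf⟩

lemma p_map {M N : Mod E B} (f : M ⟶ N) : a.p M ≫ a.baseChange.map f = f.hom ≫ a.p N :=
  a.proj_desc _ _

lemma p_map_assoc {M N : Mod E B} (f : M ⟶ N) {Z : E} (k : a.baseChange.obj N ⟶ Z) :
    a.p M ≫ a.baseChange.map f ≫ k = f.hom ≫ a.p N ≫ k := by
  rw [← Category.assoc, p_map, Category.assoc]

/-- Base change is left adjoint to the restriction along the augmentation. -/
def baseChangeAdj : a.baseChange ⊣ a.trivial where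
  unit :=
    { app := fun M => mkHom (a.p M) ((a.act_p M).trans (a.act_naturality (a.p M)))
      naturality := fun M N f => Mod.hom_ext _ _ (a.p_map f).symm }
  counit :=
    { app := fun X => a.desc (M := a.trivial.obj X) (𝟙 X) rfl
      naturality := fun X Y f => by
        rw [← cancel_epi (a.p (a.trivial.obj X))]
        have h (X : E) : a.p (a.trivial.obj X) ≫ a.desc (M := a.trivial.obj X) (𝟙 X) rfl = 𝟙 X :=
          a.proj_desc _ _
        refine (a.p_map_assoc _ _).trans ((f ≫= h Y).trans ((Category.comp_id f).trans ?_))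
        exact ((Category.assoc _ _ _).symm.trans ((h X =≫ f).trans (Category.id_comp f))).symm }
  left_triangle_components M := by
    rw [← cancel_epi (a.p M), p_map_assoc]
    refine (_ ≫= a.proj_desc (M := a.trivial.obj (a.baseChange.obj M)) (𝟙 _) rfl).trans ?_
    rfl
  right_triangle_components X := Mod.hom_ext _ _ (a.proj_desc (M := a.trivial.obj X) (𝟙 X) rfl)

instance : a.baseChange.IsLeftAdjoint := a.baseChangeAdj.isLeftAdjoint

section Linear

variable [Preadditive E] [MonoidalPreadditive E]

instance : a.baseChange.Additive where
  map_add {M N f g} := by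
    rw [← cancel_epi (a.p M), Preadditive.comp_add, p_map, p_map, p_map]
    simp

instance {R : Type*} [CommRing R] [CategoryTheory.Linear R E] [MonoidalLinear R E] :
    a.baseChange.Linear R where
  map_smul {M N} f r := by
    rw [← cancel_epi (a.p M), CategoryTheory.Linear.comp_smul, p_map, p_map]
    simp

end Linear

variable [SymmetricCategory E]
  [∀ X : E, PreservesColimitsOfShape WalkingParallelPair (tensorLeft X)] [IsCommMonObj B]

set_option linter.unusedSectionVars false in
-- With `actR_trivial`: the two actions on the tensor product of trivial modules coincide, so there
-- is nothing to divide out and the identity of `X ⊗ Y` is bilinear.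
lemma actL_trivial (X Y : E) : actL (a.trivial.obj X) (a.trivial.obj Y) = a.act (X ⊗ Y) :=
  (a.act_tensor X Y).symm

set_option linter.unusedSectionVars false in
lemma actR_trivial (X Y : E) : actR (a.trivial.obj X) (a.trivial.obj Y) = a.act (X ⊗ Y) := by
  change swp B X Y ≫ X ◁ a.act Y = a.act (X ⊗ Y)
  simp only [act, swp, MonoidalCategory.whiskerLeft_comp, Category.assoc]
  rw [← associator_naturality_middle_assoc, ← comp_whiskerRight_assoc,
    ← BraidedCategory.braiding_naturality_left]
  simp [braiding_tensorUnit_left]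

/-- The comparison morphism of the lax monoidal structure on the restriction along the
augmentation. -/
def trivialμ (X Y : E) : a.trivial.obj X ⊗ a.trivial.obj Y ⟶ a.trivial.obj (X ⊗ Y) :=
  relDesc (𝟙 (X ⊗ Y))
    (by
      refine (Category.comp_id _).trans ((a.actL_trivial X Y).trans ?_)
      exact ((congrArg (· ≫ a.act (X ⊗ Y)) (MonoidalCategory.whiskerLeft_id B (X ⊗ Y))).trans
        (Category.id_comp _)).symm)
    (by
      refine (Category.comp_id _).trans ((a.actR_trivial X Y).trans ?_)
      exact ((congrArg (· ≫ a.act (X ⊗ Y)) (MonoidalCategory.whiskerLeft_id B (X ⊗ Y))).trans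
        (Category.id_comp _)).symm)

/-- The canonical morphism from the tensor product to the relative tensor product. -/
def πT (X Y : E) : X ⊗ Y ⟶ (a.trivial.obj X ⊗ a.trivial.obj Y : Mod E B).X :=
  π (a.trivial.obj X) (a.trivial.obj Y)

/-- The underlying morphism of `trivialμ`. -/
def trivialμX (X Y : E) : (a.trivial.obj X ⊗ a.trivial.obj Y : Mod E B).X ⟶ X ⊗ Y :=
  (a.trivialμ X Y).hom

lemma πT_trivialμX (X Y : E) : a.πT X Y ≫ a.trivialμX X Y = 𝟙 (X ⊗ Y) :=
  q_relDesc (M := a.trivial.obj X) (N := a.trivial.obj Y) (P := a.trivial.obj (X ⊗ Y)) _ _ _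

lemma πT_trivialμX_assoc (X Y : E) {Z : E} (k : X ⊗ Y ⟶ Z) :
    a.πT X Y ≫ a.trivialμX X Y ≫ k = k := by
  rw [← Category.assoc, πT_trivialμX, Category.id_comp]

instance (X Y : E) : Epi (a.πT X Y) :=
  inferInstanceAs (Epi (π (a.trivial.obj X) (a.trivial.obj Y)))

instance (X Y Z : E) : Epi (a.πT X Y ▷ Z) :=
  inferInstanceAs (Epi (π (a.trivial.obj X) (a.trivial.obj Y) ▷ Z))

lemma trivialμ_natural_left {X X' : E} (f : X ⟶ X') (Y : E) :
    a.trivial.map f ▷ a.trivial.obj Y ≫ a.trivialμ X' Y =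
      a.trivialμ X Y ≫ a.trivial.map (f ▷ Y) := by
  have h : a.πT X Y ≫ (a.trivial.map f ▷ a.trivial.obj Y).hom = f ▷ Y ≫ a.πT X' Y :=
    π_whiskerRight _ _
  have h' : (a.trivial.map f ▷ a.trivial.obj Y).hom ≫ a.trivialμX X' Y =
      a.trivialμX X Y ≫ f ▷ Y := by
    rw [← cancel_epi (a.πT X Y), reassoc_of% h, πT_trivialμX, πT_trivialμX_assoc,
      Category.comp_id]
  exact Mod.hom_ext _ _ h'

lemma trivialμ_natural_right (X : E) {Y Y' : E} (f : Y ⟶ Y') :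
    a.trivial.obj X ◁ a.trivial.map f ≫ a.trivialμ X Y' =
      a.trivialμ X Y ≫ a.trivial.map (X ◁ f) := by
  have h : a.πT X Y ≫ (a.trivial.obj X ◁ a.trivial.map f).hom = X ◁ f ≫ a.πT X Y' :=
    π_whiskerLeft _ _
  have h' : (a.trivial.obj X ◁ a.trivial.map f).hom ≫ a.trivialμX X Y' =
      a.trivialμX X Y ≫ X ◁ f := by
    rw [← cancel_epi (a.πT X Y), reassoc_of% h, πT_trivialμX, πT_trivialμX_assoc,
      Category.comp_id]
  exact Mod.hom_ext _ _ h'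

lemma trivialμ_associativity (X Y Z : E) :
    a.trivialμ X Y ▷ a.trivial.obj Z ≫ a.trivialμ (X ⊗ Y) Z ≫ a.trivial.map (α_ X Y Z).hom =
      (α_ _ _ _).hom ≫ a.trivial.obj X ◁ a.trivialμ Y Z ≫ a.trivialμ X (Y ⊗ Z) := by
  -- The projections are restated with `Z` and `X` in place of the definitionally equal underlying
  -- objects of trivial modules, so that the rewriting below matches syntactically.
  obtain ⟨r, hr⟩ : ∃ r : (a.trivial.obj X ⊗ a.trivial.obj Y : Mod E B).X ⊗ Z ⟶
      ((a.trivial.obj X ⊗ a.trivial.obj Y) ⊗ a.trivial.obj Z : Mod E B).X,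
      r = π (a.trivial.obj X ⊗ a.trivial.obj Y) (a.trivial.obj Z) := ⟨_, rfl⟩
  obtain ⟨r', hr'⟩ : ∃ r : X ⊗ (a.trivial.obj Y ⊗ a.trivial.obj Z : Mod E B).X ⟶
      (a.trivial.obj X ⊗ (a.trivial.obj Y ⊗ a.trivial.obj Z) : Mod E B).X,
      r = π (a.trivial.obj X) (a.trivial.obj Y ⊗ a.trivial.obj Z) := ⟨_, rfl⟩
  have h₁ : r ≫ (a.trivialμ X Y ▷ a.trivial.obj Z).hom =
      a.trivialμX X Y ▷ Z ≫ a.πT (X ⊗ Y) Z := by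
    rw [hr]; exact π_whiskerRight _ _
  have h₂ : r' ≫ (a.trivial.obj X ◁ a.trivialμ Y Z).hom =
      X ◁ a.trivialμX Y Z ≫ a.πT X (Y ⊗ Z) := by
    rw [hr']; exact π_whiskerLeft _ _
  have h₃ : a.πT X Y ▷ Z ≫ r ≫
        (α_ (a.trivial.obj X) (a.trivial.obj Y) (a.trivial.obj Z)).hom.hom =
      (α_ X Y Z).hom ≫ X ◁ a.πT Y Z ≫ r' := by
    rw [hr, hr']
    exact π_α (a.trivial.obj X) (a.trivial.obj Y) (a.trivial.obj Z)
  have key : a.πT X Y ▷ Z ≫ r ≫ (a.trivialμ X Y ▷ a.trivial.obj Z).hom ≫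
      a.trivialμX (X ⊗ Y) Z ≫ (α_ X Y Z).hom =
    a.πT X Y ▷ Z ≫ r ≫ (α_ (a.trivial.obj X) (a.trivial.obj Y) (a.trivial.obj Z)).hom.hom ≫
      (a.trivial.obj X ◁ a.trivialμ Y Z).hom ≫ a.trivialμX X (Y ⊗ Z) := by
    rw [reassoc_of% h₃, reassoc_of% h₂, reassoc_of% h₁, πT_trivialμX, πT_trivialμX_assoc,
      ← comp_whiskerRight_assoc, πT_trivialμX, ← MonoidalCategory.whiskerLeft_comp_assoc,
      πT_trivialμX]
    simp
  rw [hr] at key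
  exact tensor_hom_ext ((cancel_epi (a.πT X Y ▷ Z)).1 key)

/-- The restriction along the augmentation is lax monoidal. -/
instance : a.trivial.LaxMonoidal where
  ε := mkHom (M := 𝟙_ (Mod E B)) (N := a.trivial.obj (𝟙_ E)) a.hom (by
    change MonObj.mul (X := B) ≫ a.hom = B ◁ a.hom ≫ a.hom ▷ _ ≫ (λ_ _).hom
    rw [a.mul, MonoidalCategory.tensorHom_def', Category.assoc])
  μ X Y := a.trivialμ X Y
  μ_natural_left f Y := a.trivialμ_natural_left f Y
  μ_natural_right X f := a.trivialμ_natural_right X f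
  associativity X Y Z := a.trivialμ_associativity X Y Z
  left_unitality X := by
    refine tensor_hom_ext ?_
    refine (π_leftUnitor (a.trivial.obj X)).trans ?_
    refine Eq.trans ?_ (π_whiskerRight_assoc _ _ _).symm
    change a.act X = a.hom ▷ X ≫ a.πT (𝟙_ E) X ≫ a.trivialμX (𝟙_ E) X ≫ (λ_ X).hom
    rw [πT_trivialμX_assoc, act]
  right_unitality X := by
    refine tensor_hom_ext ?_
    refine (π_rightUnitor (a.trivial.obj X)).trans ?_
    refine Eq.trans ?_ (π_whiskerLeft_assoc _ _ _).symm
    change (β_ X B).hom ≫ a.act X =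
      X ◁ a.hom ≫ a.πT X (𝟙_ E) ≫ a.trivialμX X (𝟙_ E) ≫ (ρ_ X).hom
    rw [πT_trivialμX_assoc, act, ← BraidedCategory.braiding_naturality_right_assoc]
    simp

/-- Base change is oplax monoidal, being left adjoint to a lax monoidal functor. -/
instance baseChangeOplax : a.baseChange.OplaxMonoidal := a.baseChangeAdj.leftAdjointOplaxMonoidal

instance : a.baseChangeAdj.IsMonoidal := inferInstance

/-- The projection of the relative tensor product. -/
def pT (M N : Mod E B) : M.X ⊗ N.X ⟶ a.baseChange.obj (M ⊗ N) := π M N ≫ a.p (M ⊗ N)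

instance (M N : Mod E B) : Epi (a.pT M N) := epi_comp _ _

instance (M N : Mod E B) : Epi (a.p M ⊗ₘ a.p N) := by
  have : Epi (a.p M ▷ N.X) := epi_whiskerRight_π _ _ _
  have : Epi (a.baseChange.obj M ◁ a.p N) := epi_whiskerLeft_π _ _ _
  rw [MonoidalCategory.tensorHom_def]
  infer_instance

/-- The unit of a monoidal adjunction is monoidal, and the lax structure of `trivial` is the
identity before passing to the quotient. As `pT` is an epimorphism, this determines `δ`. -/
lemma pT_δ (M N : Mod E B) : a.pT M N ≫ δ a.baseChange M N = a.p M ⊗ₘ a.p N := by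
  have h : (a.baseChangeAdj.unit.app (M ⊗ N)).hom ≫ (a.trivial.map (δ a.baseChange M N)).hom =
      (a.baseChangeAdj.unit.app M ⊗ₘ a.baseChangeAdj.unit.app N).hom ≫ a.trivialμX _ _ :=
    congrArg Mod.Hom.hom (a.baseChangeAdj.unit_app_tensor_comp_map_δ M N)
  refine (Category.assoc _ _ _).trans ((π M N ≫= h).trans ((π_tensorHom_assoc _ _ _).trans ?_))
  exact (_ ≫= a.πT_trivialμX _ _).trans (Category.comp_id _)

lemma p_η : a.p (𝟙_ (Mod E B)) ≫ η a.baseChange = a.hom :=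
  congrArg Mod.Hom.hom a.baseChangeAdj.unit_app_unit_comp_map_η

/-- The base change of `B` itself is the unit object; the inverse of `η` is the class of `1`. -/
instance : IsIso (η a.baseChange) := by
  obtain ⟨r, hr⟩ : ∃ r : B ⟶ a.baseChange.obj (𝟙_ (Mod E B)), r = a.p (𝟙_ (Mod E B)) := ⟨_, rfl⟩
  have h₁ : r ≫ η a.baseChange = a.hom := by rw [hr]; exact a.p_η
  have h₂ : MonObj.mul (X := B) ≫ r = a.act B ≫ r := by rw [hr]; exact a.act_p (Mod.regular B)
  have : Epi r := by rw [hr]; exact inferInstanceAs (Epi (a.p (𝟙_ (Mod E B))))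
  refine ⟨MonObj.one (X := B) ≫ r, ?_, ?_⟩
  -- The relation `h₂` at `b ⊗ 1` says that the class of `b` is `a b` times the class of `1`.
  · have h₃ : a.hom ≫ MonObj.one (X := B) ≫ r = r := by
      have h := ((ρ_ B).inv ≫ B ◁ MonObj.one (X := B)) ≫= h₂
      rw [Category.assoc, Category.assoc, MonObj.mul_one_assoc, Iso.inv_hom_id_assoc] at h
      refine Eq.trans ?_ h.symm
      rw [← act_naturality_assoc, act, Category.assoc, ← rightUnitor_inv_naturality_assoc]
      rw [← unitors_inv_equal, Iso.inv_hom_id_assoc]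
    rw [← cancel_epi r, reassoc_of% h₁, h₃, Category.comp_id]
  · rw [Category.assoc, h₁, a.one]

/-- In the base change of the relative tensor product, acting on one factor is acting on the whole,
hence acting through the augmentation. With `whiskerLeft_act_pT`, this lets `pT` descend to the base
change of each factor. -/
lemma whiskerRight_act_pT (M N : Mod E B) :
    TensorCategories.act M ▷ N.X ≫ a.pT M N = a.act M.X ▷ N.X ≫ a.pT M N := by
  have h : TensorCategories.act M ▷ N.X ≫ π M N =
    (α_ _ _ _).hom ≫ B ◁ π M N ≫ TensorCategories.act (M ⊗ N) := whiskerRight_act_q M N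
  rw [pT, reassoc_of% h, act_p, ← act_naturality_assoc, act_tensor]
  simp

lemma whiskerLeft_act_pT (M N : Mod E B) :
    M.X ◁ TensorCategories.act N ≫ a.pT M N = M.X ◁ a.act N.X ≫ a.pT M N := by
  have h : M.X ◁ TensorCategories.act N ≫ π M N =
    swp M.X B N.X ≫ B ◁ π M N ≫ TensorCategories.act (M ⊗ N) := whiskerLeft_act_q M N
  have h' : swp M.X B N.X ≫ a.act (M.X ⊗ N.X) = M.X ◁ a.act N.X := by
    rw [← actR_trivial]
    exact swp_swp_assoc _ _ _ _
  rw [pT, reassoc_of% h, act_p, ← act_naturality_assoc, reassoc_of% h']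

lemma exists_pT_desc (M N : Mod E B) :
    ∃ k : a.baseChange.obj M ⊗ a.baseChange.obj N ⟶ a.baseChange.obj (M ⊗ N),
      (a.p M ⊗ₘ a.p N) ≫ k = a.pT M N := by
  obtain ⟨k, hk⟩ := exists_desc_whiskerRight _ _ N.X (a.pT M N) (a.whiskerRight_act_pT M N)
  have hk' : a.p M ▷ N.X ≫ k = a.pT M N := hk
  -- The descent in the second variable is tested after the epimorphism `a.p M ▷ (B ⊗ N.X)`, where
  -- it becomes the relation for the second factor.
  obtain ⟨l, hl⟩ := exists_desc_whiskerLeft (TensorCategories.act N) (a.act N.X)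
    (a.baseChange.obj M) k (by
      have : Epi (a.p M ▷ (B ⊗ N.X)) := epi_whiskerRight_π _ _ _
      rw [← cancel_epi (a.p M ▷ (B ⊗ N.X))]
      refine (whisker_exchange_assoc _ _ _).symm.trans ?_
      refine Eq.trans ?_ (whisker_exchange_assoc _ _ _)
      refine (_ ≫= hk').trans (Eq.trans ?_ (_ ≫= hk').symm)
      exact a.whiskerLeft_act_pT M N)
  refine ⟨l, ?_⟩
  rw [MonoidalCategory.tensorHom_def]
  exact (Category.assoc _ _ _).trans ((_ ≫= hl).trans hk')

/-- Both sides are quotients of `M.X ⊗ N.X`, and each quotient map factors through the other. -/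
instance (M N : Mod E B) : IsIso (δ a.baseChange M N) := by
  obtain ⟨k, hk⟩ := a.exists_pT_desc M N
  refine ⟨k, ?_, ?_⟩
  · rw [← cancel_epi (a.pT M N), reassoc_of% pT_δ, hk, Category.comp_id]
  · rw [← cancel_epi (a.p M ⊗ₘ a.p N), reassoc_of% hk, pT_δ, Category.comp_id]

/-- Base change is strong monoidal. -/
instance baseChangeMonoidal : a.baseChange.Monoidal where
  toLaxMonoidal := (Functor.Monoidal.ofOplaxMonoidal a.baseChange).toLaxMonoidal
  toOplaxMonoidal := a.baseChangeOplax
  ε_η := (Functor.Monoidal.ofOplaxMonoidal a.baseChange).ε_η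
  η_ε := (Functor.Monoidal.ofOplaxMonoidal a.baseChange).η_ε
  μ_δ := (Functor.Monoidal.ofOplaxMonoidal a.baseChange).μ_δ
  δ_μ := (Functor.Monoidal.ofOplaxMonoidal a.baseChange).δ_μ

lemma baseChange_map_braiding (M N : Mod E B) :
    a.baseChange.map (β_ M N).hom ≫ δ a.baseChange N M =
      δ a.baseChange M N ≫ (β_ (a.baseChange.obj M) (a.baseChange.obj N)).hom := by
  rw [← cancel_epi (a.pT M N), reassoc_of% pT_δ, pT, Category.assoc, p_map_assoc,
    ← Category.assoc, π_braiding, Category.assoc, BraidedCategory.braiding_naturality, ← pT_δ, pT,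
    Category.assoc]

/-- Base change is symmetric strong monoidal. -/
instance : a.baseChange.Braided where
  braided M N := by
    have h := a.baseChange_map_braiding M N =≫ μ a.baseChange N M
    rw [Category.assoc, Category.assoc, Functor.Monoidal.δ_μ, Category.comp_id] at h
    rw [h, Functor.Monoidal.μ_δ_assoc]

/-- The unit of the free module followed by the projection to the base change. -/
def unitBaseChange (X : E) : X ⟶ a.baseChange.obj ((free B).obj X) :=
  unitFree B X ≫ a.p ((free B).obj X)

lemma unitBaseChange_naturality {X Y : E} (f : X ⟶ Y) :
    f ≫ a.unitBaseChange Y = a.unitBaseChange X ≫ a.baseChange.map ((free B).map f) := by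
  rw [unitBaseChange, unitBaseChange, Category.assoc, p_map, reassoc_of% unitFree_map B f]

set_option linter.unusedSectionVars false in
-- The action through the augmentation, as a morphism `B ⊗ X ⟶ X`, identifies the two actions on the
-- free module because the augmentation is multiplicative. The descended morphism is the inverse of
-- `unitBaseChange`.
lemma exists_unitBaseChange_inv (X : E) :
    ∃ k : a.baseChange.obj ((free B).obj X) ⟶ X, a.p ((free B).obj X) ≫ k = a.act X :=
  a.exists_desc (M := (free B).obj X) (a.act X) (by
    have h : ((α_ B B X).inv ≫ MonObj.mul (X := B) ▷ X) ≫ a.act X =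
        a.act (B ⊗ X) ≫ a.act X := by
      rw [Category.assoc, mul_act, act_naturality]
      simp
    exact h)

instance (X : E) : IsIso (a.unitBaseChange X) := by
  obtain ⟨k, hk⟩ := a.exists_unitBaseChange_inv X
  have h₁ : a.unitBaseChange X ≫ k = 𝟙 X := by
    refine (Category.assoc _ _ _).trans ((_ ≫= hk).trans ?_)
    have e : ((λ_ X).inv ≫ MonObj.one (X := B) ▷ X) ≫ a.act X = 𝟙 X := by
      rw [Category.assoc, a.one_act, Iso.inv_hom_id]
    exact e
  -- In the base change, the class of `b ⊗ x` is `a b` times the class of `1 ⊗ x`.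
  have h₂ : a.act X ≫ a.unitBaseChange X = a.p ((free B).obj X) := by
    have e := B ◁ unitFree B X ≫= a.act_p ((free B).obj X)
    have e' : (B ◁ unitFree B X ≫ TensorCategories.act ((free B).obj X)) ≫
        a.p ((free B).obj X) = a.p ((free B).obj X) :=
      (map_unitFree_act B X =≫ _).trans (Category.id_comp _)
    rw [unitBaseChange, act_naturality_assoc, ← e, ← Category.assoc, e']
  refine ⟨k, h₁, ?_⟩
  rw [← cancel_epi (a.p ((free B).obj X))]
  exact (Category.assoc _ _ _).symm.trans ((hk =≫ _).trans (h₂.trans (Category.comp_id _).symm))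

/-- The component at `X` of the unit of the base change of free modules. -/
def unitBaseChangeIso (X : E) : X ≅ a.baseChange.obj ((free B).obj X) :=
  asIso (a.unitBaseChange X)

/-- The base change of a free module. -/
def freeBaseChangeIso : free B ⋙ a.baseChange ≅ 𝟭 E :=
  (NatIso.ofComponents (fun X => a.unitBaseChangeIso X)
    (fun f => a.unitBaseChange_naturality f) : 𝟭 E ≅ free B ⋙ a.baseChange).symm

lemma unitBaseChange_freeBaseChangeIso (X : E) :
    a.unitBaseChange X ≫ a.freeBaseChangeIso.hom.app X = 𝟙 X :=
  (a.unitBaseChangeIso X).hom_inv_id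

lemma unitBaseChange_η :
    a.unitBaseChange (𝟙_ E) ≫ a.baseChange.map (η (free B)) ≫ η a.baseChange = 𝟙 _ := by
  rw [unitBaseChange, Category.assoc, p_map_assoc, p_η]
  exact (Category.assoc _ _ _).symm.trans ((unitFree_η B =≫ _).trans a.one)

lemma unitBaseChange_δ (X Y : E) :
    a.unitBaseChange (X ⊗ Y) ≫ a.baseChange.map (δ (free B) X Y) ≫ δ a.baseChange _ _ =
      a.unitBaseChange X ⊗ₘ a.unitBaseChange Y := by
  rw [unitBaseChange, Category.assoc, p_map_assoc]
  refine (Category.assoc _ _ _).symm.trans ((unitFree_δ B X Y =≫ _).trans ?_)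
  refine (Category.assoc _ _ _).trans ?_
  refine (_ ≫= ((Category.assoc _ _ _).symm.trans (a.pT_δ ((free B).obj X) ((free B).obj Y)))).trans
    ?_
  rw [tensorHom_comp_tensorHom]
  rfl

instance : NatTrans.IsMonoidal a.freeBaseChangeIso.hom where
  unit := by
    rw [Functor.LaxMonoidal.comp_ε, Functor.LaxMonoidal.id_ε]
    have h := a.unitBaseChange_η =≫ (ε a.baseChange ≫ a.baseChange.map (ε (free B)))
    have e : a.baseChange.map (η (free B)) ≫ a.baseChange.map (ε (free B)) = 𝟙 _ := by
      rw [← Functor.map_comp, Functor.Monoidal.η_ε]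
      exact CategoryTheory.Functor.map_id _ _
    rw [Category.id_comp, Category.assoc, Category.assoc, Functor.Monoidal.η_ε_assoc, e] at h
    rw [← h, Category.comp_id]
    exact a.unitBaseChange_freeBaseChangeIso _
  tensor X Y := by
    have h := a.unitBaseChange_δ X Y =≫
      (μ a.baseChange _ _ ≫ a.baseChange.map (μ (free B) X Y) ≫ a.freeBaseChangeIso.hom.app (X ⊗ Y))
    have e : a.baseChange.map (δ (free B) X Y) ≫ a.baseChange.map (μ (free B) X Y) = 𝟙 _ := by
      rw [← Functor.map_comp, Functor.Monoidal.δ_μ]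
      exact CategoryTheory.Functor.map_id _ _
    rw [Category.assoc, Category.assoc, Functor.Monoidal.δ_μ_assoc, reassoc_of% e] at h
    rw [Functor.LaxMonoidal.comp_μ, Functor.LaxMonoidal.id_μ]
    have h₂ := a.unitBaseChange_freeBaseChangeIso
    rw [← cancel_epi (a.unitBaseChange X ⊗ₘ a.unitBaseChange Y), Category.assoc]
    refine h.symm.trans ((h₂ _).trans ?_)
    refine Eq.trans ?_ (tensorHom_comp_tensorHom_assoc _ _ _ _ _).symm
    refine Eq.trans ?_ (congrArg₂ (fun f g => (f ⊗ₘ g) ≫ 𝟙 _) (h₂ X) (h₂ Y)).symm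
    simp

/-- Base change recovers the augmentation from the multiplication of `B`, as needed for the extended
functor to induce the prescribed augmentation. -/
lemma freeBaseChangeIso_hom :
    a.freeBaseChangeIso.hom.app B ≫ a.hom =
      a.baseChange.map (freeCounitUnit B) ≫ η a.baseChange := by
  rw [← cancel_epi (a.unitBaseChange B)]
  refine (Category.assoc _ _ _).symm.trans ((a.unitBaseChange_freeBaseChangeIso B =≫ _).trans ?_)
  rw [unitBaseChange, Category.assoc, p_map_assoc, p_η]
  refine Eq.trans ?_ (Category.assoc _ _ _)
  exact (unitFree_freeCounitUnit B =≫ a.hom).symm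

end Augmentation

end BaseChange

/-! ### Functors on modules and the augmentations which they induce. -/

section Universal

open Functor.LaxMonoidal Functor.OplaxMonoidal

universe v'' u''

variable {C : Type u} [Category.{v} C] [MonoidalCategory C] [SymmetricCategory C]
  [HasCoequalizers C] [∀ X : C, PreservesColimitsOfShape WalkingParallelPair (tensorLeft X)]
  {D : Type u'} [Category.{v'} D] [MonoidalCategory D] [SymmetricCategory D]
  [HasCoequalizers D] [∀ X : D, PreservesColimitsOfShape WalkingParallelPair (tensorLeft X)]
  (F : C ⥤ D) [F.Braided] [PreservesColimitsOfShape WalkingParallelPair F]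
  (A : C) [MonObj A] [IsCommMonObj A]

/-- The isomorphism of free modules is compatible with the multiplication of the algebra. -/
lemma freeIso_freeCounitUnit :
    (freeIso F A).hom.app A ≫ (induced F A).map (freeCounitUnit A) ≫ η (induced F A) =
      freeCounitUnit (F.obj A) := by
  obtain ⟨e, he⟩ : ∃ e : F.obj A ⟶ (Mod.regular (F.obj A)).X,
    e = (η (induced F A)).hom := ⟨_, rfl⟩
  obtain ⟨n, hn⟩ : ∃ n : ((free A).obj A).X ⟶ A, n = (freeCounitUnit A).hom := ⟨_, rfl⟩
  have he' : e = 𝟙 (F.obj A) := by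
    rw [he]
    have h : 𝟙 (F.obj A) ≫ (η (induced F A)).hom = 𝟙 (F.obj A) :=
      congrArg Mod.Hom.hom (Functor.Monoidal.ε_η (induced F A))
    exact (Category.id_comp _).symm.trans h
  have hu : unitFree A A ≫ n = 𝟙 A := by rw [hn]; exact unitFree_freeCounitUnit A
  have hu' : unitFree (F.obj A) (F.obj A) ≫ (freeCounitUnit (F.obj A)).hom = 𝟙 (F.obj A) :=
    unitFree_freeCounitUnit (F.obj A)
  -- Both sides of the goal have the identity of `F A` as transpose, since `unitFree` is a section
  -- of the multiplication and `η (induced F A)` is the identity on underlying objects.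
  have key : unitFree (F.obj A) (F.obj A) ≫ freeIsoX F A A ≫ F.map n ≫ e = 𝟙 (F.obj A) := by
    rw [reassoc_of% unitFree_freeIsoX, ← F.map_comp_assoc, hu, he', F.map_id]
    exact Category.comp_id _
  rw [he, hn] at key
  exact free_hom_ext (key.trans hu'.symm)

variable {F A}

section

variable {E : Type u''} [Category.{v''} E] [MonoidalCategory E] {G : C ⥤ E} [G.Monoidal]
  {K : Mod C A ⥤ E} [K.Monoidal] (s : G ⟶ free A ⋙ K) [s.IsMonoidal]

/-- With `mul_augmentation`, shows that `G A ⟶ K (A ⊗ A) ⟶ K A ⟶ 𝟙_` is a morphism of algebras. Here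
monoidality of `s` and the retraction `ε_free_map_one` give the unit law. -/
lemma one_augmentation : ε G ≫ G.map (MonObj.one (X := A)) ≫
    s.app A ≫ K.map (freeCounitUnit A) ≫ η K = 𝟙 _ := by
  have h := NatTrans.IsMonoidal.unit (τ := s)
  rw [Functor.LaxMonoidal.comp_ε] at h
  have h' : G.map (MonObj.one (X := A)) ≫ s.app A =
    s.app (𝟙_ C) ≫ K.map ((free A).map (MonObj.one (X := A))) := s.naturality _
  have e : K.map (ε (free A)) ≫ K.map ((free A).map (MonObj.one (X := A))) ≫
      K.map (freeCounitUnit A) = 𝟙 _ := by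
    rw [← K.map_comp, ← K.map_comp, ε_free_map_one, K.map_id]
  rw [reassoc_of% h', reassoc_of% h, reassoc_of% e, Functor.Monoidal.ε_η]

/-- The case of two copies of the unit module in `freeCounit_tensor`: there the projection to the
relative tensor product, followed by the unitor, is the multiplication of `A`. -/
lemma mul_freeCounitUnit :
    μ (free A) A A ≫ (free A).map (MonObj.mul (X := A)) ≫ freeCounitUnit A =
      (freeCounitUnit A ⊗ₘ freeCounitUnit A) ≫ (λ_ (𝟙_ (Mod C A))).hom := by
  have h := freeCounit_tensor A (𝟙_ (Mod C A)) (𝟙_ (Mod C A)) =≫ (λ_ (𝟙_ (Mod C A))).hom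
  rw [Category.assoc, Category.assoc, ← free_map_freeCounit, ← Functor.map_comp_assoc,
    π_leftUnitor] at h
  exact h

lemma mul_augmentation : μ G A A ≫ G.map (MonObj.mul (X := A)) ≫
      s.app A ≫ K.map (freeCounitUnit A) ≫ η K =
    ((s.app A ≫ K.map (freeCounitUnit A) ≫ η K) ⊗ₘ (s.app A ≫ K.map (freeCounitUnit A) ≫ η K)) ≫
      (λ_ (𝟙_ E)).hom := by
  have h := NatTrans.IsMonoidal.tensor (τ := s) A A
  rw [Functor.LaxMonoidal.comp_μ] at h
  have h' : G.map (MonObj.mul (X := A)) ≫ s.app A =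
    s.app (A ⊗ A) ≫ K.map ((free A).map (MonObj.mul (X := A))) := s.naturality _
  have e : K.map (μ (free A) A A) ≫ K.map ((free A).map (MonObj.mul (X := A))) ≫
      K.map (freeCounitUnit A) = K.map (freeCounitUnit A ⊗ₘ freeCounitUnit A) ≫
        K.map (λ_ (𝟙_ (Mod C A))).hom := by
    rw [← K.map_comp, ← K.map_comp, mul_freeCounitUnit, K.map_comp]
  have e' : μ K (𝟙_ _) (𝟙_ _) ≫ K.map (λ_ (𝟙_ (Mod C A))).hom ≫ η K =
      (η K ⊗ₘ η K) ≫ (λ_ (𝟙_ E)).hom := by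
    rw [Functor.Monoidal.map_leftUnitor, Category.assoc, Category.assoc,
      Functor.Monoidal.μ_δ_assoc, MonoidalCategory.tensorHom_def, Category.assoc,
      leftUnitor_naturality]
  rw [reassoc_of% h', reassoc_of% h, reassoc_of% e, ← Functor.LaxMonoidal.μ_natural_assoc, e',
    ← tensorHom_comp_tensorHom_assoc, ← tensorHom_comp_tensorHom_assoc]

end

section

variable {E : Type u''} [Category.{v''} E] [MonoidalCategory E]
  {L : D ⥤ E} [L.Monoidal] {K : Mod C A ⥤ E} [K.Monoidal]
  (s : F ⋙ L ⟶ free A ⋙ K) [s.IsMonoidal]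

/-- The augmentation of `L (F A)` determined by a functor on `A`-modules whose restriction to free
modules is `F ⋙ L`. -/
def augmentation : Augmentation (L.obj (F.obj A)) where
  hom := s.app A ≫ K.map (freeCounitUnit A) ≫ η K
  one := by
    have h := one_augmentation s
    rw [Functor.LaxMonoidal.comp_ε, Category.assoc] at h
    refine Eq.trans ?_ h
    -- The unit of the algebra `L (F A)` is transported in two stages, whereas `h` concerns the
    -- composite `F ⋙ L`; likewise for the multiplication below.
    change (ε L ≫ L.map (ε F ≫ F.map _)) ≫ _ = _
    rw [L.map_comp, Category.assoc, Category.assoc]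
    rfl
  mul := by
    have h := mul_augmentation s
    rw [Functor.LaxMonoidal.comp_μ, Category.assoc] at h
    refine Eq.trans ?_ h
    change (μ L _ _ ≫ L.map (μ F _ _ ≫ F.map _)) ≫ _ = _
    rw [L.map_comp, Category.assoc, Category.assoc]
    rfl

end

section

variable {E : Type u''} [Category.{v''} E] [MonoidalCategory E]  [SymmetricCategory E]
  [HasCoequalizers E] [∀ X : E, PreservesColimitsOfShape WalkingParallelPair (tensorLeft X)]
  (L : D ⥤ E) [L.Braided] [PreservesColimitsOfShape WalkingParallelPair L]
  {B : D} [MonObj B] [IsCommMonObj B] (a : Augmentation (L.obj B))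

/-- The extension of `L` to `B`-modules along an augmentation of `L B` restricts to `L` on free
modules. -/
def freeExtensionIso : free B ⋙ induced L B ⋙ a.baseChange ≅ L :=
  Functor.isoWhiskerRight (freeIso L B).symm a.baseChange ≪≫
    Functor.isoWhiskerLeft L a.freeBaseChangeIso

instance freeExtensionIso_isMonoidal : NatTrans.IsMonoidal (freeExtensionIso L a).hom := by
  have h₁ : NatTrans.IsMonoidal (Functor.whiskerRight (freeIso L B).inv a.baseChange) :=
    inferInstance
  have h₂ : NatTrans.IsMonoidal (Functor.whiskerLeft L a.freeBaseChangeIso.hom) := inferInstance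
  -- The coherence isomorphisms have identity components; inserting them presents the transformation
  -- as a composite of monoidal ones.
  have h₃ : NatTrans.IsMonoidal ((Functor.associator (free B) (induced L B) a.baseChange).inv ≫
    Functor.whiskerRight (freeIso L B).inv a.baseChange ≫
    (Functor.associator L (free (L.obj B)) a.baseChange).hom ≫
    Functor.whiskerLeft L a.freeBaseChangeIso.hom ≫ L.rightUnitor.hom) := inferInstance
  convert h₃
  ext X
  simp [freeExtensionIso]

/-- The extension of `L` built from `a` induces `a` back. This is the hypothesis under which
`exists_iso_induced` compares it with `K`. -/
lemma freeExtensionIso_hom :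
    (freeExtensionIso L a).inv.app B ≫ (induced L B ⋙ a.baseChange).map (freeCounitUnit B) ≫
      η (induced L B ⋙ a.baseChange) = a.hom := by
  have h : (freeExtensionIso L a).inv.app B = a.freeBaseChangeIso.inv.app (L.obj B) ≫
    a.baseChange.map ((freeIso L B).hom.app B) := rfl
  rw [h, Functor.OplaxMonoidal.comp_η, Category.assoc]
  have h' : a.baseChange.map ((freeIso L B).hom.app B) ≫
      a.baseChange.map ((induced L B).map (freeCounitUnit B)) ≫ a.baseChange.map (η (induced L B)) =
        a.baseChange.map (freeCounitUnit (L.obj B)) := by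
    rw [← Functor.map_comp, ← Functor.map_comp, freeIso_freeCounitUnit]
  have h'' := h' =≫ η a.baseChange
  rw [Category.assoc, Category.assoc] at h''
  refine (_ ≫= h'').trans ?_
  rw [← a.freeBaseChangeIso_hom]
  exact Iso.inv_hom_id_app_assoc _ _ _

end

section

variable {E : Type u''} [Category.{v''} E] [MonoidalCategory E]
  [∀ X : E, (tensorLeft X).PreservesEpimorphisms]
  [∀ X : E, (tensorRight X).PreservesEpimorphisms]
  [PreservesColimitsOfShape WalkingParallelPair (induced F A)]
  {H H' : Mod D (F.obj A) ⥤ E} [H.Monoidal] [H'.Monoidal]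
  [PreservesColimitsOfShape WalkingParallelPair H]

/-- A monoidal functor on `A`-modules is determined by its restriction to free modules and the
augmentation which it induces. -/
lemma exists_iso_induced {L : D ⥤ E} [L.Monoidal] {K : Mod C A ⥤ E} [K.Monoidal]
    [PreservesColimitsOfShape WalkingParallelPair K]
    (σ : free A ⋙ K ≅ F ⋙ L) [σ.hom.IsMonoidal] (l : free (F.obj A) ⋙ H ≅ L) [l.hom.IsMonoidal]
    (hl : l.inv.app (F.obj A) ≫ H.map (freeCounitUnit (F.obj A)) ≫ η H =
      σ.inv.app A ≫ K.map (freeCounitUnit A) ≫ η K) :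
    ∃ t : K ≅ induced F A ⋙ H, t.hom.IsMonoidal ∧ ∀ X, t.inv.app ((free A).obj X) ≫ σ.hom.app X =
      H.map ((freeIso F A).inv.app X) ≫ l.hom.app (F.obj X) := by
  -- On free `A`-modules, `K` is `F ⋙ L`, hence `H` on free `F A`-modules, hence `induced F A ⋙ H`
  -- by `freeIso`.
  obtain ⟨s, hs⟩ : ∃ s : free A ⋙ K ≅ free A ⋙ induced F A ⋙ H, s = σ ≪≫
    Functor.isoWhiskerLeft F l.symm ≪≫ Functor.isoWhiskerRight (freeIso F A) H := ⟨_, rfl⟩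
  have hs' (X : C) : s.hom.app X =
      σ.hom.app X ≫ l.inv.app (F.obj X) ≫ H.map ((freeIso F A).hom.app X) := by
    rw [hs]
    rfl
  have : s.hom.IsMonoidal := by
    have h₁ : NatTrans.IsMonoidal (Functor.whiskerLeft F l.inv) := inferInstance
    have h₂ : NatTrans.IsMonoidal (Functor.whiskerRight (freeIso F A).hom H) := inferInstance
    have h₃ : NatTrans.IsMonoidal (σ.hom ≫ Functor.whiskerLeft F l.inv ≫
      (Functor.associator F (free (F.obj A)) H).inv ≫
      Functor.whiskerRight (freeIso F A).hom H ≫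
      (Functor.associator (free A) (induced F A) H).hom) := inferInstance
    convert h₃
    ext X
    rw [hs']
    simp
  -- Equality of the augmentations, in the form of the condition `mul` which allows `s` to extend to
  -- all `A`-modules.
  have hm : s.hom.app A ≫ (induced F A ⋙ H).map (freeCounitUnit A) ≫ η (induced F A ⋙ H) =
      K.map (freeCounitUnit A) ≫ η K := by
    have h' : H.map ((freeIso F A).hom.app A) ≫
        H.map ((induced F A).map (freeCounitUnit A)) ≫ H.map (η (induced F A)) =
          H.map (freeCounitUnit (F.obj A)) := by
      rw [← Functor.map_comp, ← Functor.map_comp, freeIso_freeCounitUnit]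
    rw [hs', Functor.OplaxMonoidal.comp_η, Category.assoc, Category.assoc]
    have h'' := h' =≫ η H
    rw [Category.assoc, Category.assoc] at h''
    refine (_ ≫= _ ≫= h'').trans ((_ ≫= hl).trans ?_)
    exact Iso.hom_inv_id_app_assoc _ _ _
  obtain ⟨t, ht, ht'⟩ := IsMonoidalOnFree.exists_iso_extension (H := K) (H' := induced F A ⋙ H)
    (l := fun X => s.app X) (isMonoidalOnFree_of_natTrans s.hom hm)
  refine ⟨t, ht, fun X => ?_⟩
  rw [← cancel_epi (t.hom.app ((free A).obj X)), Iso.hom_inv_id_app_assoc, ht', Iso.app_hom, hs',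
    Category.assoc, Category.assoc, ← Functor.map_comp_assoc, Iso.hom_inv_id_app]
  simp

/-- Compatible monoidal transformations on `A`-modules and on free `F A`-modules extend to all
`F A`-modules. -/
lemma exists_natTrans_induced (k : induced F A ⋙ H ⟶ induced F A ⋙ H') [k.IsMonoidal]
    (l : free (F.obj A) ⋙ H ⟶ free (F.obj A) ⋙ H') [l.IsMonoidal]
    (w : ∀ X, H.map ((freeIso F A).hom.app X) ≫ k.app ((free A).obj X) =
      l.app (F.obj X) ≫ H'.map ((freeIso F A).hom.app X)) :
    ∃ t : H ⟶ H', t.IsMonoidal ∧ Functor.whiskerLeft (induced F A) t = k ∧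
      Functor.whiskerLeft (free (F.obj A)) t = l := by
  have hη : k.app (𝟙_ _) ≫ η (induced F A ⋙ H') = η (induced F A ⋙ H) := by
    rw [← cancel_epi (ε (induced F A ⋙ H)), ← Category.assoc, NatTrans.IsMonoidal.unit,
      Functor.Monoidal.ε_η, Functor.Monoidal.ε_η]
  have e (H : Mod D (F.obj A) ⥤ E) [H.Monoidal] : H.map ((freeIso F A).hom.app A) ≫
      (induced F A ⋙ H).map (freeCounitUnit A) ≫ η (induced F A ⋙ H) =
        H.map (freeCounitUnit (F.obj A)) ≫ η H := by
    rw [← freeIso_freeCounitUnit, Functor.OplaxMonoidal.comp_η]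
    simp
  -- Where `k` enters: it is natural at `freeCounitUnit A`, whose image under the induced functor is
  -- `freeCounitUnit (F A)` up to `freeIso`, so `l` respects the augmentations.
  have hm : l.app (F.obj A) ≫ H'.map (freeCounitUnit (F.obj A)) ≫ η H' =
      H.map (freeCounitUnit (F.obj A)) ≫ η H := by
    rw [← e, ← e, ← hη, k.naturality_assoc]
    exact ((Category.assoc _ _ _).symm.trans (w A =≫ _).symm).trans (Category.assoc _ _ _)
  obtain ⟨t, ht, ht'⟩ := (isMonoidalOnFree_of_natTrans l hm).exists_extension
  -- Agreement with `k` is tested on free `A`-modules, whose images are free `F A`-modules by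
  -- `freeIso`; there `w` reduces it to agreement with `l`.
  refine ⟨t, ht, natTrans_ext_of_free fun X => ?_, NatTrans.ext (funext ht')⟩
  rw [← cancel_epi (H.map ((freeIso F A).hom.app X)), w]
  exact (t.naturality _).trans (ht' _ =≫ _)

end

end Universal

/-! ### The comparison functor is an equivalence. -/

section Pushout

open Functor.LaxMonoidal Functor.OplaxMonoidal

variable {R : Type u} [CommRing R]

instance (E : TensorCat.{v, u} R) (X : E.carrier) : (tensorRight X).PreservesEpimorphisms :=
  Functor.PreservesEpimorphisms.of_iso (BraidedCategory.tensorLeftIsoTensorRight X)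

lemma preservesCoequalizers {C D : TensorCat.{v, u} R} (F : TensorFunctor C D) :
    PreservesColimitsOfShape WalkingParallelPair F.functor :=
  inferInstance

/-- Base change along an augmentation as a tensor functor. -/
def baseChangeFunctor {E : TensorCat.{v, u} R} {B : E.carrier} [MonObj B] [IsCommMonObj B]
    (a : Augmentation B) : TensorFunctor (modCat E B) E where
  functor := a.baseChange
  braided := (inferInstance : a.baseChange.Braided)
  additive := (inferInstance : a.baseChange.Additive)
  linear := (inferInstance : a.baseChange.Linear R)
  isLeftAdjoint := (inferInstance : a.baseChange.IsLeftAdjoint)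

variable {C D : TensorCat.{v, u} R} (F : TensorFunctor C D) (A : C.carrier) [MonObj A]
  [IsCommMonObj A] (h : (induced F.functor A).IsLeftAdjoint) (E : TensorCat.{v, u} R)

/-- The comparison functor of the square of free module functors. -/
abbrev comparison := pushoutComparison (B := TensorCat.{v, u} R) (a := modCat C A) (b := D) (c := C)
  (d := modCat D (F.functor.obj A)) (freeFunctor C A) F (inducedFunctor F A h)
  (freeFunctor D (F.functor.obj A)) (squareIso F A h) E

/-- The component on `D` already determines a transformation, since it gives the values on all free
modules. -/
lemma comparison_faithful : (comparison F A h E).Faithful where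
  map_injective {H H' s t} hst := by
    change TensorFunctor (modCat D (F.functor.obj A)) E at H H'
    change TensorTrans H H' at s t
    have h₁ : Functor.whiskerLeft (free (F.functor.obj A)) s.natTrans =
        Functor.whiskerLeft (free (F.functor.obj A)) t.natTrans :=
      congrArg (fun f => TensorTrans.natTrans (CategoricalPullback.Hom.snd f)) hst
    let H₁ : Mod D.carrier (F.functor.obj A) ⥤ E.carrier := H.functor
    have : PreservesColimitsOfShape WalkingParallelPair H₁ := preservesCoequalizers H
    exact TensorTrans.ext (natTrans_ext_of_free (H := H₁) fun X => NatTrans.congr_app h₁ X)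

/-- The component on `D` is a transformation on free `F A`-modules, and its compatibility with the
component on `A`-modules is what lets it extend. -/
lemma comparison_full : (comparison F A h E).Full where
  map_surjective {H H'} f := by
    change TensorFunctor (modCat D (F.functor.obj A)) E at H H'
    let H₁ : Mod D.carrier (F.functor.obj A) ⥤ E.carrier := H.functor
    let H₂ : Mod D.carrier (F.functor.obj A) ⥤ E.carrier := H'.functor
    let : H₁.Braided := H.braided
    let : H₂.Braided := H'.braided
    have : PreservesColimitsOfShape WalkingParallelPair H₁ :=
      preservesCoequalizers H
    let k : induced F.functor A ⋙ H₁ ⟶ induced F.functor A ⋙ H₂ := f.fst.natTrans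
    let l : free (F.functor.obj A) ⋙ H₁ ⟶ free (F.functor.obj A) ⋙ H₂ := f.snd.natTrans
    have : k.IsMonoidal := f.fst.isMonoidal
    have : l.IsMonoidal := f.snd.isMonoidal
    have w (X : C.carrier) : k.app ((free A).obj X) ≫ H₂.map ((freeIso F.functor A).inv.app X) =
        H₁.map ((freeIso F.functor A).inv.app X) ≫ l.app (F.functor.obj X) := by
      -- The identities are the components of the associators in the isomorphism attached to a
      -- 1-cell by the comparison functor.
      have h₁ : k.app ((free A).obj X) ≫ (𝟙 _ ≫ H₂.map ((freeIso F.functor A).inv.app X) ≫ 𝟙 _) =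
          (𝟙 _ ≫ H₁.map ((freeIso F.functor A).inv.app X) ≫ 𝟙 _) ≫ l.app (F.functor.obj X) :=
        NatTrans.congr_app (congrArg TensorTrans.natTrans f.w) X
      refine Eq.trans ?_ (h₁.trans ?_) <;> simp
    obtain ⟨t, ht, hk, hl⟩ := exists_natTrans_induced k l (fun X => by
      rw [← cancel_mono (H₂.map ((freeIso F.functor A).inv.app X)), Category.assoc, w,
        ← Functor.map_comp_assoc, Iso.hom_inv_id_app, Category.assoc, ← Functor.map_comp,
        Iso.hom_inv_id_app]
      simp)
    exact ⟨⟨t, ht⟩, CategoricalPullback.Hom.ext (TensorTrans.ext hk) (TensorTrans.ext hl)⟩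

/-- A triple `(K, L, σ)` yields an augmentation of `L (F A)`, hence an extension of `L` to `F
A`-modules. Its restriction to `D` is `L` by `freeExtensionIso`, and its restriction to `A`-modules
is `K` because the augmentations agree. -/
lemma comparison_essSurj : (comparison F A h E).EssSurj where
  mem_essImage x := by
    let L : D.carrier ⥤ E.carrier := x.snd.functor
    let K : Mod C.carrier A ⥤ E.carrier := x.fst.functor
    let : L.Braided := x.snd.braided
    let : K.Braided := x.fst.braided
    have : PreservesColimitsOfShape WalkingParallelPair L :=
      preservesCoequalizers x.snd
    have : PreservesColimitsOfShape WalkingParallelPair K :=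
      preservesCoequalizers x.fst
    let σ : free A ⋙ K ≅ F.functor ⋙ L :=
      { hom := x.iso.hom.natTrans
        inv := x.iso.inv.natTrans
        hom_inv_id := congrArg TensorTrans.natTrans x.iso.hom_inv_id
        inv_hom_id := congrArg TensorTrans.natTrans x.iso.inv_hom_id }
    have : σ.hom.IsMonoidal := x.iso.hom.isMonoidal
    have : σ.inv.IsMonoidal := x.iso.inv.isMonoidal
    let a := augmentation σ.inv
    -- First `M ↦ L M`, from `F A`-modules to `L (F A)`-modules, then base change along `a`.
    let H : TensorFunctor (modCat D (F.functor.obj A)) E :=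
      (inducedFunctor x.snd (F.functor.obj A) (isLeftAdjoint_induced _ L)).comp (baseChangeFunctor a)
    have : PreservesColimitsOfShape WalkingParallelPair
        (induced L (F.functor.obj A) ⋙ a.baseChange) := preservesCoequalizers H
    obtain ⟨t, ht, ht'⟩ := exists_iso_induced σ (freeExtensionIso L a) (freeExtensionIso_hom L a)
    let i₁ : TensorFunctor.comp (inducedFunctor F A h) H ≅ x.fst := (tensorIso t ht).symm
    let i₂ : TensorFunctor.comp (freeFunctor D (F.functor.obj A)) H ≅ x.snd :=
      tensorIso (freeExtensionIso L a) (freeExtensionIso_isMonoidal L a)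
    refine ⟨H, ⟨CategoricalPullback.mkIso i₁ i₂ ?_⟩⟩
    refine TensorTrans.ext (NatTrans.ext (funext fun X => ?_))
    -- The last clause of `exists_iso_induced` is the compatibility of the two isomorphisms with
    -- `σ`, up to the identity components of the associators.
    refine (ht' X).trans ?_
    have e {X Y Z : E.carrier} (f : X ⟶ Y) (g : Y ⟶ Z) : f ≫ g = (𝟙 _ ≫ f ≫ 𝟙 _) ≫ g := by simp
    exact e _ _

end Pushout

end TensorCategories

end

/-- The square of tensor categories with corners `C`, `C_A`, `D`, `D_{FA}` exists in the 2-category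
of tensor categories over `R` and is a bicategorical pushout. -/
theorem proposition4 {R : Type u} [CommRing R] (C D : TensorCat.{v, u} R) (F : TensorFunctor C D)
    (A : C.carrier) [MonObj A] [IsCommMonObj A] :
    ∃ (_ : IsTensorCategory (CategoryTheory.Mod C.carrier A))
      (_ : IsTensorCategory (CategoryTheory.Mod D.carrier (F.functor.obj A)))
      (h : (induced F.functor A).IsLeftAdjoint),
      IsBipushout (B := TensorCat.{v, u} R) (a := modCat C A) (b := D) (c := C)
        (d := modCat D (F.functor.obj A)) (freeFunctor C A) F (inducedFunctor F A h)
        (freeFunctor D (F.functor.obj A)) (squareIso F A h) :=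
  ⟨inferInstance, inferInstance, isLeftAdjoint_induced A F.functor, fun E =>
    { faithful := comparison_faithful F A _ E
      full := comparison_full F A _ E
      essSurj := comparison_essSurj F A _ E }⟩
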